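/- **Theorem (coisotropic neighborhood theorem).** Let $n \ge 1$, let $L$ be a closed (compact, without boundary) connected smooth $n$-manifold, and let $M$ be a smooth $(2n-1)$-manifold (Hausdorff, second countable, without boundary) with a contact form $\alpha$, i.e. a smooth one-form with $\alpha \wedge (d\alpha)^{n-1} \neq 0$ everywhere; let $\xi = \ker \alpha$ be the contact structure, cooriented by $\alpha$. Let $\iota \colon L \hookrightarrow M$ be a coisotropic (pre-Lagrangian) embedding: a smooth embedding that is transversal to $\xi$ and such that the distribution $\iota^*\xi = \ker(\iota^*\alpha) \subset TL$ can be defined by a closed one-form. Suppose moreover that $\alpha$ is chosen so that $\iota^*\alpha$ is closed. Let $ST^*L = (T^*L \setminus L_0)/\mathbb{R}_+$ be the unit cotangent bundle of $L$, regarded as the oriented projectivization of the cotangent bundle ($L_0$ is the zero section), with projection $\pi \colon ST^*L \to L$ and with its canonical cooriented contact structure $\xi_{\mathrm{can}}$: at the ray $q$ through $p \in T^*_xL \setminus 0$ it is the kernel of $p \circ d\pi_q$, cooriented by this covector. Let $\beta \colon L \to ST^*L$ be the section sending $x$ to the ray through the covector $(\iota^*\alpha)_x$, which is nonzero by transversality.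 Then there exist an open neighborhood $U$ of $\beta(L)$ in $ST^*L$, an open neighborhood $V$ of $\iota(L)$ in $M$, and a diffeomorphism $\varphi \colon U \to V$ which is a contact diffeomorphism $(U, \xi_{\mathrm{can}}) \to (V, \xi)$ preserving coorientations, such that $\iota = \varphi \circ \beta$. -/

import Mathlib

open scoped Manifold ContDiff Topology
open Bundle

-- A vector space is a manifold modelled on itself by its identity chart: prefer this instance.
attribute [local instance 2000] chartedSpaceSelf

noncomputable section

namespace ContactNbhd

/-! ### One-forms -/

section Forms

variable {d : ℕ} {N : Type*} [TopologicalSpace N] [ChartedSpace (EuclideanSpace ℝ (Fin d)) N]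

/-- A (not necessarily continuous) one-form on the `d`-manifold `N`. -/
abbrev CovectorField (d : ℕ) (N : Type*) [TopologicalSpace N]
    [ChartedSpace (EuclideanSpace ℝ (Fin d)) N] : Type _ :=
  ∀ x : N, TangentSpace (𝓡 d) x →L[ℝ] ℝ

/-- A one-form is smooth if it is a smooth section of the cotangent bundle. -/
def IsSmoothForm [IsManifold (𝓡 d) ∞ N] (α : CovectorField d N) : Prop :=
  ContMDiff (𝓡 d) ((𝓡 d).prod 𝓘(ℝ, EuclideanSpace ℝ (Fin d) →L[ℝ] ℝ)) ∞
    (fun x => (TotalSpace.mk' (EuclideanSpace ℝ (Fin d) →L[ℝ] ℝ) x (α x) :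
      TotalSpace (EuclideanSpace ℝ (Fin d) →L[ℝ] ℝ)
        (fun x : N => TangentSpace (𝓡 d) x →L[ℝ] Trivial N ℝ x)))

/-- The pullback of the one-form `α` by the inverse of the preferred chart at `x₀`: a one-form on
(the target of that chart in) the vector space `ℝ^d`. -/
def formInChart (α : CovectorField d N) (x₀ : N) :
    EuclideanSpace ℝ (Fin d) → (EuclideanSpace ℝ (Fin d) →L[ℝ] ℝ) :=
  fun y => (α ((chartAt (EuclideanSpace ℝ (Fin d)) x₀).symm y)).comp
    (mfderiv (𝓡 d) (𝓡 d) (chartAt (EuclideanSpace ℝ (Fin d)) x₀).symm y)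

/-- The value `dα_x(u, v)` of the exterior derivative, computed in the preferred chart `c` at `x`:
if `a = (c⁻¹)^*α` and `U`, `V` are the coordinate vectors of `u`, `v`, it is
`(D_U a)(V) - (D_V a)(U)`, taken at the point `c x`. -/
def extDerivForm (α : CovectorField d N) (x : N) (u v : TangentSpace (𝓡 d) x) : ℝ :=
  let c := chartAt (EuclideanSpace ℝ (Fin d)) x
  let U : EuclideanSpace ℝ (Fin d) := mfderiv (𝓡 d) (𝓡 d) c x u
  let V : EuclideanSpace ℝ (Fin d) := mfderiv (𝓡 d) (𝓡 d) c x v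
  fderiv ℝ (formInChart α x) (c x) U V - fderiv ℝ (formInChart α x) (c x) V U

/-- A closed one-form: `dα = 0`. -/
def IsClosedForm (α : CovectorField d N) : Prop :=
  ∀ (x : N) (u v : TangentSpace (𝓡 d) x), extDerivForm α x u v = 0

/-- A contact form: a smooth nowhere vanishing one-form `α` whose differential `dα` is
nondegenerate on each hyperplane `ker α_x`, i.e. `ker α` is a completely non-integrable
hyperplane field. In dimension `d = 2n - 1` this says `α ∧ (dα)^(n-1) ≠ 0` everywhere. -/
structure IsContactForm [IsManifold (𝓡 d) ∞ N] (α : CovectorField d N) : Prop where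
  smooth : IsSmoothForm α
  ne_zero : ∀ x, α x ≠ 0
  nondegenerate : ∀ (x : N) (v : TangentSpace (𝓡 d) x), α x v = 0 →
    (∀ w : TangentSpace (𝓡 d) x, α x w = 0 → extDerivForm α x v w = 0) → v = 0

variable {k : ℕ} {L : Type*} [TopologicalSpace L] [ChartedSpace (EuclideanSpace ℝ (Fin k)) L]

/-- The pullback `f^*α`. -/
def pullbackForm (f : L → N) (α : CovectorField d N) : CovectorField k L :=
  fun x => (α (f x)).comp (mfderiv (𝓡 k) (𝓡 d) f x)

/-- Coisotropic (or pre-Lagrangian) embeddings of `L` into `N` with the contact structure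
`ker α`. -/
structure IsCoisotropicEmbedding [IsManifold (𝓡 k) ∞ L] (α : CovectorField d N) (ι : L → N) :
    Prop where
  isSmoothEmbedding : Manifold.IsSmoothEmbedding (𝓡 k) (𝓡 d) ∞ ι
  /-- `ι` is transversal to the hyperplane field `ker α`. -/
  transversal : ∀ x : L,
    LinearMap.range (mfderiv (𝓡 k) (𝓡 d) ι x).toLinearMap ⊔
      LinearMap.ker (α (ι x)).toLinearMap = ⊤
  /-- The distribution `ker (ι^*α)` on `L` can be defined by a closed one-form. -/
  exists_closed : ∃ γ : CovectorField k L, IsSmoothForm γ ∧ IsClosedForm γ ∧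
    ∀ x, LinearMap.ker (γ x).toLinearMap = LinearMap.ker (pullbackForm (k := k) ι α x).toLinearMap

theorem IsCoisotropicEmbedding.pullbackForm_ne_zero [IsManifold (𝓡 k) ∞ L]
    [IsManifold (𝓡 d) ∞ N] {α : CovectorField d N} {ι : L → N}
    (h : IsCoisotropicEmbedding (k := k) α ι) (hα : IsContactForm α) (x : L) :
    (pullbackForm (k := k) ι α x : TangentSpace (𝓡 k) x →L[ℝ] ℝ) ≠ 0 := by
  intro h0
  apply hα.ne_zero (ι x)
  have hle : LinearMap.range (mfderiv (𝓡 k) (𝓡 d) ι x).toLinearMap ≤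
      LinearMap.ker (α (ι x)).toLinearMap := by
    rintro _ ⟨v, rfl⟩
    exact congrArg (fun p : TangentSpace (𝓡 k) x →L[ℝ] ℝ => p v) h0
  have ht := h.transversal x
  rw [sup_eq_right.mpr hle] at ht
  ext v
  have hv : v ∈ LinearMap.ker (α (ι x)).toLinearMap := by rw [ht]; trivial
  exact hv

end Forms

/-! ### The unit cotangent bundle as the oriented projectivization of the cotangent bundle -/

/-- The oriented projectivization `ST^*L = (T^*L ∖ L₀) / ℝ₊` of the cotangent bundle of the
`(m+1)`-manifold `L`: an element is a point `x` of `L` together with an (open) ray in the cotangent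
space at `x`. -/
structure SphereCotangent (m : ℕ) (L : Type*) [TopologicalSpace L]
    [ChartedSpace (EuclideanSpace ℝ (Fin (m + 1))) L] where
  /-- The projection `ST^*L → L`. -/
  base : L
  /-- The ray in the cotangent space at the base point. -/
  ray : Module.Ray ℝ (TangentSpace (𝓡 (m + 1)) base →L[ℝ] ℝ)

namespace SphereCotangent

variable {m : ℕ} {L : Type*} [TopologicalSpace L]
  [ChartedSpace (EuclideanSpace ℝ (Fin (m + 1))) L]

/-- The canonical map `T^*L ∖ L₀ → ST^*L` sending a nonzero covector to its ray. -/
def mk' (x : L) (p : TangentSpace (𝓡 (m + 1)) x →L[ℝ] ℝ) (hp : p ≠ 0) : SphereCotangent m L :=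
  ⟨x, rayOfNeZero ℝ p hp⟩

/-- The section of `ST^*L` defined by a nowhere vanishing one-form. -/
def ofForm (b : CovectorField (m + 1) L)
    (hb : ∀ x, (b x : TangentSpace (𝓡 (m + 1)) x →L[ℝ] ℝ) ≠ 0) : L → SphereCotangent m L :=
  fun x => mk' x (b x) (hb x)

theorem mk'_eq_mk' {x : L} {p q : TangentSpace (𝓡 (m + 1)) x →L[ℝ] ℝ} {hp : p ≠ 0} {hq : q ≠ 0}
    {c : ℝ} (hc : 0 < c) (h : q = c • p) : mk' x p hp = mk' x q hq := by
  subst h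
  unfold mk'
  congr 1
  exact (ray_pos_smul hp hc hq).symm

theorem eq_mk' (q : SphereCotangent m L) :
    q = mk' q.base q.ray.someVector q.ray.someVector_ne_zero := by
  cases q
  simp [mk']

theorem someVector_mk' (x : L) (p : TangentSpace (𝓡 (m + 1)) x →L[ℝ] ℝ) (hp : p ≠ 0) :
    ∃ c : ℝ, 0 < c ∧ (mk' x p hp).ray.someVector = c • p := by
  have h : SameRay ℝ ((mk' x p hp).ray.someVector : TangentSpace (𝓡 (m + 1)) x →L[ℝ] ℝ) p :=
    (ray_eq_iff _ hp).mp (Module.Ray.someVector_ray (R := ℝ) (rayOfNeZero ℝ p hp))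
  obtain ⟨r, hr, h⟩ := h.exists_pos_left (mk' x p hp).ray.someVector_ne_zero hp
  exact ⟨r⁻¹, inv_pos.mpr hr, (inv_smul_eq_iff₀ hr.ne').mpr h.symm |>.symm⟩

/-- The coordinate overlap domain, in the first factor. -/
def overlap (x₀ x₁ : L) : Set (EuclideanSpace ℝ (Fin (m + 1)) × EuclideanSpace ℝ (Fin m)) :=
  {z | z.1 ∈ ((chartAt (EuclideanSpace ℝ (Fin (m + 1))) x₀).symm.trans
    (chartAt (EuclideanSpace ℝ (Fin (m + 1))) x₁)).source}

theorem isOpen_overlap (x₀ x₁ : L) : IsOpen (overlap (m := m) x₀ x₁) :=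
  ((chartAt (EuclideanSpace ℝ (Fin (m + 1))) x₀).symm.trans
    (chartAt (EuclideanSpace ℝ (Fin (m + 1))) x₁)).open_source.preimage continuous_fst

variable [IsManifold (𝓡 (m + 1)) ∞ L]

/-- The trivialization of `TL` over the domain of the preferred chart at `x₀`, given by the
coordinate vector fields. -/
abbrev triv (x₀ : L) : Trivialization (EuclideanSpace ℝ (Fin (m + 1)))
    (TotalSpace.proj : TangentBundle (𝓡 (m + 1)) L → L) :=
  trivializationAt (EuclideanSpace ℝ (Fin (m + 1))) (TangentSpace (𝓡 (m + 1))) x₀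

/-- The fibre coordinates `p_i = p(∂/∂x_i)` of a covector `p` at `x`, with respect to the
preferred chart at `x₀`. -/
def coeff (x₀ x : L) (p : TangentSpace (𝓡 (m + 1)) x →L[ℝ] ℝ) (i : Fin (m + 1)) : ℝ :=
  p ((triv (m := m) x₀).symmL ℝ x (EuclideanSpace.single i 1))

/-- The covector `∑ a_i dx_i` at `x`, with respect to the preferred chart at `x₀`. -/
def covector (x₀ x : L) (a : Fin (m + 1) → ℝ) : TangentSpace (𝓡 (m + 1)) x →L[ℝ] ℝ :=
  (∑ i, a i • (EuclideanSpace.proj i : EuclideanSpace ℝ (Fin (m + 1)) →L[ℝ] ℝ)).comp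
    ((triv (m := m) x₀).continuousLinearMapAt ℝ x)

theorem coeff_smul (x₀ x : L) (c : ℝ) (p : TangentSpace (𝓡 (m + 1)) x →L[ℝ] ℝ)
    (i : Fin (m + 1)) : coeff x₀ x (c • p) i = c * coeff x₀ x p i := rfl

theorem covector_smul (x₀ x : L) (c : ℝ) (a : Fin (m + 1) → ℝ) :
    covector x₀ x (c • a) = c • covector x₀ x a := by
  ext v
  simp [covector, Finset.mul_sum, mul_assoc]

theorem coeff_covector {x₀ x : L} (hx : x ∈ (chartAt (EuclideanSpace ℝ (Fin (m + 1))) x₀).source)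
    (a : Fin (m + 1) → ℝ) : coeff (m := m) x₀ x (covector x₀ x a) = a := by
  funext i
  have hx' : x ∈ (triv (m := m) x₀).baseSet := by simpa using hx
  simp [coeff, covector, (triv (m := m) x₀).continuousLinearMapAt_symmL hx']

theorem covector_coeff {x₀ x : L} (hx : x ∈ (chartAt (EuclideanSpace ℝ (Fin (m + 1))) x₀).source)
    (p : TangentSpace (𝓡 (m + 1)) x →L[ℝ] ℝ) : covector (m := m) x₀ x (coeff x₀ x p) = p := by
  have hx' : x ∈ (triv (m := m) x₀).baseSet := by simpa using hx
  ext v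
  have hv := (triv (m := m) x₀).symmL_continuousLinearMapAt (R := ℝ) hx' v
  set w := (triv (m := m) x₀).continuousLinearMapAt ℝ x v with hw
  have hw' : w = ∑ i, w i • EuclideanSpace.single i (1 : ℝ) := by
    ext j
    simp [Finset.sum_apply, Pi.single_apply]
  rw [← hv]
  conv_rhs => rw [hw']
  simp only [map_sum, map_smul]
  simp [covector, coeff, (triv (m := m) x₀).continuousLinearMapAt_symmL hx', mul_comm]

theorem covector_ne_zero {x₀ x : L}
    (hx : x ∈ (chartAt (EuclideanSpace ℝ (Fin (m + 1))) x₀).source)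
    {a : Fin (m + 1) → ℝ} (ha : a ≠ 0) : covector x₀ x a ≠ 0 := by
  intro h
  apply ha
  rw [← coeff_covector hx a, h]
  rfl

theorem exists_coeff_ne_zero {x₀ x : L}
    (hx : x ∈ (chartAt (EuclideanSpace ℝ (Fin (m + 1))) x₀).source)
    {p : TangentSpace (𝓡 (m + 1)) x →L[ℝ] ℝ} (hp : p ≠ 0) : ∃ i, coeff x₀ x p i ≠ 0 := by
  by_contra! h
  apply hp
  rw [← covector_coeff hx p, show coeff x₀ x p = 0 from funext h]
  ext v
  simp [covector]

open Classical in
/-- The point of `ST^*L` over `x` with homogeneous coordinates `a ≠ 0`, with respect to the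
preferred chart at `x₀` (arbitrary if `x` is not in the domain of that chart or if `a = 0`). -/
def point (x₀ x : L) (a : Fin (m + 1) → ℝ) : SphereCotangent m L :=
  if h : covector x₀ x a ≠ 0 then mk' x _ h
  else mk' x (EuclideanSpace.proj 0 : EuclideanSpace ℝ (Fin (m + 1)) →L[ℝ] ℝ) (by
    intro h
    have := congrArg (fun p : EuclideanSpace ℝ (Fin (m + 1)) →L[ℝ] ℝ =>
      p (EuclideanSpace.single 0 1)) h
    change (EuclideanSpace.single (0 : Fin (m + 1)) (1 : ℝ)) 0 = 0 at this
    simp at this)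

@[simp] theorem base_point (x₀ x : L) (a : Fin (m + 1) → ℝ) : (point x₀ x a).base = x := by
  unfold point
  split_ifs <;> rfl

theorem point_eq {x₀ x : L} (hx : x ∈ (chartAt (EuclideanSpace ℝ (Fin (m + 1))) x₀).source)
    {a : Fin (m + 1) → ℝ} (ha : a ≠ 0) :
    point x₀ x a = mk' x (covector x₀ x a) (covector_ne_zero hx ha) := by
  unfold point
  rw [dif_pos]

/-- Homogeneous fibre coordinates of `q ∈ ST^*L`: those of some covector in the ray `q`. -/
def homCoord (x₀ : L) (q : SphereCotangent m L) : Fin (m + 1) → ℝ :=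
  coeff x₀ q.base q.ray.someVector

theorem homCoord_mk' (x₀ x : L) (p : TangentSpace (𝓡 (m + 1)) x →L[ℝ] ℝ) (hp : p ≠ 0) :
    ∃ c : ℝ, 0 < c ∧ homCoord x₀ (mk' x p hp) = c • coeff x₀ x p := by
  obtain ⟨c, hc, h⟩ := someVector_mk' x p hp
  refine ⟨c, hc, ?_⟩
  unfold homCoord
  rw [h]
  rfl

theorem homCoord_point {x₀ x : L}
    (hx : x ∈ (chartAt (EuclideanSpace ℝ (Fin (m + 1))) x₀).source) (x₁ : L)
    {a : Fin (m + 1) → ℝ} (ha : a ≠ 0) :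
    ∃ c : ℝ, 0 < c ∧ homCoord x₁ (point x₀ x a) = c • coeff x₁ x (covector x₀ x a) := by
  rw [point_eq hx ha]
  exact homCoord_mk' _ _ _ _

theorem point_homCoord {x₀ : L} {q : SphereCotangent m L}
    (hx : q.base ∈ (chartAt (EuclideanSpace ℝ (Fin (m + 1))) x₀).source)
    {c : ℝ} (hc : 0 < c) : point x₀ q.base (c • homCoord x₀ q) = q := by
  have h1 : covector x₀ q.base (c • homCoord x₀ q) = c • q.ray.someVector := by
    rw [covector_smul, homCoord, covector_coeff hx]
  have h0 : c • homCoord x₀ q ≠ 0 := by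
    intro h
    rw [h] at h1
    have h2 : c • q.ray.someVector = 0 := by
      rw [← h1]; ext v; simp [covector]
    exact (smul_ne_zero hc.ne' q.ray.someVector_ne_zero) h2
  rw [point_eq hx h0]
  conv_rhs => rw [eq_mk' q]
  exact (mk'_eq_mk' hc h1).symm

/-- The homogeneous coordinates whose `i`-th entry is the sign `s` and whose other entries are
`w`. -/
def insertSign (i : Fin (m + 1)) (s : ℤˣ) (w : EuclideanSpace ℝ (Fin m)) : Fin (m + 1) → ℝ :=
  i.insertNth (α := fun _ => ℝ) (((s : ℤ) : ℝ)) (fun j => w j)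

theorem sign_mul_self (s : ℤˣ) : ((s : ℤ) : ℝ) * ((s : ℤ) : ℝ) = 1 := by
  rcases Int.units_eq_one_or s with rfl | rfl <;> simp

theorem insertSign_ne_zero (i : Fin (m + 1)) (s : ℤˣ) (w : EuclideanSpace ℝ (Fin m)) :
    insertSign i s w ≠ 0 := by
  intro h
  have h1 := congrFun h i
  simp only [insertSign, Fin.insertNth_apply_same, Pi.zero_apply] at h1
  have := sign_mul_self s
  rw [h1] at this
  simp at this

/-- The affine chart of `ST^*L` on the set of rays over the domain of the preferred chart `c` at
`x₀` on which the fibre coordinate `p_i` has the sign `s`: the ray of the covector `p` at `x` has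
the coordinates `(c x, (p_j / |p_i|)_{j ≠ i})`. -/
def chart (x₀ : L) (i : Fin (m + 1)) (s : ℤˣ) :
    PartialEquiv (SphereCotangent m L)
      (ModelProd (EuclideanSpace ℝ (Fin (m + 1))) (EuclideanSpace ℝ (Fin m))) where
  toFun q := (chartAt (EuclideanSpace ℝ (Fin (m + 1))) x₀ q.base,
    WithLp.toLp 2 fun j => homCoord x₀ q (i.succAbove j) / (((s : ℤ) : ℝ) * homCoord x₀ q i))
  invFun z := point x₀ ((chartAt (EuclideanSpace ℝ (Fin (m + 1))) x₀).symm z.1) (insertSign i s z.2)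
  source := {q | q.base ∈ (chartAt (EuclideanSpace ℝ (Fin (m + 1))) x₀).source ∧
    0 < ((s : ℤ) : ℝ) * homCoord x₀ q i}
  target := {z | z.1 ∈ (chartAt (EuclideanSpace ℝ (Fin (m + 1))) x₀).target}
  map_source' q hq := (chartAt (EuclideanSpace ℝ (Fin (m + 1))) x₀).map_source hq.1
  map_target' z hz := by
    have hx := (chartAt (EuclideanSpace ℝ (Fin (m + 1))) x₀).map_target hz
    refine ⟨by simpa using hx, ?_⟩
    obtain ⟨c, hc, h⟩ := homCoord_point hx x₀ (insertSign_ne_zero i s z.2)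
    rw [h, coeff_covector hx]
    simp only [insertSign, Pi.smul_apply, Fin.insertNth_apply_same, smul_eq_mul]
    rw [mul_left_comm, sign_mul_self]
    simpa using hc
  left_inv' q hq := by
    obtain ⟨hx, hpos⟩ := hq
    simp only
    rw [(chartAt (EuclideanSpace ℝ (Fin (m + 1))) x₀).left_inv hx]
    convert! point_homCoord hx (inv_pos.mpr hpos) using 2
    funext j
    refine Fin.succAboveCases i ?_ (fun j => ?_) j
    · simp only [insertSign, Fin.insertNth_apply_same, Pi.smul_apply, smul_eq_mul]
      have := sign_mul_self s
      have hne : homCoord x₀ q i ≠ 0 := by rintro h; simp [h] at hpos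
      have hne' : ((s : ℤ) : ℝ) ≠ 0 := by rintro h; simp [h] at hpos
      field_simp
      linarith
    · simp [insertSign, div_eq_inv_mul]
  right_inv' z hz := by
    have hx := (chartAt (EuclideanSpace ℝ (Fin (m + 1))) x₀).map_target hz
    obtain ⟨c, hc, h⟩ := homCoord_point hx x₀ (insertSign_ne_zero i s z.2)
    refine Prod.ext ?_ ?_
    · simpa using (chartAt (EuclideanSpace ℝ (Fin (m + 1))) x₀).right_inv hz
    · ext j
      simp only [h, coeff_covector hx]
      simp only [insertSign, Pi.smul_apply, Fin.insertNth_apply_same, Fin.insertNth_apply_succAbove,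
        smul_eq_mul]
      rw [mul_left_comm, sign_mul_self, mul_one, mul_div_cancel_left₀ _ hc.ne']

/-- The change of homogeneous coordinates from the preferred chart at `x₀` to that at `x₁`. -/
def changeCoord (x₀ x₁ : L) (i : Fin (m + 1)) (s : ℤˣ)
    (z : EuclideanSpace ℝ (Fin (m + 1)) × EuclideanSpace ℝ (Fin m)) : Fin (m + 1) → ℝ :=
  coeff x₁ ((chartAt (EuclideanSpace ℝ (Fin (m + 1))) x₀).symm z.1)
    (covector x₀ ((chartAt (EuclideanSpace ℝ (Fin (m + 1))) x₀).symm z.1) (insertSign i s z.2))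

theorem contDiffOn_changeCoord (x₀ x₁ : L) (i : Fin (m + 1)) (s : ℤˣ) :
    ContDiffOn ℝ ∞ (changeCoord x₀ x₁ i s) (overlap x₀ x₁) := by
  rw [contDiffOn_pi]
  intro k
  have h1 : ContMDiffOn (𝓡 (m + 1)) 𝓘(ℝ, EuclideanSpace ℝ (Fin (m + 1)) →L[ℝ]
      EuclideanSpace ℝ (Fin (m + 1))) ∞
      (fun y : EuclideanSpace ℝ (Fin (m + 1)) => (((triv (m := m) x₁).coordChangeL ℝ (triv (m := m) x₀)
        ((chartAt (EuclideanSpace ℝ (Fin (m + 1))) x₀).symm y) :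
        EuclideanSpace ℝ (Fin (m + 1)) ≃L[ℝ] EuclideanSpace ℝ (Fin (m + 1))) :
        EuclideanSpace ℝ (Fin (m + 1)) →L[ℝ] EuclideanSpace ℝ (Fin (m + 1))))
      ((chartAt (EuclideanSpace ℝ (Fin (m + 1))) x₀).symm.trans
        (chartAt (EuclideanSpace ℝ (Fin (m + 1))) x₁)).source := by
    refine (contMDiffOn_coordChangeL (n := ∞) (IB := 𝓡 (m + 1)) (triv (m := m) x₁) (triv (m := m) x₀)).comp
      ((contMDiffOn_chart_symm (I := 𝓡 (m + 1)) (n := ∞) (x := x₀)).mono ?_) ?_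
    · intro y hy
      simpa using hy.1
    · intro y hy
      simp only [OpenPartialHomeomorph.trans_source, Set.mem_inter_iff, Set.mem_preimage,
        OpenPartialHomeomorph.symm_source] at hy
      simp only [Set.mem_preimage, Set.mem_inter_iff, TangentBundle.trivializationAt_baseSet]
      exact ⟨hy.2, (chartAt (EuclideanSpace ℝ (Fin (m + 1))) x₀).map_target hy.1⟩
  rw [contMDiffOn_iff_contDiffOn] at h1
  have h2 := h1.comp (contDiff_fst (𝕜 := ℝ) (n := ∞) (E := EuclideanSpace ℝ (Fin (m + 1)))
    (F := EuclideanSpace ℝ (Fin m))).contDiffOn (s := overlap x₀ x₁) (fun z hz => hz)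
  have h3 : ∀ l : Fin (m + 1), ContDiff ℝ ∞
      (fun z : EuclideanSpace ℝ (Fin (m + 1)) × EuclideanSpace ℝ (Fin m) =>
        insertSign i s z.2 l) := by
    intro l
    refine Fin.succAboveCases i ?_ (fun j => ?_) l
    · simpa [insertSign] using contDiff_const
    · simp only [insertSign, Fin.insertNth_apply_succAbove]
      exact (EuclideanSpace.proj j : EuclideanSpace ℝ (Fin m) →L[ℝ] ℝ).contDiff.comp contDiff_snd
  have h4 : ContDiffOn ℝ ∞ (fun z : EuclideanSpace ℝ (Fin (m + 1)) × EuclideanSpace ℝ (Fin m) =>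
      ∑ l, insertSign i s z.2 l * ((((triv (m := m) x₁).coordChangeL ℝ (triv (m := m) x₀)
        ((chartAt (EuclideanSpace ℝ (Fin (m + 1))) x₀).symm z.1) :
        EuclideanSpace ℝ (Fin (m + 1)) ≃L[ℝ] EuclideanSpace ℝ (Fin (m + 1))) :
        EuclideanSpace ℝ (Fin (m + 1)) →L[ℝ] EuclideanSpace ℝ (Fin (m + 1)))
          (EuclideanSpace.single k 1)) l) (overlap x₀ x₁) := by
    refine ContDiffOn.sum fun l _ => (h3 l).contDiffOn.mul ?_
    exact (EuclideanSpace.proj l : EuclideanSpace ℝ (Fin (m + 1)) →L[ℝ] ℝ).contDiff.comp_contDiffOn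
      (h2.clm_apply contDiffOn_const)
  refine h4.congr fun z hz => ?_
  simp only [overlap, OpenPartialHomeomorph.trans_source, Set.mem_inter_iff, Set.mem_preimage,
    OpenPartialHomeomorph.symm_source, Set.mem_ofPred_eq] at hz
  have hb : (chartAt (EuclideanSpace ℝ (Fin (m + 1))) x₀).symm z.1 ∈
      (triv (m := m) x₁).baseSet ∩ (triv (m := m) x₀).baseSet := by
    simp only [Set.mem_inter_iff, TangentBundle.trivializationAt_baseSet]
    exact ⟨hz.2, (chartAt (EuclideanSpace ℝ (Fin (m + 1))) x₀).map_target hz.1⟩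
  have hc : ∀ v : EuclideanSpace ℝ (Fin (m + 1)),
      (triv (m := m) x₀).continuousLinearMapAt ℝ ((chartAt (EuclideanSpace ℝ (Fin (m + 1))) x₀).symm z.1)
        ((triv (m := m) x₁).symmL ℝ ((chartAt (EuclideanSpace ℝ (Fin (m + 1))) x₀).symm z.1) v) =
      (triv (m := m) x₁).coordChangeL ℝ (triv (m := m) x₀)
        ((chartAt (EuclideanSpace ℝ (Fin (m + 1))) x₀).symm z.1) v := by
    intro v
    rw [(triv (m := m) x₁).coordChangeL_apply (triv (m := m) x₀) hb, Trivialization.continuousLinearMapAt_apply,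
      (triv (m := m) x₀).coe_linearMapAt_of_mem hb.2,
      (triv (m := m) x₁).symmL_apply hb.1]
  simp only [changeCoord, coeff, covector, ContinuousLinearMap.comp_apply]
  rw [hc]
  simp

theorem coe_chart_trans_source (x₀ x₁ : L) (i i' : Fin (m + 1)) (s s' : ℤˣ) :
    ((chart x₀ i s).symm.trans (chart x₁ i' s')).source =
      {z | z ∈ overlap x₀ x₁ ∧ 0 < ((s' : ℤ) : ℝ) * changeCoord x₀ x₁ i s z i'} := by
  ext z
  simp only [PartialEquiv.trans_source, PartialEquiv.symm_source, Set.mem_inter_iff,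
    Set.mem_preimage, Set.mem_ofPred_eq, overlap, OpenPartialHomeomorph.trans_source,
    OpenPartialHomeomorph.symm_source, and_assoc]
  refine and_congr_right fun hz => ?_
  have hz' : z.1 ∈ (chartAt (EuclideanSpace ℝ (Fin (m + 1))) x₀).target := hz
  have hx := (chartAt (EuclideanSpace ℝ (Fin (m + 1))) x₀).map_target hz'
  obtain ⟨c, hc, h⟩ := homCoord_point hx x₁ (insertSign_ne_zero i s z.2)
  refine and_congr (by simp [chart]) ?_
  simp only [chart, PartialEquiv.coe_symm_mk, h, Pi.smul_apply, smul_eq_mul]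
  rw [mul_left_comm]
  exact mul_pos_iff_of_pos_left hc

theorem chart_trans_apply (x₀ x₁ : L) (i i' : Fin (m + 1)) (s s' : ℤˣ)
    {z : ModelProd (EuclideanSpace ℝ (Fin (m + 1))) (EuclideanSpace ℝ (Fin m))}
    (hz : z.1 ∈ (chartAt (EuclideanSpace ℝ (Fin (m + 1))) x₀).target) :
    ((chart x₀ i s).symm.trans (chart x₁ i' s')) z =
      (chartAt (EuclideanSpace ℝ (Fin (m + 1))) x₁
        ((chartAt (EuclideanSpace ℝ (Fin (m + 1))) x₀).symm z.1),
      WithLp.toLp 2 fun j => changeCoord x₀ x₁ i s z (i'.succAbove j) /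
        (((s' : ℤ) : ℝ) * changeCoord x₀ x₁ i s z i')) := by
  have hx := (chartAt (EuclideanSpace ℝ (Fin (m + 1))) x₀).map_target hz
  obtain ⟨c, hc, h⟩ := homCoord_point hx x₁ (insertSign_ne_zero i s z.2)
  refine Prod.ext ?_ ?_
  · simp [chart]
  · ext j
    simp only [chart, PartialEquiv.coe_trans, Function.comp_apply, PartialEquiv.coe_symm_mk,
      h, Pi.smul_apply, smul_eq_mul]
    rw [mul_left_comm, mul_div_mul_left _ _ hc.ne']
    rfl

theorem isOpen_chart_trans_source (x₀ x₁ : L) (i i' : Fin (m + 1)) (s s' : ℤˣ) :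
    IsOpen ((chart x₀ i s).symm.trans (chart x₁ i' s')).source := by
  rw [coe_chart_trans_source]
  have h : ContinuousOn (fun z => ((s' : ℤ) : ℝ) * changeCoord x₀ x₁ i s z i')
      (overlap (m := m) x₀ x₁) :=
    continuousOn_const.mul (continuousOn_pi.mp (contDiffOn_changeCoord x₀ x₁ i s).continuousOn i')
  exact h.isOpen_inter_preimage (isOpen_overlap x₀ x₁) isOpen_Ioi

theorem contDiffOn_chart_trans (x₀ x₁ : L) (i i' : Fin (m + 1)) (s s' : ℤˣ) :
    ContDiffOn ℝ (E := EuclideanSpace ℝ (Fin (m + 1)) × EuclideanSpace ℝ (Fin m))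
      (F := EuclideanSpace ℝ (Fin (m + 1)) × EuclideanSpace ℝ (Fin m)) ∞ (fun z =>
      (((chart x₀ i s).symm.trans (chart x₁ i' s')) z :
        EuclideanSpace ℝ (Fin (m + 1)) × EuclideanSpace ℝ (Fin m)))
      ((chart x₀ i s).symm.trans (chart x₁ i' s')).source := by
  have h0 : ContMDiffOn (𝓡 (m + 1)) (𝓡 (m + 1)) ∞
      ((chartAt (EuclideanSpace ℝ (Fin (m + 1))) x₀).symm.trans
        (chartAt (EuclideanSpace ℝ (Fin (m + 1))) x₁))
      ((chartAt (EuclideanSpace ℝ (Fin (m + 1))) x₀).symm.trans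
        (chartAt (EuclideanSpace ℝ (Fin (m + 1))) x₁)).source :=
    contMDiffOn_of_mem_contDiffGroupoid
      (HasGroupoid.compatible (G := contDiffGroupoid ∞ (𝓡 (m + 1)))
        (chart_mem_atlas _ x₀) (chart_mem_atlas _ x₁))
  rw [contMDiffOn_iff_contDiffOn] at h0
  have h1 := h0.comp (contDiff_fst (𝕜 := ℝ) (n := ∞) (E := EuclideanSpace ℝ (Fin (m + 1)))
    (F := EuclideanSpace ℝ (Fin m))).contDiffOn (s := overlap x₀ x₁) (fun z hz => hz)
  have h2 := contDiffOn_pi.mp (contDiffOn_changeCoord x₀ x₁ i s)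
  rw [coe_chart_trans_source]
  have hsub : {z | z ∈ overlap x₀ x₁ ∧ 0 < ((s' : ℤ) : ℝ) * changeCoord x₀ x₁ i s z i'} ⊆
      overlap (m := m) x₀ x₁ := fun z hz => hz.1
  have h3 : ContDiffOn ℝ ∞ (fun z : EuclideanSpace ℝ (Fin (m + 1)) × EuclideanSpace ℝ (Fin m) =>
      WithLp.toLp 2 fun j : Fin m =>
      changeCoord x₀ x₁ i s z (i'.succAbove j) / (((s' : ℤ) : ℝ) * changeCoord x₀ x₁ i s z i'))
      {z | z ∈ overlap x₀ x₁ ∧ 0 < ((s' : ℤ) : ℝ) * changeCoord x₀ x₁ i s z i'} := by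
    rw [contDiffOn_euclidean]
    intro j
    exact ((h2 _).mono hsub).div (contDiffOn_const.mul ((h2 _).mono hsub)) fun z hz => hz.2.ne'
  refine ((h1.mono hsub).prodMk h3).congr fun z hz => ?_
  refine chart_trans_apply x₀ x₁ i i' s s' ?_
  have := hz.1
  simp only [overlap, OpenPartialHomeomorph.trans_source, Set.mem_inter_iff,
    OpenPartialHomeomorph.symm_source, Set.mem_ofPred_eq] at this
  exact this.1

theorem exists_mem_chart_source (q : SphereCotangent m L) :
    ∃ is : Fin (m + 1) × ℤˣ, q ∈ (chart q.base is.1 is.2).source := by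
  have hx := mem_chart_source (EuclideanSpace ℝ (Fin (m + 1))) q.base
  obtain ⟨i, hi⟩ := exists_coeff_ne_zero hx q.ray.someVector_ne_zero
  rcases lt_or_gt_of_ne hi with h | h
  · exact ⟨(i, -1), hx, by simpa [homCoord] using h⟩
  · exact ⟨(i, 1), hx, by simpa [homCoord] using h⟩

/-- The smooth atlas of `ST^*L` consisting of all affine charts. -/
def core (m : ℕ) (L : Type*) [TopologicalSpace L]
    [ChartedSpace (EuclideanSpace ℝ (Fin (m + 1))) L] [IsManifold (𝓡 (m + 1)) ∞ L] :
    ChartedSpaceCore (ModelProd (EuclideanSpace ℝ (Fin (m + 1))) (EuclideanSpace ℝ (Fin m)))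
      (SphereCotangent m L) where
  atlas := {e | ∃ x₀ i s, e = chart x₀ i s}
  chartAt q := chart q.base (exists_mem_chart_source q).choose.1
    (exists_mem_chart_source q).choose.2
  mem_chart_source q := (exists_mem_chart_source q).choose_spec
  chart_mem_atlas q := ⟨_, _, _, rfl⟩
  open_source := by
    rintro _ _ ⟨x₀, i, s, rfl⟩ ⟨x₁, i', s', rfl⟩
    exact isOpen_chart_trans_source x₀ x₁ i i' s s'
  continuousOn_toFun := by
    rintro _ _ ⟨x₀, i, s, rfl⟩ ⟨x₁, i', s', rfl⟩
    exact (contDiffOn_chart_trans x₀ x₁ i i' s s').continuousOn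

instance : TopologicalSpace (SphereCotangent m L) := (core m L).toTopologicalSpace

instance : ChartedSpace (ModelProd (EuclideanSpace ℝ (Fin (m + 1))) (EuclideanSpace ℝ (Fin m)))
    (SphereCotangent m L) := (core m L).toChartedSpace

instance : IsManifold ((𝓡 (m + 1)).prod (𝓡 m)) ∞ (SphereCotangent m L) := by
  refine isManifold_of_contDiffOn _ _ _ ?_
  rintro e e' he he'
  obtain ⟨_, ⟨_, rfl⟩, _, ⟨⟨x₀, i, s, rfl⟩, rfl⟩, rfl⟩ := he
  obtain ⟨_, ⟨_, rfl⟩, _, ⟨⟨x₁, i', s', rfl⟩, rfl⟩, rfl⟩ := he'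
  refine (contDiffOn_chart_trans x₀ x₁ i i' s s').mono ?_
  rintro z ⟨hz, -⟩
  exact hz

/-- The canonical cooriented contact structure `ξ_can` on `ST^*L`, given at `q` by the positive
covectors defining the cooriented hyperplane `(ξ_can)_q`. These are the covectors `p ∘ dπ_q` for `p`
in the ray `q`, where `π : ST^*L → L` is the projection: the pullbacks of the canonical one-form
`λ_can` of `T^*L ∖ L₀` (`(λ_can)_p = p ∘ dπ_p`) under the local sections of `T^*L ∖ L₀ → ST^*L`.
In particular, restricting to the unit covectors of a Riemannian metric on `L` singles out the
values of `α_can`; the other elements at `q` are its positive multiples. -/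
def canonicalContact (q : SphereCotangent m L) :
    Set (TangentSpace ((𝓡 (m + 1)).prod (𝓡 m)) q →L[ℝ] ℝ) :=
  {a | ∃ (p : TangentSpace (𝓡 (m + 1)) q.base →L[ℝ] ℝ) (hp : p ≠ 0),
    rayOfNeZero ℝ p hp = q.ray ∧
      a = p.comp (mfderiv ((𝓡 (m + 1)).prod (𝓡 m)) (𝓡 (m + 1))
        (base : SphereCotangent m L → L) q)}

/-- A diffeomorphism `φ` from an open set `U ⊆ ST^*L` (its `source`) onto an open set `V ⊆ M` (its
`target`) is a contact diffeomorphism `(U, ξ_can) → (V, ker α)` preserving coorientations if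
`φ^*α` is a positive defining form of `ξ_can`, i.e. locally `φ^*α = f α_can` with `f > 0`. -/
structure IsContactDiffeo {d : ℕ} {M : Type*} [TopologicalSpace M]
    [ChartedSpace (EuclideanSpace ℝ (Fin d)) M] (α : CovectorField d M)
    (φ : OpenPartialHomeomorph (SphereCotangent m L) M) : Prop where
  contMDiffOn : ContMDiffOn ((𝓡 (m + 1)).prod (𝓡 m)) (𝓡 d) ∞ φ φ.source
  contMDiffOn_symm : ContMDiffOn (𝓡 d) ((𝓡 (m + 1)).prod (𝓡 m)) ∞ φ.symm φ.target
  contact : ∀ q ∈ φ.source,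
    (α (φ q)).comp (mfderiv ((𝓡 (m + 1)).prod (𝓡 m)) (𝓡 d) φ q) ∈ canonicalContact q

end SphereCotangent

end ContactNbhd

end

/-! The proof has two halves, joined by a retraction `ϖ` of a neighbourhood of `L` onto `L` whose
fibres are Legendrian.

From the retraction to `ST^*L`. If `ker dϖ ⊆ ker α` and `dϖ` is onto, then `α_y = p ∘ dϖ_y` for a
unique nonzero covector `p` at `ϖ y`. The map `y ↦ [p]` (`contactLift`) covers `ϖ`, so it pulls
`ξ_can` back to `ker α` with its coorientation. Nondegeneracy of `dα` on `ker α` makes it an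
immersion (`eq_zero_of_fderiv_quotient`), and both sides have dimension `2m + 1`, so it is a local
diffeomorphism. On `L` the relation `ϖ ∘ ι = id` gives `p = ι^*α`, so `ι x` goes to `β x`.
Compactness of `L` yields injectivity near `L`, and `φ` is the inverse.

Construction of the retraction. Since `ι^*α` is closed, `α` restricted to `TM|_L` extends to a
closed one-form `η` near `L` (`exists_closed_extension`). Let `(z, g)` be the unique solution of
`α(z) = 0`, `ι_z dα + g α = η`. On `L` one has `η = α`, hence `z = 0` and `g = 1`. Because `TL ∩ ker
α` is Lagrangian in `ker α`, the linearization of `z` is `-1` on the normal bundle of `L`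
(`IsPreLagrangianOn.fderiv_contactField_inr`): the flow of `z` contracts to `L`. With `s = exp(-t)`
the flow lines solve `s x' = -z(x)`, and in coordinates `(u, s q)` this equation is regular at `s =
0`, so the limit map at `s = 0` is a smooth retraction (`exists_contraction`).

Its fibres are Legendrian (`IsPreLagrangianOn.legendrian`): let `v` be a variation of flow lines
whose limit at `s = 0` vanishes. As `η` is closed and `η(z) = 0`, the number `η(v)` is constant in
`s`, hence zero. Then `b = α(v)` solves `s b' = g b` with `g = 1 + O(s)` and `b(0) = b'(0) = 0`,
which forces `b = 0`. Since `z` is natural under changes of charts, the retractions built in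
different slice charts agree.

Smoothness of flows in the initial point is obtained from the implicit function theorem on a space
of continuous curves. -/

noncomputable section

namespace ContactNbhd

/-! ### Composition operators on spaces of continuous maps -/

section Nemytskii

universe u



variable {K : Type*} [TopologicalSpace K] [CompactSpace K]
  {E F : Type*} [NormedAddCommGroup E] [NormedSpace ℝ E] [NormedAddCommGroup F] [NormedSpace ℝ F]

set_option synthInstance.maxHeartbeats 200000

section Bilinear

variable {G : Type*} [NormedAddCommGroup G] [NormedSpace ℝ G] (β : G →L[ℝ] E →L[ℝ] F)

/-- Pointwise application of a bounded bilinear map to continuous functions. -/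
def pointwiseBilinFun (B : C(K, G)) (v : C(K, E)) : C(K, F) where
  toFun k := β (B k) (v k)
  continuous_toFun := (β.continuous.comp B.continuous).clm_apply v.continuous

theorem norm_pointwiseBilinFun_le (B : C(K, G)) (v : C(K, E)) :
    ‖pointwiseBilinFun β B v‖ ≤ ‖β‖ * ‖B‖ * ‖v‖ := by
  rw [ContinuousMap.norm_le _ (by positivity)]
  intro k
  refine (β.le_opNorm₂ _ _).trans ?_
  gcongr
  · exact B.norm_coe_le_norm k
  · exact v.norm_coe_le_norm k

/-- Pointwise application of a bounded bilinear map to continuous functions, as a bounded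
bilinear map. -/
def pointwiseBilin : C(K, G) →L[ℝ] C(K, E) →L[ℝ] C(K, F) :=
  LinearMap.mkContinuous₂
    (LinearMap.mk₂ ℝ (pointwiseBilinFun β)
      (fun _ _ _ => by ext; simp [pointwiseBilinFun]) (fun _ _ _ => by ext; simp [pointwiseBilinFun])
      (fun _ _ _ => by ext; simp [pointwiseBilinFun]) (fun _ _ _ => by ext; simp [pointwiseBilinFun]))
    ‖β‖ (norm_pointwiseBilinFun_le β)

/-- The mean value inequality is applied at each point of `K`; one `δ` serves all points because the
derivative is uniformly continuous at the compact range of `γ`. The derivative is written as `β ∘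
f'` so that a scalar factor can be absorbed into `β` later. -/
theorem hasFDerivAt_comp_continuousMap {f : E → F} {f' : E → G} (hf' : Continuous f')
    (hf : ∀ x, HasFDerivAt f (β (f' x)) x) (γ : C(K, E)) :
    HasFDerivAt (fun γ : C(K, E) =>
        (⟨f, continuous_iff_continuousAt.mpr fun x => (hf x).continuousAt⟩ : C(E, F)).comp γ)
      (pointwiseBilin β ((⟨f', hf'⟩ : C(E, G)).comp γ)) γ := by
  rw [hasFDerivAt_iff_isLittleO_nhds_zero, Asymptotics.isLittleO_iff]
  intro ε hε
  have hS : IsCompact (Set.range γ) := isCompact_range γ.continuous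
  have hu := hS.uniformContinuousAt_of_continuousAt (fun x => β (f' x))
    (fun a _ => (β.continuous.comp hf').continuousAt) (Metric.dist_mem_uniformity hε)
  obtain ⟨δ, hδ, hu⟩ := Metric.mem_uniformity_dist.mp hu
  filter_upwards [Metric.ball_mem_nhds (0 : C(K, E)) hδ] with h hh
  have hh' : ‖h‖ < δ := by simpa using hh
  rw [ContinuousMap.norm_le _ (by positivity)]
  intro k
  have hk : ‖h k‖ ≤ ‖h‖ := h.norm_coe_le_norm k
  have := (convex_ball (γ k) δ).norm_image_sub_le_of_norm_hasFDerivWithin_le'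
    (f := f) (f' := fun x => β (f' x)) (φ := β (f' (γ k))) (C := ε) (x := γ k) (y := γ k + h k)
    (fun x _ => (hf x).hasFDerivWithinAt)
    (fun x hx => by
      have h1 := hu (a := γ k) (b := x) (by rwa [dist_comm]) ⟨k, rfl⟩
      rw [← dist_eq_norm, dist_comm]
      exact le_of_lt h1)
    (Metric.mem_ball_self hδ) (by simpa using hk.trans_lt hh')
  simp only [add_sub_cancel_left] at this
  exact this.trans (by gcongr)

theorem contDiff_comp_continuousMap_succ {n : ℕ} {f : E → F} {f' : E → G} (hf' : Continuous f')
    (hf : ∀ x, HasFDerivAt f (β (f' x)) x)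
    (h : ContDiff ℝ n (fun γ : C(K, E) => (⟨f', hf'⟩ : C(E, G)).comp γ)) :
    ContDiff ℝ (n + 1) (fun γ : C(K, E) =>
      (⟨f, continuous_iff_continuousAt.mpr fun x => (hf x).continuousAt⟩ : C(E, F)).comp γ) :=
  contDiff_succ_iff_hasFDerivAt.mpr
    ⟨_, (pointwiseBilin β).contDiff.comp h, hasFDerivAt_comp_continuousMap β hf' hf⟩

end Bilinear

/-- The derivative of the composition operator is again one, for `fderiv ℝ f`. The target `F` is
quantified inside the induction since it changes to `E →L[ℝ] F`, which lies in the same universe. -/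
theorem contDiff_comp_continuousMap_nat {E : Type u} [NormedAddCommGroup E] [NormedSpace ℝ E]
    (n : ℕ) : ∀ {F : Type u} [NormedAddCommGroup F] [NormedSpace ℝ F]
    {f : E → F} (hf : ContDiff ℝ ∞ f),
    ContDiff ℝ n (fun γ : C(K, E) => (⟨f, hf.continuous⟩ : C(E, F)).comp γ) := by
  induction n with
  | zero =>
    intro F _ _ f hf
    exact contDiff_zero.mpr (ContinuousMap.continuous_postcomp _)
  | succ n ih =>
    intro F _ _ f hf
    have h2 : ContDiff ℝ ∞ (fderiv ℝ f) := hf.fderiv_right (by norm_cast)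
    exact contDiff_comp_continuousMap_succ (ContinuousLinearMap.id ℝ (E →L[ℝ] F)) h2.continuous
      (fun x => (hf.differentiable (by simp) x).hasFDerivAt) (ih h2)

/-- The composition operator `γ ↦ f ∘ γ` of a smooth map `f` is smooth. -/
theorem contDiff_comp_continuousMap {E F : Type u} [NormedAddCommGroup E] [NormedSpace ℝ E]
    [NormedAddCommGroup F] [NormedSpace ℝ F] {f : E → F} (hf : ContDiff ℝ ∞ f) :
    ContDiff ℝ ∞ (fun γ : C(K, E) => (⟨f, hf.continuous⟩ : C(E, F)).comp γ) :=
  contDiff_infty.mpr fun n => contDiff_comp_continuousMap_nat n hf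

end Nemytskii

end ContactNbhd
end

noncomputable section

namespace ContactNbhd

/-! ### Smooth dependence of flows on initial conditions -/

section Flow

open Set unitInterval MeasureTheory

universe u

set_option synthInstance.maxHeartbeats 200000

variable {E : Type u} [NormedAddCommGroup E] [NormedSpace ℝ E]

/-- The primitive `t ↦ ∫₀ᵗ v` of a continuous curve on the unit interval. -/
def volterraFun (v : C(I, E)) : C(I, E) where
  toFun t := ∫ τ in (0 : ℝ)..t, v (projIcc 0 1 zero_le_one τ)
  continuous_toFun :=
    (intervalIntegral.continuous_primitive (fun _ _ =>
      (v.continuous.comp continuous_projIcc).intervalIntegrable _ _) 0).comp continuous_subtype_val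

theorem norm_volterraFun_le_of_le {v : C(I, E)} {c : ℝ} {n : ℕ}
    (h : ∀ t : I, ‖v t‖ ≤ c * (t : ℝ) ^ n / n.factorial) (t : I) :
    ‖volterraFun v t‖ ≤ c * (t : ℝ) ^ (n + 1) / (n + 1).factorial := by
  have h1 : ‖∫ τ in (0 : ℝ)..t, v (projIcc 0 1 zero_le_one τ)‖ ≤
      ∫ τ in (0 : ℝ)..t, c * τ ^ n / n.factorial := by
    refine intervalIntegral.norm_integral_le_of_norm_le t.2.1 ?_ ?_
    · refine Filter.Eventually.of_forall fun τ hτ => ?_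
      have := h (projIcc 0 1 zero_le_one τ)
      rwa [projIcc_of_mem zero_le_one ⟨hτ.1.le, hτ.2.trans t.2.2⟩] at this ⊢
    · exact (by fun_prop : Continuous fun τ : ℝ => c * τ ^ n / n.factorial).intervalIntegrable _ _
  refine h1.trans (le_of_eq ?_)
  simp only [intervalIntegral.integral_div, intervalIntegral.integral_const_mul, integral_pow,
    Nat.factorial_succ, Nat.cast_mul, Nat.cast_succ]
  simp
  field_simp

/-- The primitive `t ↦ ∫₀ᵗ v`, as a bounded operator. -/
def volterra (E : Type u) [NormedAddCommGroup E] [NormedSpace ℝ E] : C(I, E) →L[ℝ] C(I, E) :=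
  LinearMap.mkContinuous
    { toFun := volterraFun
      map_add' := fun v w => ContinuousMap.ext fun t =>
        intervalIntegral.integral_add ((v.continuous.comp continuous_projIcc).intervalIntegrable _ _)
          ((w.continuous.comp continuous_projIcc).intervalIntegrable _ _)
      map_smul' := fun c v => ContinuousMap.ext fun t => intervalIntegral.integral_smul c _ }
    1 fun v => by
      rw [one_mul, ContinuousMap.norm_le _ (norm_nonneg v)]
      intro t
      have := norm_volterraFun_le_of_le (v := v) (c := ‖v‖) (n := 0)
        (fun t => by simpa using v.norm_coe_le_norm t) t
      refine this.trans ?_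
      simpa using mul_le_of_le_one_right (norm_nonneg v) t.2.2

/-- A Volterra operator `A` satisfies `‖A ^ n‖ ≤ c ^ n / n!`, so `1 - A ^ n` is invertible for some
`n` even when `‖A‖` is large. As `1 - A` is a factor of it commuting with the cofactor, `1 - A` is
invertible too. -/
theorem isUnit_one_sub_volterra_comp [CompleteSpace E] {G : Type*} [NormedAddCommGroup G]
    [NormedSpace ℝ G] (β : G →L[ℝ] E →L[ℝ] E) (B : C(I, G)) :
    IsUnit (1 - (volterra E).comp (pointwiseBilin β B)) := by
  set A := (volterra E).comp (pointwiseBilin β B) with hA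
  obtain ⟨c, hc0, hcB⟩ : ∃ c : ℝ, 0 ≤ c ∧ ∀ (t : I) (v : E), ‖β (B t) v‖ ≤ c * ‖v‖ :=
    ⟨‖β‖ * ‖B‖, mul_nonneg (norm_nonneg β) (norm_nonneg B), fun t v =>
      (β.le_opNorm₂ _ _).trans (mul_le_mul_of_nonneg_right
        (mul_le_mul_of_nonneg_left (B.norm_coe_le_norm t) (norm_nonneg β)) (norm_nonneg v))⟩
  have h1 : ∀ (n : ℕ) (v : C(I, E)) (t : I),
      ‖(A ^ n) v t‖ ≤ (c ^ n * ‖v‖) * (t : ℝ) ^ n / n.factorial := by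
    intro n v
    induction n with
    | zero => intro t; simpa using v.norm_coe_le_norm t
    | succ n ih =>
      rw [pow_succ']
      refine norm_volterraFun_le_of_le fun t => ?_
      refine (hcB t _).trans ((mul_le_mul_of_nonneg_left (ih t) hc0).trans (le_of_eq ?_))
      ring
  have h2 : ∀ n : ℕ, ‖A ^ n‖ ≤ c ^ n / n.factorial := by
    intro n
    refine ContinuousLinearMap.opNorm_le_bound _ (by positivity) fun v => ?_
    rw [ContinuousMap.norm_le _ (by positivity)]
    intro t
    refine (h1 n v t).trans ?_
    have ht : (t : ℝ) ^ n ≤ 1 := pow_le_one₀ t.2.1 t.2.2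
    rw [div_mul_eq_mul_div]
    exact div_le_div_of_nonneg_right (mul_le_of_le_one_right (by positivity) ht) (by positivity)
  obtain ⟨n, hn⟩ := ((FloorSemiring.tendsto_pow_div_factorial_atTop c).eventually
    (gt_mem_nhds one_pos)).exists
  have h3 : IsUnit (1 - A ^ n) := isUnit_one_sub_of_norm_lt_one (R := C(I, E) →L[ℝ] C(I, E)) ((h2 n).trans_lt hn)
  rw [← mul_neg_geom_sum] at h3
  have hc : Commute (1 - A) (∑ i ∈ Finset.range n, A ^ i) :=
    Commute.sum_right _ _ _ fun i _ => ((Commute.one_left A).sub_left (Commute.refl A)).pow_right i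
  exact (hc.isUnit_mul_iff.mp h3).1

/-- Constant curves. -/
def constCurve (E : Type u) [NormedAddCommGroup E] [NormedSpace ℝ E] : E →L[ℝ] C(I, E) :=
  LinearMap.mkContinuous
    { toFun := fun x => ContinuousMap.const I x
      map_add' := fun _ _ => rfl
      map_smul' := fun _ _ => rfl }
    1 fun v => by
      rw [one_mul, ContinuousMap.norm_le _ (norm_nonneg v)]
      exact fun _ => le_rfl

variable {X : E → E} (hX : ContDiff ℝ ∞ X)

/-- The integral equation for curves `γ` with `γ' = s X(γ)`, `γ 0 = x`. -/
def integralEqn (p : (ℝ × E) × C(I, E)) : C(I, E) :=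
  p.2 - constCurve E p.1.2 - p.1.1 • volterra E ((⟨X, hX.continuous⟩ : C(E, E)).comp p.2)

theorem contDiff_integralEqn : ContDiff ℝ ∞ (integralEqn hX) := by
  have h1 := (contDiff_comp_continuousMap (K := I) hX).comp
    (contDiff_snd (𝕜 := ℝ) (E := ℝ × E) (F := C(I, E)))
  have h2 := (volterra E).contDiff.comp h1
  have h3 : ContDiff ℝ ∞ fun p : (ℝ × E) × C(I, E) => constCurve E p.1.2 :=
    (constCurve E).contDiff.comp (contDiff_snd.comp contDiff_fst)
  exact (contDiff_snd.sub h3).sub ((contDiff_fst.comp contDiff_fst).smul h2)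

/-- The partial derivative in `γ` is `v ↦ v - s ∫ DX(γ) v`, the identity minus a Volterra operator;
the factor `s` goes into the bilinear map. This is the hypothesis of the implicit function theorem.
-/
theorem isInvertible_fderiv_integralEqn [CompleteSpace E] (p : (ℝ × E) × C(I, E)) :
    (fderiv ℝ (integralEqn hX) p ∘L .inr ℝ (ℝ × E) C(I, E)).IsInvertible := by
  have h2 : ContDiff ℝ ∞ (fderiv ℝ X) := hX.fderiv_right (by norm_cast)
  have h1 := hasFDerivAt_comp_continuousMap (K := I) (ContinuousLinearMap.id ℝ (E →L[ℝ] E))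
    h2.continuous (fun x => (hX.differentiable (by simp) x).hasFDerivAt) p.2
  have h3 : HasFDerivAt (fun γ : C(I, E) => integralEqn hX (p.1, γ)) _ p.2 :=
    ((hasFDerivAt_id p.2).sub_const (constCurve E p.1.2)).sub
      (((volterra E).hasFDerivAt.comp p.2 h1).const_smul p.1.1)
  have h4 : HasFDerivAt (fun γ : C(I, E) => integralEqn hX (p.1, γ))
      (fderiv ℝ (integralEqn hX) p ∘L .inr ℝ (ℝ × E) C(I, E)) p.2 :=
    HasFDerivAt.comp (g := integralEqn hX) (f := fun γ : C(I, E) => (p.1, γ)) p.2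
      ((contDiff_integralEqn hX).differentiable (by simp) p).hasFDerivAt
      (hasFDerivAt_prodMk_right p.1 p.2)
  rw [h4.unique h3]
  have h5 := isUnit_one_sub_volterra_comp (p.1.1 • ContinuousLinearMap.id ℝ (E →L[ℝ] E))
    ((⟨fderiv ℝ X, h2.continuous⟩ : C(E, E →L[ℝ] E)).comp p.2)
  obtain ⟨a, ha⟩ := h5
  refine ⟨ContinuousLinearEquiv.unitsEquiv ℝ _ a, ?_⟩
  ext1 v
  change (a : C(I, E) →L[ℝ] C(I, E)) v = _
  rw [ha]
  change v - volterra E _ = v - p.1.1 • volterra E _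
  rw [← map_smul]
  rfl

theorem exists_integralEqn_eq_zero [CompleteSpace E] {C : NNReal} (hL : LipschitzWith C X)
    {B : ℝ} (hB : ∀ x, ‖X x‖ ≤ B) (s : ℝ) (x : E) : ∃ γ : C(I, E), integralEqn hX ((s, x), γ) = 0 := by
  have hB0 : 0 ≤ B := (norm_nonneg _).trans (hB 0)
  -- A solution of `y' = s X(y)` moves by at most `|s| B` in unit time, so a ball of radius `|s| B`
  -- suffices and Picard–Lindelöf applies on all of `[0, 1]`.
  have hPL : IsPicardLindelof (fun _ y => s • X y) (tmin := 0) (tmax := 1)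
      ⟨0, left_mem_Icc.mpr zero_le_one⟩ x (‖s‖₊ * ⟨B, hB0⟩) 0 (‖s‖₊ * ⟨B, hB0⟩) (‖s‖₊ * C) :=
    { lipschitzOnWith := fun t _ =>
        ((lipschitzWith_smul s).comp hL).lipschitzOnWith
      continuousOn := fun _ _ => continuousOn_const
      norm_le := fun t _ y _ => by
        rw [norm_smul]
        exact mul_le_mul_of_nonneg_left (hB y) (norm_nonneg s)
      mul_max_le := by simp }
  obtain ⟨c, hc0, hc⟩ := hPL.exists_eq_forall_mem_Icc_hasDerivWithinAt₀
  have hcc : ContinuousOn c (Icc 0 1) := fun t ht => (hc t ht).continuousWithinAt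
  refine ⟨⟨fun t => c t, continuousOn_iff_continuous_domRestrict.mp hcc⟩, ?_⟩
  ext t
  have h0 : ∀ τ ∈ Icc (0 : ℝ) t, τ ∈ Icc (0 : ℝ) 1 := fun τ hτ => ⟨hτ.1, hτ.2.trans t.2.2⟩
  have h1 := ODE.picard_eq_of_hasDerivAt (f := fun _ y => s • X y) (u := Set.univ) (t₀ := 0)
    (t := t) (α := c)
    (by
      refine Continuous.continuousOn ?_
      exact (hX.continuous.comp continuous_snd).const_smul s)
    (fun τ hτ => by
      rw [uIcc_of_le t.2.1] at hτ ⊢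
      exact (hc τ (h0 τ hτ)).mono h0) (fun _ _ => mem_univ _)
  rw [ODE.picard_apply] at h1
  have h2 : ∫ τ in (0 : ℝ)..t, X (c (projIcc 0 1 zero_le_one τ)) = ∫ τ in (0 : ℝ)..t, X (c τ) := by
    refine intervalIntegral.integral_congr fun τ hτ => ?_
    rw [uIcc_of_le t.2.1] at hτ
    simp only [projIcc_of_mem zero_le_one (h0 τ hτ)]
  change c t - x - s • ∫ τ in (0 : ℝ)..t, X (c (projIcc 0 1 zero_le_one τ)) = 0
  rw [h2, ← intervalIntegral.integral_smul, sub_sub, sub_eq_zero, ← h1]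
  simp only [hc0]

/-- Extending the integrand constantly beyond `[0, 1]` gives a curve on `ℝ`, so the derivative is
two-sided even at the endpoints. -/
theorem exists_hasDerivAt_of_integralEqn [CompleteSpace E] {s : ℝ} {x : E} {γ : C(I, E)}
    (h : integralEqn hX ((s, x), γ) = 0) : ∃ c : ℝ → E, c 0 = x ∧ (∀ t : I, c t = γ t) ∧
      ∀ t ∈ Icc (0 : ℝ) 1, HasDerivAt c (s • X (c t)) t := by
  have h0 : ∀ t : I, x + s • ∫ τ in (0 : ℝ)..t, X (γ (projIcc 0 1 zero_le_one τ)) = γ t := by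
    intro t
    have := congrArg (fun f : C(I, E) => f t) h
    change γ t - x - s • ∫ τ in (0 : ℝ)..t, X (γ (projIcc 0 1 zero_le_one τ)) = 0 at this
    rw [sub_sub, sub_eq_zero] at this
    exact this.symm
  refine ⟨fun t => x + s • ∫ τ in (0 : ℝ)..t, X (γ (projIcc 0 1 zero_le_one τ)), by simp, h0,
    fun t ht => ?_⟩
  have hcont : Continuous fun τ => X (γ (projIcc 0 1 zero_le_one τ)) :=
    hX.continuous.comp (γ.continuous.comp continuous_projIcc)
  have h1 := (intervalIntegral.integral_hasDerivAt_right (hcont.intervalIntegrable 0 t)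
    (hcont.stronglyMeasurableAtFilter _ _) hcont.continuousAt).const_smul s |>.const_add x
  have h2 := h0 ⟨t, ht⟩
  rw [projIcc_of_mem zero_le_one ht] at h1
  simp only at h2 ⊢
  rw [h2]
  exact h1

theorem eqOn_of_hasDerivWithinAt {C : NNReal} (hL : LipschitzWith C X) {s : ℝ} {c d : ℝ → E}
    (hc : ContinuousOn c (Icc 0 1)) (hd : ContinuousOn d (Icc 0 1))
    (hc' : ∀ t ∈ Ico (0 : ℝ) 1, HasDerivWithinAt c (s • X (c t)) (Ici t) t)
    (hd' : ∀ t ∈ Ico (0 : ℝ) 1, HasDerivWithinAt d (s • X (d t)) (Ici t) t)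
    (h0 : c 0 = d 0) : EqOn c d (Icc 0 1) :=
  ODE_solution_unique_of_mem_Icc_right (v := fun _ y => s • X y) (s := fun _ => univ)
    (fun _ _ => ((lipschitzWith_smul s).comp hL).lipschitzOnWith) hc hc' (fun _ _ => mem_univ _)
    hd hd' (fun _ _ => mem_univ _) h0

/-- A bounded Lipschitz smooth vector field has a smooth flow. -/
theorem exists_contDiff_flow [CompleteSpace E] {X : E → E} (hX : ContDiff ℝ ∞ X) {C : NNReal} (hL : LipschitzWith C X)
    {B : ℝ} (hB : ∀ x, ‖X x‖ ≤ B) : ∃ φ : ℝ × E → E, ContDiff ℝ ∞ φ ∧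
      (∀ x, φ (0, x) = x) ∧ (∀ x, ∀ t > 0, HasDerivAt (fun t => φ (t, x)) (X (φ (t, x))) t) ∧
      ∀ c : ℝ → E, ContinuousOn c (Icc 0 1) →
        (∀ t ∈ Ico (0 : ℝ) 1, HasDerivWithinAt c (X (c t)) (Ici t) t) →
        ∀ t ∈ Icc (0 : ℝ) 1, φ (t, c 0) = c t := by
  -- Time is turned into a parameter: `c (s, x)` solves `c' = s X(c)` on the fixed interval `[0,
  -- 1]`, and the flow at time `s` is its value at `1`. Smoothness in time and in the initial point
  -- then come together.
  choose γ hγ using fun p : ℝ × E => exists_integralEqn_eq_zero hX hL hB p.1 p.2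
  choose c hc0 hcγ hc using fun p : ℝ × E => exists_hasDerivAt_of_integralEqn hX (hγ p)
  have hccont : ∀ p, ContinuousOn (c p) (Icc 0 1) := fun p t ht =>
    (hc p t ht).continuousAt.continuousWithinAt
  have huniq : ∀ (s : ℝ) (d : ℝ → E), ContinuousOn d (Icc 0 1) →
      (∀ t ∈ Ico (0 : ℝ) 1, HasDerivWithinAt d (s • X (d t)) (Ici t) t) →
      EqOn (c (s, d 0)) d (Icc 0 1) := fun s d hd hd' =>
    eqOn_of_hasDerivWithinAt hL (hccont _) hd
      (fun t ht => (hc _ t (Ico_subset_Icc_self ht)).hasDerivWithinAt) hd' (hc0 _)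
  have hscale : ∀ (r : ℝ) (d : ℝ → E), ContinuousOn d (Icc 0 1) →
      (∀ t ∈ Ico (0 : ℝ) 1, HasDerivWithinAt d (r • X (d t)) (Ici t) t) →
      ∀ t ∈ Icc (0 : ℝ) 1, c (r * t, d 0) 1 = d t := by
    intro r d hd hd' t ht
    have hmem : ∀ ρ ∈ Icc (0 : ℝ) 1, ρ * t ∈ Icc (0 : ℝ) 1 := fun ρ hρ =>
      ⟨mul_nonneg hρ.1 ht.1, mul_le_one₀ hρ.2 ht.1 ht.2⟩
    have h1 := huniq (r * t) (fun ρ => c (r, d 0) (ρ * t))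
      ((hccont _).comp (by fun_prop) hmem) (fun ρ hρ => by
        have := (hc (r, d 0) (ρ * t) (hmem ρ (Ico_subset_Icc_self hρ))).scomp ρ
          ((hasDerivAt_id ρ).mul_const t)
        refine HasDerivAt.hasDerivWithinAt ?_
        convert! this using 1
        simp [smul_smul, mul_comm])
    have h2 := h1 (right_mem_Icc.mpr zero_le_one)
    simp only [zero_mul, hc0, one_mul] at h2
    rw [h2]
    exact huniq r d hd hd' ht
  have hscale' : ∀ (r : ℝ) (x : E), ∀ t ∈ Icc (0 : ℝ) 1, c (r * t, x) 1 = c (r, x) t := by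
    intro r x t ht
    have := hscale r (c (r, x)) (hccont _)
      (fun t ht => (hc _ t (Ico_subset_Icc_self ht)).hasDerivWithinAt) t ht
    rwa [hc0] at this
  refine ⟨fun p => c p 1, ?_, fun x => ?_, fun x t ht => ?_, fun d hd hd' t ht => ?_⟩
  · rw [show (fun p => c p 1) = fun p => γ p 1 from funext fun p => hcγ p 1]
    have hev : ContDiff ℝ ∞ fun v : C(I, E) => v 1 :=
      (ContinuousMap.evalCLM (M := E) ℝ (1 : I)).contDiff
    refine hev.comp (contDiff_iff_contDiffAt.mpr fun p => ?_)
    have hcd : ContDiffAt ℝ ∞ (integralEqn hX) (p, γ p) := (contDiff_integralEqn hX).contDiffAt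
    have hinv := isInvertible_fderiv_integralEqn hX (p, γ p)
    -- The implicit function is smooth near `p`, and by uniqueness of integral curves it coincides
    -- there with the chosen solutions `γ`.
    have h1 := hcd.contDiffAt_implicitFunction (by simp) hinv
    refine h1.congr_of_eventuallyEq ?_
    filter_upwards [hcd.eventually_apply_implicitFunction (by simp) hinv] with q hq
    rw [hγ p] at hq
    obtain ⟨d, hd0, hdγ, hd⟩ := exists_hasDerivAt_of_integralEqn hX hq
    ext t
    rw [← hcγ, ← hdγ]
    have := huniq q.1 d (fun t ht => (hd t ht).continuousAt.continuousWithinAt)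
      (fun t ht => (hd t (Ico_subset_Icc_self ht)).hasDerivWithinAt) t.2
    rwa [hd0] at this
  · have := hscale' 0 x 0 (left_mem_Icc.mpr zero_le_one)
    rwa [hc0, zero_mul] at this
  · have hp : 0 < t + 1 := by linarith
    -- For `r` near `t`, all values are read off the single curve with parameter `t + 1`, at the
    -- interior time `r / (t + 1)`. This uses `t > 0`.
    have h1 : (fun r => c (r, x) 1) =ᶠ[𝓝 t] fun r => c (t + 1, x) (r / (t + 1)) := by
      filter_upwards [Ioo_mem_nhds ht (lt_add_one t)] with r hr
      rw [← hscale' (t + 1) x _ ⟨(div_pos hr.1 hp).le, (div_le_one hp).mpr hr.2.le⟩,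
        mul_div_cancel₀ _ hp.ne']
    have h2 : c (t, x) 1 = c (t + 1, x) (t / (t + 1)) := h1.eq_of_nhds
    beta_reduce
    rw [h2]
    refine HasDerivAt.congr_of_eventuallyEq ?_ h1
    have := (hc (t + 1, x) (t / (t + 1)) ⟨(div_pos ht hp).le, (div_le_one hp).mpr (by linarith)⟩).scomp
      t ((hasDerivAt_id t).div_const (t + 1))
    convert! this using 1
    simp [smul_smul, hp.ne']
  · simpa using hscale 1 d hd (by simpa using hd') t ht

/-- Parametric integrals of smooth functions are smooth. -/
theorem contDiff_parametric_integral {G : Type u} [NormedAddCommGroup G] [NormedSpace ℝ G]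
    {g : ℝ × E → G} (hg : ContDiff ℝ ∞ g) :
    ContDiff ℝ ∞ fun x => ∫ τ in (0 : ℝ)..1, g (τ, x) := by
  -- The integral is the composite of the affine map sending `x` to the curve `τ ↦ (τ, x)`,
  -- composition with `g`, the Volterra operator, and evaluation at `1`, all of which are smooth.
  let j : C(I, ℝ × E) := ⟨fun τ => (τ, 0), by fun_prop⟩
  have hJ : ContDiff ℝ ∞ fun x : E => j + constCurve (ℝ × E) (0, x) :=
    contDiff_const.add ((constCurve (ℝ × E)).contDiff.comp (contDiff_const.prodMk contDiff_id))
  have hev : ContDiff ℝ ∞ fun v : C(I, G) => v 1 :=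
    (ContinuousMap.evalCLM (M := G) ℝ (1 : I)).contDiff
  have h1 := hev.comp ((volterra G).contDiff.comp
    ((contDiff_comp_continuousMap (K := I) hg).comp hJ))
  convert h1 using 2 with x
  change _ = ∫ τ in (0 : ℝ)..1, g ((projIcc 0 1 zero_le_one τ : ℝ) + 0, 0 + x)
  refine intervalIntegral.integral_congr fun τ hτ => ?_
  rw [uIcc_of_le zero_le_one] at hτ
  simp [projIcc_of_mem zero_le_one hτ]

/-- Hadamard's lemma along the fibres of a product. -/
theorem exists_hadamard {F G : Type u} [NormedAddCommGroup F] [NormedSpace ℝ F]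
    [NormedAddCommGroup G] [NormedSpace ℝ G] [CompleteSpace G] {f : E × F → G}
    (hf : ContDiff ℝ ∞ f) (h0 : ∀ u, f (u, 0) = 0) :
    ∃ h : ℝ × (E × F) → G, ContDiff ℝ ∞ h ∧ (∀ s u q, f (u, s • q) = s • h (s, (u, q))) ∧
      (∀ s u, h (s, (u, 0)) = 0) ∧ ∀ u q, h (0, (u, q)) = fderiv ℝ f (u, 0) (0, q) := by
  have h2 : ContDiff ℝ ∞ (fderiv ℝ f) := hf.fderiv_right (by norm_cast)
  -- The quotient is `h(s, u, q) = ∫₀¹ D f(u, τ s q)(0, q) dτ`; this is its integrand.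
  have hg : ContDiff ℝ ∞ fun p : ℝ × (ℝ × (E × F)) =>
      fderiv ℝ f (p.2.2.1, (p.1 * p.2.1) • p.2.2.2) ((0 : E), p.2.2.2) := by
    have h3 : ContDiff ℝ ∞ fun p : ℝ × (ℝ × (E × F)) => (p.2.2.1, (p.1 * p.2.1) • p.2.2.2) := by
      fun_prop
    have h4 : ContDiff ℝ ∞ fun p : ℝ × (ℝ × (E × F)) => ((0 : E), p.2.2.2) := by fun_prop
    exact (h2.comp h3).clm_apply h4
  refine ⟨_, contDiff_parametric_integral hg, fun s u q => ?_, fun s u => ?_, fun u q => ?_⟩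
  · simp only
    rw [← intervalIntegral.integral_smul]
    have h5 : ∀ τ : ℝ, HasDerivAt (fun τ : ℝ => f (u, (τ * s) • q))
        (s • fderiv ℝ f (u, (τ * s) • q) (0, q)) τ := by
      intro τ
      have h6 : HasDerivAt (fun τ : ℝ => (u, (τ * s) • q)) (0, s • q) τ := by
        refine (hasDerivAt_const τ u).prodMk ?_
        simpa using ((hasDerivAt_id τ).mul_const s).smul_const q
      have := ((hf.differentiable (by simp)) (u, (τ * s) • q)).hasFDerivAt.comp_hasDerivAt τ h6
      convert! this using 1
      rw [← map_smul]
      simp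
    rw [intervalIntegral.integral_eq_sub_of_hasDerivAt (fun τ _ => h5 τ)]
    · simp [h0]
    · refine Continuous.intervalIntegrable ?_ _ _
      have := hg.continuous.comp
        (by fun_prop : Continuous fun τ : ℝ => ((τ, (s, (u, q))) : ℝ × (ℝ × (E × F))))
      exact this.const_smul s
  · simp only [smul_zero, intervalIntegral.integral_const, sub_zero, one_smul]
    exact map_zero _
  · simp

end Flow

end ContactNbhd
end

noncomputable section

namespace ContactNbhd

/-! ### Contraction along an Euler-like vector field -/

section EulerLike

open Set

/-- The cutoff makes a locally defined function global, so that the globally stated Hadamard lemma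
applies. -/
theorem contDiff_bump_smul {W G : Type*} [NormedAddCommGroup W] [NormedSpace ℝ W]
    [FiniteDimensional ℝ W] [NormedAddCommGroup G] [NormedSpace ℝ G] {w : W} (χ : ContDiffBump w)
    {Ω : Set W} (hΩ : IsOpen Ω) (hχ : tsupport χ ⊆ Ω) {f : W → G} (hf : ContDiffOn ℝ ∞ f Ω) :
    ContDiff ℝ ∞ fun p => χ p • f p := by
  refine contDiff_iff_contDiffAt.mpr fun p => ?_
  by_cases hp : p ∈ tsupport χ
  · exact χ.contDiff.contDiffAt.smul (hf.contDiffAt (hΩ.mem_nhds (hχ hp)))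
  · refine (contDiffAt_const (c := (0 : G))).congr_of_eventuallyEq ?_
    filter_upwards [notMem_tsupport_iff_eventuallyEq.mp hp] with q hq
    simp [hq]

variable {E F : Type} [NormedAddCommGroup E] [NormedSpace ℝ E] [FiniteDimensional ℝ E]
  [NormedAddCommGroup F] [NormedSpace ℝ F] [FiniteDimensional ℝ F]

/-- Division of the transverse components of an Euler-like vector field: near `(u₀, 0)`, one has
`z (u, s q) = (s h₁(s, u, q), s² h₂(s, u, q) - s q)` with smooth `h₁` and `h₂`. -/
theorem exists_eulerLike_division {Ω : Set (E × F)} (hΩ : IsOpen Ω) {z : E × F → E × F}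
    (hz : ContDiffOn ℝ ∞ z Ω) {u₀ : E} (hu₀ : (u₀, (0 : F)) ∈ Ω)
    (h0 : ∀ u, (u, (0 : F)) ∈ Ω → z (u, 0) = 0)
    (h1 : ∀ u, (u, (0 : F)) ∈ Ω → ∀ q, (fderiv ℝ z (u, 0) (0, q)).2 = -q) :
    ∃ (h₁ : ℝ × (E × F) → E) (h₂ : ℝ × (E × F) → F) (Ω' : Set (E × F)), ContDiff ℝ ∞ h₁ ∧
      ContDiff ℝ ∞ h₂ ∧ IsOpen Ω' ∧ (u₀, (0 : F)) ∈ Ω' ∧ Ω' ⊆ Ω ∧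
      (∀ s u, h₁ (s, (u, 0)) = 0) ∧ (∀ s u, h₂ (s, (u, 0)) = 0) ∧
      ∀ s u q, (u, s • q) ∈ Ω' →
        z (u, s • q) = (s • h₁ (s, (u, q)), s • s • h₂ (s, (u, q)) - s • q) := by
  obtain ⟨r, hr, hrΩ⟩ := Metric.isOpen_iff.mp hΩ _ hu₀
  let χ : ContDiffBump (u₀, (0 : F)) := ⟨r / 3, r / 2, by positivity, by linarith⟩
  have hχΩ : tsupport χ ⊆ Ω := by
    rw [χ.tsupport_eq]
    exact (Metric.closedBall_subset_ball (by change r / 2 < r; linarith)).trans hrΩ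
  have hf1 : ContDiff ℝ ∞ fun p => χ p • (z p).1 :=
    contDiff_bump_smul χ hΩ hχΩ hz.fst
  -- Adding `q` cancels the linear part of the second component, so this function vanishes to second
  -- order along `q = 0` in the fibre directions and can be divided by `s` twice.
  have hf2 : ContDiff ℝ ∞ fun p => χ p • ((z p).2 + p.2) :=
    contDiff_bump_smul χ hΩ hχΩ (hz.snd.add contDiffOn_snd)
  have hf10 : ∀ u, χ (u, 0) • (z (u, 0)).1 = 0 := by
    intro u
    by_cases hu : (u, (0 : F)) ∈ Ω
    · simp [h0 u hu]
    · rw [image_eq_zero_of_notMem_tsupport fun h => hu (hχΩ h), zero_smul]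
  have hf20 : ∀ u, χ (u, 0) • ((z (u, 0)).2 + (u, (0 : F)).2) = 0 := by
    intro u
    by_cases hu : (u, (0 : F)) ∈ Ω
    · simp [h0 u hu]
    · rw [image_eq_zero_of_notMem_tsupport fun h => hu (hχΩ h), zero_smul]
  have hf2d : ∀ u q, fderiv ℝ (fun p => χ p • ((z p).2 + p.2)) (u, 0) (0, q) = 0 := by
    intro u q
    by_cases hu : (u, (0 : F)) ∈ Ω
    · have hzd : DifferentiableAt ℝ z (u, 0) :=
        (hz.contDiffAt (hΩ.mem_nhds hu)).differentiableAt (by simp)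
      have hd := (χ.contDiff (n := 1)).contDiffAt.differentiableAt (x := (u, (0 : F))) one_ne_zero
      have : HasFDerivAt (fun p => χ p • ((z p).2 + p.2)) _ (u, 0) :=
        hd.hasFDerivAt.smul (hzd.hasFDerivAt.snd.add hasFDerivAt_snd)
      rw [this.fderiv]
      simp [h0 u hu, h1 u hu]
    · have : (fun p => χ p • ((z p).2 + p.2)) =ᶠ[𝓝 (u, (0 : F))] fun _ => 0 := by
        filter_upwards [notMem_tsupport_iff_eventuallyEq.mp fun h => hu (hχΩ h)] with p hp
        simp [hp]
      rw [this.fderiv_eq]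
      simp
  obtain ⟨h₁, hh₁, hs₁, hz₁, -⟩ := exists_hadamard hf1 hf10
  obtain ⟨k, hk, hsk, hzk, hdk⟩ := exists_hadamard hf2 hf20
  have hk' : ContDiff ℝ ∞ fun p : (E × F) × ℝ => k (p.2, p.1) :=
    hk.comp (contDiff_snd.prodMk contDiff_fst)
  -- The second division: `k` vanishes at `s = 0`, so Hadamard's lemma is used again with `s` itself
  -- as the transverse variable, scaled from the vector `1`.
  obtain ⟨l, hl, hsl, -, -⟩ := exists_hadamard hk' fun u => by
    change k (0, (u.1, u.2)) = 0
    rw [hdk, hf2d]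
  have hkl : ∀ s w, k (s, w) = s • l (s, (w, 1)) := by
    intro s w
    have := hsl s w 1
    simpa using this
  refine ⟨h₁, fun p => l (p.1, (p.2, 1)), Metric.ball (u₀, 0) (r / 3), hh₁,
    hl.comp (by fun_prop), Metric.isOpen_ball, Metric.mem_ball_self (by positivity),
    (Metric.ball_subset_ball (by linarith)).trans hrΩ, hz₁, fun s u => ?_, fun s u q hp => ?_⟩
  -- The relation `k = s l` gives the vanishing of `l` only for `s ≠ 0`; density of those `s` covers
  -- `s = 0`.
  · have hc : Continuous fun s : ℝ => l (s, ((u, (0 : F)), 1)) :=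
      hl.continuous.comp (by fun_prop)
    refine congrFun (hc.ext_on (dense_compl_singleton (0 : ℝ)) continuous_const
      (g := fun _ => (0 : F)) fun s hs => ?_) s
    have := hkl s (u, 0)
    rw [hzk] at this
    exact (smul_eq_zero.mp this.symm).resolve_left hs
  · have hχ1 : χ (u, s • q) = 1 := χ.one_of_mem_closedBall (Metric.ball_subset_closedBall hp)
    have e1 := hs₁ s u q
    have e2 := hsk s u q
    rw [hkl] at e2
    simp only [hχ1, one_smul] at e1 e2
    exact Prod.ext e1 (eq_sub_of_add_eq e2)

/-- The flow of an Euler-like vector field `-z`, parametrized so that it extends smoothly to the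
limit points: `s ∂_sΦ = -z(Φ)`, `Φ(1, w) = w` and `Φ(0, w)` lies in `E × 0`. -/
theorem exists_contraction {Ω : Set (E × F)} (hΩ : IsOpen Ω) {z : E × F → E × F}
    (hz : ContDiffOn ℝ ∞ z Ω) {u₀ : E} (hu₀ : (u₀, (0 : F)) ∈ Ω)
    (h0 : ∀ u, (u, (0 : F)) ∈ Ω → z (u, 0) = 0)
    (h1 : ∀ u, (u, (0 : F)) ∈ Ω → ∀ q, (fderiv ℝ z (u, 0) (0, q)).2 = -q) :
    ∃ (Φ : ℝ × (E × F) → E × F) (N : Set (E × F)), ContDiff ℝ ∞ Φ ∧ IsOpen N ∧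
      (u₀, (0 : F)) ∈ N ∧ N ⊆ Ω ∧ (∀ w, Φ (1, w) = w) ∧ (∀ w, (Φ (0, w)).2 = 0) ∧
      (∀ w ∈ N, ∀ s ∈ Icc (0 : ℝ) 1, Φ (s, w) ∈ Ω) ∧
      (∀ w ∈ N, ∀ s ∈ Ioo (0 : ℝ) 1,
        HasDerivAt (fun s => Φ (s, w)) (-(s⁻¹ • z (Φ (s, w)))) s) ∧
      ∀ u, (u, (0 : F)) ∈ N → ∀ s ∈ Icc (0 : ℝ) 1, Φ (s, (u, 0)) = (u, 0) := by
  obtain ⟨h₁, h₂, Ω', hh₁, hh₂, hΩ', hu₀', hΩΩ', hz₁, hz₂, hdiv⟩ :=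
    exists_eulerLike_division hΩ hz hu₀ h0 h1
  -- Centre `1 / 2` and inner radius `1` make the cutoff equal to `1` on `[0, 1] × ball (u₀, 0) 1`.
  let χ : ContDiffBump ((1 / 2 : ℝ), (u₀, (0 : F))) := ⟨1, 2, one_pos, one_lt_two⟩
  -- Writing `Φ = (u, s q)`, the equation `s ∂_s Φ = -z(Φ)` becomes `u' = -h₁`, `q' = -h₂` after the
  -- powers of `s` cancel, and it is regular at `s = 0`. `X` is this equation in the time `t = 1 -
  -- s`, starting at `s = 1` with `(u, q) = w`.
  let X : ℝ × (E × F) → ℝ × (E × F) := fun p => χ p • ((-1 : ℝ), (h₁ p, h₂ p))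
  have hX : ContDiff ℝ ∞ X := χ.contDiff.smul (contDiff_const.prodMk (hh₁.prodMk hh₂))
  have hXc : HasCompactSupport X := χ.hasCompactSupport.smul_right
  obtain ⟨C, hC⟩ := hXc.exists_bound_of_continuous hX.continuous
  obtain ⟨K, hK⟩ : ∃ K, LipschitzWith K X :=
    ContDiff.lipschitzWith_of_hasCompactSupport hXc hX (by simp)
  obtain ⟨φ, hφ, hφ0, hφd, hφu⟩ := exists_contDiff_flow hX hK hC
  let B : Set (ℝ × (E × F)) := Metric.ball ((1 / 2 : ℝ), (u₀, (0 : F))) 1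
  have hBmem : ∀ s ∈ Icc (0 : ℝ) 1, ∀ w ∈ Metric.ball (u₀, (0 : F)) 1, (s, w) ∈ B := by
    intro s hs w hw
    rw [Metric.mem_ball, Prod.dist_eq, max_lt_iff]
    refine ⟨?_, hw⟩
    rw [Real.dist_eq, abs_lt]
    constructor <;> linarith [hs.1, hs.2]
  have hXB : ∀ p ∈ B, X p = ((-1 : ℝ), (h₁ p, h₂ p)) := by
    intro p hp
    have : χ p = 1 := χ.one_of_mem_closedBall (Metric.ball_subset_closedBall hp)
    simp [X, this]
  have hstat : ∀ u, (u, (0 : F)) ∈ Metric.ball (u₀, (0 : F)) 1 → ∀ t ∈ Icc (0 : ℝ) 1,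
      φ (t, (1, (u, 0))) = (1 - t, (u, 0)) := by
    intro u hu t ht
    have := hφu (fun t => (1 - t, (u, (0 : F)))) (by fun_prop) (fun τ hτ => by
      rw [hXB _ (hBmem (1 - τ) ⟨by linarith [hτ.2], by linarith [hτ.1]⟩ _ hu), hz₁, hz₂]
      exact (((hasDerivAt_id τ).const_sub 1).prodMk (hasDerivAt_const τ _)).hasDerivWithinAt) t ht
    simpa using this
  let O : Set (ℝ × (E × F)) := B ∩ {p | (p.2.1, p.1 • p.2.2) ∈ Ω'}
  have hO : IsOpen O := Metric.isOpen_ball.inter (hΩ'.preimage (by fun_prop))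
  -- The trajectory of `(u₀, 0)` is stationary in `(u, q)` and stays in the open set `O`; by
  -- compactness of the time interval so do all nearby trajectories.
  have hev : ∀ᶠ w in 𝓝 (u₀, (0 : F)), ∀ t ∈ Icc (0 : ℝ) 1, φ (t, (1, w)) ∈ O := by
    refine isCompact_Icc.eventually_forall_of_forall_eventually fun t ht => ?_
    have hc : Continuous fun p : (E × F) × ℝ => φ (p.2, (1, p.1)) :=
      hφ.continuous.comp (by fun_prop)
    refine hc.continuousAt.eventually_mem (hO.mem_nhds ?_)
    simp only
    rw [hstat u₀ (Metric.mem_ball_self one_pos) t ht]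
    exact ⟨hBmem (1 - t) ⟨by linarith [ht.2], by linarith [ht.1]⟩ _
      (Metric.mem_ball_self one_pos), by simpa using hu₀'⟩
  obtain ⟨N, hN, hNo, hNu⟩ := eventually_nhds_iff.mp
    (hev.and ((hΩ.eventually_mem hu₀).and
      (Metric.isOpen_ball.eventually_mem (Metric.mem_ball_self (x := (u₀, (0 : F))) one_pos))))
  have htime : ∀ w ∈ N, ∀ t ∈ Icc (0 : ℝ) 1, (φ (t, (1, w))).1 = 1 - t := by
    intro w hw t ht
    rcases ht.1.eq_or_lt with rfl | h
    · rw [hφ0]; simp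
    have hc : Continuous fun t : ℝ => (φ (t, (1, w))).1 := by
      have := hφ.continuous
      fun_prop
    obtain ⟨τ, hτ, he⟩ := exists_hasDerivAt_eq_slope (fun t : ℝ => (φ (t, (1, w))).1)
      (fun _ => -1) h hc.continuousOn (fun τ hτ => by
        have := (hφd (1, w) τ hτ.1).fst
        rwa [hXB _ ((hN w hw).1 τ ⟨hτ.1.le, hτ.2.le.trans ht.2⟩).1] at this)
    rw [hφ0, sub_zero, eq_div_iff h.ne'] at he
    linarith
  have hrev : ∀ s ∈ Icc (0 : ℝ) 1, 1 - s ∈ Icc (0 : ℝ) 1 := fun s hs =>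
    ⟨by linarith [hs.2], by linarith [hs.1]⟩
  have hmem : ∀ w ∈ N, ∀ s ∈ Icc (0 : ℝ) 1,
      ((φ (1 - s, (1, w))).2.1, s • (φ (1 - s, (1, w))).2.2) ∈ Ω' := by
    intro w hw s hs
    have := ((hN w hw).1 (1 - s) (hrev s hs)).2
    simp only [mem_ofPred_eq] at this
    rwa [htime w hw (1 - s) (hrev s hs), sub_sub_cancel] at this
  refine ⟨fun p => ((φ (1 - p.1, (1, p.2))).2.1, p.1 • (φ (1 - p.1, (1, p.2))).2.2), N, ?_, hNo, hNu,
    fun w hw => (hN w hw).2.1, fun w => ?_, fun w => ?_, fun w hw s hs => hΩΩ' (hmem w hw s hs),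
    fun w hw s hs => ?_, fun u hu s hs => ?_⟩
  · have : ContDiff ℝ ∞ fun p : ℝ × (E × F) => φ (1 - p.1, (1, p.2)) := hφ.comp (by fun_prop)
    fun_prop
  · simp [hφ0]
  · simp
  · have hs' := Ioo_subset_Icc_self hs
    have hd := (hφd (1, w) (1 - s) (by linarith [hs.2])).comp_const_sub 1 s
    rw [hXB _ ((hN w hw).1 _ (hrev s hs')).1] at hd
    have hd₁ : HasDerivAt (fun s => (φ (1 - s, (1, w))).2.1) (-h₁ (φ (1 - s, (1, w)))) s :=
      ((ContinuousLinearMap.fst ℝ E F).comp (.snd ℝ ℝ (E × F))).hasFDerivAt.comp_hasDerivAt s hd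
    have hd₂ : HasDerivAt (fun s => (φ (1 - s, (1, w))).2.2) (-h₂ (φ (1 - s, (1, w)))) s :=
      ((ContinuousLinearMap.snd ℝ E F).comp (.snd ℝ ℝ (E × F))).hasFDerivAt.comp_hasDerivAt s hd
    have hd' := hd₁.prodMk ((hasDerivAt_id s).smul hd₂)
    have hp : φ (1 - s, (1, w)) = (s, ((φ (1 - s, (1, w))).2.1, (φ (1 - s, (1, w))).2.2)) :=
      Prod.ext (by rw [htime w hw _ (hrev s hs')]; ring) rfl
    simp only
    rw [hdiv s _ _ (hmem w hw s hs'), ← hp]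
    convert! hd' using 1
    simp [smul_smul, hs.1.ne', sub_eq_neg_add]
  · simp only
    rw [hstat u (hN _ hu).2.2 _ (hrev s hs)]
    simp

end EulerLike

end ContactNbhd
end

noncomputable section

namespace ContactNbhd

/-! ### Contact forms on open subsets of vector spaces -/

section LinearAlgebra

open Module

/-- An isotropic subspace of half the dimension has the dimension of its orthogonal complement and
so equals it. -/
theorem mem_of_lagrangian {V : Type*} [AddCommGroup V] [Module ℝ V] [FiniteDimensional ℝ V]
    (B : LinearMap.BilinForm ℝ V) (halt : ∀ v w, B v w = -B w v)
    (hnd : ∀ v, (∀ w, B v w = 0) → v = 0) (S : Submodule ℝ V)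
    (hiso : ∀ s ∈ S, ∀ t ∈ S, B s t = 0) (hdim : finrank ℝ V = 2 * finrank ℝ S) {v : V}
    (hv : ∀ s ∈ S, B v s = 0) : v ∈ S := by
  have hB : B.Nondegenerate := ⟨hnd, fun v h => hnd v fun w => by rw [halt, h, neg_zero]⟩
  have hle : S ≤ B.orthogonal S := fun s hs t ht => hiso t ht s hs
  have heq : S = B.orthogonal S := Submodule.eq_of_le_of_finrank_eq hle (by
    rw [LinearMap.BilinForm.finrank_orthogonal hB]; omega)
  rw [heq]
  intro s hs
  change B s v = 0
  rw [halt, hv s hs, neg_zero]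

theorem isInvertible_of_injective {V V' : Type*} [NormedAddCommGroup V] [NormedSpace ℝ V]
    [FiniteDimensional ℝ V] [NormedAddCommGroup V'] [NormedSpace ℝ V'] [FiniteDimensional ℝ V']
    {f : V →L[ℝ] V'} (hf : ∀ v, f v = 0 → v = 0) (h : finrank ℝ V = finrank ℝ V') :
    f.IsInvertible :=
  ⟨(LinearMap.linearEquivOfInjective f.toLinearMap
    (LinearMap.ker_eq_bot.mp (LinearMap.ker_eq_bot'.mpr hf)) h).toContinuousLinearEquiv, by
      ext v; rfl⟩

end LinearAlgebra

section Contact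

open Set Module

variable {W : Type*} [NormedAddCommGroup W] [NormedSpace ℝ W]

/-- The exterior derivative of the one-form `a` at `p`. -/
def dForm (a : W → W →L[ℝ] ℝ) (p : W) : W →L[ℝ] W →L[ℝ] ℝ :=
  fderiv ℝ a p - (fderiv ℝ a p).flip

@[simp] theorem dForm_apply (a : W → W →L[ℝ] ℝ) (p v w : W) :
    dForm a p v w = fderiv ℝ a p v w - fderiv ℝ a p w v := rfl

theorem dForm_swap (a : W → W →L[ℝ] ℝ) (p v w : W) : dForm a p v w = -dForm a p w v := by
  simp

theorem contDiffOn_dForm [FiniteDimensional ℝ W] {a : W → W →L[ℝ] ℝ} {Ω : Set W} (hΩ : IsOpen Ω)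
    (ha : ContDiffOn ℝ ∞ a Ω) : ContDiffOn ℝ ∞ (dForm a) Ω := by
  have h1 : ContDiffOn ℝ ∞ (fderiv ℝ a) Ω := ha.fderiv_of_isOpen hΩ (by norm_cast)
  have h2 (v w : W) : ContDiffOn ℝ ∞ (fun p => fderiv ℝ a p v w) Ω :=
    (h1.clm_apply contDiffOn_const).clm_apply contDiffOn_const
  refine contDiffOn_clm_apply.mpr fun v => contDiffOn_clm_apply.mpr fun w => ?_
  simp only [dForm_apply]
  exact (h2 v w).sub (h2 w v)

/-- The exterior derivative is natural under pullback. -/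
theorem dForm_pullback {W' : Type*} [NormedAddCommGroup W'] [NormedSpace ℝ W']
    {a : W → W →L[ℝ] ℝ} {a' : W' → W' →L[ℝ] ℝ} {ψ : W → W'} {p : W}
    (hψ : ContDiffAt ℝ ∞ ψ p) (ha' : DifferentiableAt ℝ a' (ψ p))
    (h : ∀ᶠ q in 𝓝 p, a q = (a' (ψ q)).comp (fderiv ℝ ψ q)) (v w : W) :
    dForm a p v w = dForm a' (ψ p) (fderiv ℝ ψ p v) (fderiv ℝ ψ p w) := by
  have hψ1 : HasFDerivAt ψ (fderiv ℝ ψ p) p := (hψ.differentiableAt (by simp)).hasFDerivAt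
  have hψ2 : HasFDerivAt (fderiv ℝ ψ) (fderiv ℝ (fderiv ℝ ψ) p) p :=
    ((hψ.fderiv_right (m := ∞) (by norm_cast)).differentiableAt (by simp)).hasFDerivAt
  have hsymm : IsSymmSndFDerivAt ℝ ψ p := hψ.isSymmSndFDerivAt
    (by rw [minSmoothness_of_isRCLikeNormedField]; exact WithTop.coe_le_coe.mpr le_top)
  have hc := (ha'.hasFDerivAt.comp p hψ1).clm_comp hψ2
  have hd : ∀ v w, fderiv ℝ a p v w = a' (ψ p) (fderiv ℝ (fderiv ℝ ψ) p v w) +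
      fderiv ℝ a' (ψ p) (fderiv ℝ ψ p v) (fderiv ℝ ψ p w) := by
    intro v w
    rw [Filter.EventuallyEq.fderiv_eq h]
    have := hc.fderiv
    simp only [Function.comp_def] at this
    rw [this]
    simp
  -- The terms containing the second derivative of `ψ` are symmetric in `v`, `w` and drop out.
  simp only [dForm_apply, hd]
  rw [hsymm v w]
  ring

/-- A contact form on an open subset of a vector space. -/
structure IsContactOn (a : W → W →L[ℝ] ℝ) (Ω : Set W) : Prop where
  isOpen : IsOpen Ω
  contDiffOn : ContDiffOn ℝ ∞ a Ω
  ne_zero : ∀ p ∈ Ω, a p ≠ 0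
  nondegenerate : ∀ p ∈ Ω, ∀ v, a p v = 0 → (∀ w, a p w = 0 → dForm a p v w = 0) → v = 0

theorem IsContactOn.mono {a : W → W →L[ℝ] ℝ} {Ω Ω' : Set W} (h : IsContactOn a Ω)
    (hΩ' : IsOpen Ω') (hsub : Ω' ⊆ Ω) : IsContactOn a Ω' :=
  ⟨hΩ', h.contDiffOn.mono hsub, fun p hp => h.ne_zero p (hsub hp),
    fun p hp => h.nondegenerate p (hsub hp)⟩

/-- The linear map `(z, g) ↦ (ι_z da + g a, a z)`. -/
def contactMap (a : W → W →L[ℝ] ℝ) (p : W) : W × ℝ →L[ℝ] (W →L[ℝ] ℝ) × ℝ :=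
  ((dForm a p).coprod (ContinuousLinearMap.toSpanSingleton ℝ (a p))).prod
    ((a p).comp (ContinuousLinearMap.fst ℝ W ℝ))

@[simp] theorem contactMap_apply (a : W → W →L[ℝ] ℝ) (p : W) (z : W × ℝ) :
    contactMap a p z = (dForm a p z.1 + z.2 • a p, a p z.1) := rfl

theorem contDiffOn_contactMap [FiniteDimensional ℝ W] {a : W → W →L[ℝ] ℝ} {Ω : Set W}
    (hΩ : IsOpen Ω) (ha : ContDiffOn ℝ ∞ a Ω) : ContDiffOn ℝ ∞ (contactMap a) Ω := by
  refine contDiffOn_clm_apply.mpr fun z => ?_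
  simp only [contactMap_apply]
  exact (((contDiffOn_dForm hΩ ha).clm_apply contDiffOn_const).add
    ((contDiffOn_const (c := z.2)).smul ha)).prodMk (ha.clm_apply contDiffOn_const)

variable [FiniteDimensional ℝ W]

/-- If `ι_z da + g a = 0` and `a z = 0`, then `z` lies in the kernel of `da` on `ker a`, so `z = 0`,
and then `g = 0` as `a ≠ 0`. Injectivity suffices because the dimensions agree. -/
theorem IsContactOn.isInvertible {a : W → W →L[ℝ] ℝ} {Ω : Set W} (h : IsContactOn a Ω) {p : W}
    (hp : p ∈ Ω) : (contactMap a p).IsInvertible := by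
  refine isInvertible_of_injective (fun z hz => ?_) ?_
  · rw [contactMap_apply, Prod.mk_eq_zero] at hz
    have h1 : z.1 = 0 := by
      refine h.nondegenerate p hp _ hz.2 fun w hw => ?_
      have := congrArg (fun f : W →L[ℝ] ℝ => f w) hz.1
      simpa [hw] using this
    refine Prod.ext h1 ?_
    have h2 := hz.1
    rw [h1, map_zero, zero_add] at h2
    exact (smul_eq_zero.mp h2).resolve_right (h.ne_zero p hp)
  · simp only [finrank_prod]
    congr 1
    rw [← LinearMap.toContinuousLinearMap.finrank_eq]
    exact Subspace.dual_finrank_eq.symm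

/-- The solution `(z, g)` of `a z = 0`, `ι_z da + g a = η`. -/
def contactPair (a η : W → W →L[ℝ] ℝ) (p : W) : W × ℝ :=
  (contactMap a p).inverse (η p, 0)

/-- The vector field `z` with `a z = 0` and `ι_z da = η` on `ker a`. -/
def contactField (a η : W → W →L[ℝ] ℝ) (p : W) : W := (contactPair a η p).1

theorem IsContactOn.contactPair_spec {a : W → W →L[ℝ] ℝ} {Ω : Set W} (h : IsContactOn a Ω)
    (η : W → W →L[ℝ] ℝ) {p : W} (hp : p ∈ Ω) :
    (∀ w, dForm a p (contactField a η p) w + (contactPair a η p).2 * a p w = η p w) ∧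
      a p (contactField a η p) = 0 := by
  have := (h.isInvertible hp).self_apply_inverse (η p, 0)
  change contactMap a p (contactPair a η p) = _ at this
  rw [contactMap_apply, Prod.mk.injEq] at this
  exact ⟨fun w => congrArg (fun f : W →L[ℝ] ℝ => f w) this.1, this.2⟩

theorem IsContactOn.contactPair_unique {a : W → W →L[ℝ] ℝ} {Ω : Set W} (h : IsContactOn a Ω)
    {η : W → W →L[ℝ] ℝ} {p : W} (hp : p ∈ Ω) {z : W} {g : ℝ} (hz : a p z = 0)
    (hg : ∀ w, dForm a p z w + g * a p w = η p w) : contactPair a η p = (z, g) := by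
  rw [contactPair, (h.isInvertible hp).inverse_apply_eq, contactMap_apply]
  refine Prod.ext ?_ hz.symm
  ext w
  exact (hg w).symm

theorem IsContactOn.contactPair_of_eq {a : W → W →L[ℝ] ℝ} {Ω : Set W} (h : IsContactOn a Ω)
    {η : W → W →L[ℝ] ℝ} {p : W} (hp : p ∈ Ω) (he : η p = a p) : contactPair a η p = (0, 1) :=
  h.contactPair_unique hp (map_zero _) fun w => by simp [he]

theorem IsContactOn.contDiffOn_contactPair {a : W → W →L[ℝ] ℝ} {Ω : Set W} (h : IsContactOn a Ω)
    {η : W → W →L[ℝ] ℝ} (hη : ContDiffOn ℝ ∞ η Ω) : ContDiffOn ℝ ∞ (contactPair a η) Ω := by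
  have h1 : ContDiffOn ℝ ∞ (fun p => (contactMap a p).inverse) Ω := fun p hp => by
    have := (h.isInvertible hp).contDiffAt_map_inverse (n := ∞)
    exact this.comp_contDiffWithinAt p (contDiffOn_contactMap h.isOpen h.contDiffOn p hp)
  exact h1.clm_apply (hη.prodMk contDiffOn_const)

/-- The vector field `contactField` is natural under local diffeomorphisms. -/
theorem contactField_pullback {W' : Type*} [NormedAddCommGroup W'] [NormedSpace ℝ W']
    [FiniteDimensional ℝ W'] {a η : W → W →L[ℝ] ℝ} {a' η' : W' → W' →L[ℝ] ℝ} {Ω : Set W}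
    {Ω' : Set W'} (h : IsContactOn a Ω) (h' : IsContactOn a' Ω') {ψ : W → W'} {p : W}
    (hp : p ∈ Ω) (hp' : ψ p ∈ Ω') (hψ : ContDiffAt ℝ ∞ ψ p)
    (hsurj : Function.Surjective (fderiv ℝ ψ p))
    (ha : ∀ᶠ q in 𝓝 p, a q = (a' (ψ q)).comp (fderiv ℝ ψ q))
    (hη : η p = (η' (ψ p)).comp (fderiv ℝ ψ p)) :
    contactField a' η' (ψ p) = fderiv ℝ ψ p (contactField a η p) := by
  obtain ⟨h1, h2⟩ := h.contactPair_spec η hp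
  have hd := dForm_pullback hψ ((h'.contDiffOn.contDiffAt (h'.isOpen.mem_nhds hp')).differentiableAt
    (by simp)) ha
  have hap := ha.self_of_nhds
  -- The pushed-forward vector, with the same factor `g`, solves the defining equations at `ψ p`;
  -- surjectivity of the differential ensures that all test vectors are reached.
  have := h'.contactPair_unique (η := η') (z := fderiv ℝ ψ p (contactField a η p))
    (g := (contactPair a η p).2) hp' (by rw [hap] at h2; exact h2) fun w' => by
      obtain ⟨w, rfl⟩ := hsurj w'
      have := h1 w
      rw [hd, hη, hap] at this
      exact this
  exact congrArg Prod.fst this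

end Contact

end ContactNbhd
end

noncomputable section

namespace ContactNbhd

/-! ### The contact field along a pre-Lagrangian: its linearization. -/

section EulerLikeContact

open Set Module

variable {E F : Type*} [NormedAddCommGroup E] [NormedSpace ℝ E]
  [NormedAddCommGroup F] [NormedSpace ℝ F]

/-- A contact form `a` near `L = {v = 0}` in `E × F` for which `L` is pre-Lagrangian, together with
a closed one-form `η` which agrees with `a` along `L`. -/
structure IsPreLagrangianOn (a η : E × F → E × F →L[ℝ] ℝ) (Ω : Set (E × F)) : Prop where
  contact : IsContactOn a Ω
  contDiffOn : ContDiffOn ℝ ∞ η Ω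
  closed : ∀ p ∈ Ω, ∀ v w, fderiv ℝ η p v w = fderiv ℝ η p w v
  eq_zero_section : ∀ u : E, (u, (0 : F)) ∈ Ω → η (u, 0) = a (u, 0)
  transversal : ∀ u : E, (u, (0 : F)) ∈ Ω → ∃ e : E, a (u, 0) (e, 0) ≠ 0

variable {a η : E × F → E × F →L[ℝ] ℝ} {Ω : Set (E × F)}

theorem IsPreLagrangianOn.mono (h : IsPreLagrangianOn a η Ω) {Ω' : Set (E × F)} (hΩ' : IsOpen Ω')
    (hsub : Ω' ⊆ Ω) : IsPreLagrangianOn a η Ω' :=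
  ⟨h.contact.mono hΩ' hsub, h.contDiffOn.mono hsub, fun p hp => h.closed p (hsub hp),
    fun u hu => h.eq_zero_section u (hsub hu), fun u hu => h.transversal u (hsub hu)⟩

/-- The two forms agree along `v = 0`, hence so do their derivatives in directions tangent to it,
even when evaluated on transverse vectors. -/
theorem IsPreLagrangianOn.fderiv_eq_fderiv (h : IsPreLagrangianOn a η Ω) {u : E}
    (hu : (u, (0 : F)) ∈ Ω) (e : E) : fderiv ℝ η (u, 0) (e, 0) = fderiv ℝ a (u, 0) (e, 0) := by
  have hΩ := h.contact.isOpen.mem_nhds hu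
  have h1 := ((h.contDiffOn.contDiffAt hΩ).differentiableAt (by simp)).hasFDerivAt
  have h2 := ((h.contact.contDiffOn.contDiffAt hΩ).differentiableAt (by simp)).hasFDerivAt
  have hl : HasFDerivAt (fun u : E => (u, (0 : F))) (ContinuousLinearMap.inl ℝ E F) u :=
    (ContinuousLinearMap.inl ℝ E F).hasFDerivAt
  have h1' := h1.comp u hl
  have h2' := h2.comp u hl
  have heq : (η ∘ fun u : E => (u, (0 : F))) =ᶠ[𝓝 u] (a ∘ fun u : E => (u, (0 : F))) := by
    filter_upwards [hl.continuousAt.preimage_mem_nhds hΩ] with u' hu'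
    exact h.eq_zero_section u' hu'
  have := (h1'.congr_of_eventuallyEq heq.symm).unique h2'
  exact congrArg (fun f : E →L[ℝ] E × F →L[ℝ] ℝ => f e) this

/-- On vectors tangent to `L`, `da` agrees with `dη = 0`. So `TL ∩ ker a` is isotropic in `ker a`.
-/
theorem IsPreLagrangianOn.dForm_eq_zero (h : IsPreLagrangianOn a η Ω) {u : E}
    (hu : (u, (0 : F)) ∈ Ω) (e e' : E) : dForm a (u, 0) (e, 0) (e', 0) = 0 := by
  rw [dForm_apply, ← h.fderiv_eq_fderiv hu, ← h.fderiv_eq_fderiv hu, h.closed _ hu, sub_self]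

variable [FiniteDimensional ℝ E] [FiniteDimensional ℝ F]

theorem IsPreLagrangianOn.contactPair_zero (h : IsPreLagrangianOn a η Ω) {u : E}
    (hu : (u, (0 : F)) ∈ Ω) : contactPair a η (u, 0) = (0, 1) :=
  h.contact.contactPair_of_eq hu (h.eq_zero_section u hu)

theorem IsPreLagrangianOn.contactField_zero (h : IsPreLagrangianOn a η Ω) {u : E}
    (hu : (u, (0 : F)) ∈ Ω) : contactField a η (u, 0) = 0 :=
  congrArg Prod.fst (h.contactPair_zero hu)

theorem IsPreLagrangianOn.contDiffOn_contactField (h : IsPreLagrangianOn a η Ω) :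
    ContDiffOn ℝ ∞ (contactField a η) Ω :=
  (h.contact.contDiffOn_contactPair h.contDiffOn).fst

theorem IsPreLagrangianOn.fderiv_contactField_inl (h : IsPreLagrangianOn a η Ω) {u : E}
    (hu : (u, (0 : F)) ∈ Ω) (e : E) : fderiv ℝ (contactField a η) (u, 0) (e, 0) = 0 := by
  have hΩ := h.contact.isOpen.mem_nhds hu
  have h1 := ((h.contDiffOn_contactField.contDiffAt hΩ).differentiableAt (by simp)).hasFDerivAt
  have hl : HasFDerivAt (fun u : E => (u, (0 : F))) (ContinuousLinearMap.inl ℝ E F) u :=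
    (ContinuousLinearMap.inl ℝ E F).hasFDerivAt
  have heq : (contactField a η ∘ fun u : E => (u, (0 : F))) =ᶠ[𝓝 u] fun _ => 0 := by
    filter_upwards [hl.continuousAt.preimage_mem_nhds hΩ] with u' hu'
    exact h.contactField_zero hu'
  have := (h1.comp u hl).unique ((hasFDerivAt_const (0 : E × F) u).congr_of_eventuallyEq heq)
  exact congrArg (fun f : E →L[ℝ] E × F => f e) this

/-- The linearization of the defining equations of the contact field along the zero section. -/
theorem IsPreLagrangianOn.fderiv_contactField_spec (h : IsPreLagrangianOn a η Ω) {u : E}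
    (hu : (u, (0 : F)) ∈ Ω) (k : E × F) :
    a (u, 0) (fderiv ℝ (contactField a η) (u, 0) k) = 0 ∧
      ∃ c : ℝ, ∀ w, dForm a (u, 0) (fderiv ℝ (contactField a η) (u, 0) k) w + c * a (u, 0) w +
        fderiv ℝ a (u, 0) k w = fderiv ℝ η (u, 0) k w := by
  have hΩ := h.contact.isOpen.mem_nhds hu
  have ha := ((h.contact.contDiffOn.contDiffAt hΩ).differentiableAt (by simp)).hasFDerivAt
  have hη := ((h.contDiffOn.contDiffAt hΩ).differentiableAt (by simp)).hasFDerivAt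
  have hz := ((h.contDiffOn_contactField.contDiffAt hΩ).differentiableAt (by simp)).hasFDerivAt
  have hP := (((h.contact.contDiffOn_contactPair h.contDiffOn).contDiffAt hΩ).differentiableAt
    (by simp))
  have hg := hP.snd.hasFDerivAt
  have hd := (((contDiffOn_dForm h.contact.isOpen h.contact.contDiffOn).contDiffAt
    hΩ).differentiableAt (by simp)).hasFDerivAt
  constructor
  · have h1 := ha.clm_apply hz
    have h2 : (fun q => a q (contactField a η q)) =ᶠ[𝓝 (u, (0 : F))] fun _ => 0 := by
      filter_upwards [hΩ] with q hq using (h.contact.contactPair_spec η hq).2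
    have h3 := h1.unique ((hasFDerivAt_const (0 : ℝ) (u, (0 : F))).congr_of_eventuallyEq h2)
    have h4 := congrArg (fun f : E × F →L[ℝ] ℝ => f k) h3
    simpa [h.contactField_zero hu] using h4
  -- The identity `ι_z da + g a = η` is differentiated at a point where `z = 0` and `g = 1`: the
  -- derivative of `da` is multiplied by zero, and `c = dg(k)`.
  · refine ⟨fderiv ℝ (fun q => (contactPair a η q).2) (u, 0) k, fun w => ?_⟩
    have hcw (f : E × F → E × F →L[ℝ] ℝ) {f'} (hf : HasFDerivAt f f' (u, (0 : F))) :
        HasFDerivAt (fun q => f q w) (f'.flip w) (u, (0 : F)) := by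
      simpa using hf.clm_apply (hasFDerivAt_const w (u, (0 : F)))
    have hdz := hcw _ (hd.clm_apply hz)
    have h1 := hdz.add (hg.mul (hcw a ha))
    have h2 : (fun q => η q w) =ᶠ[𝓝 (u, (0 : F))]
        fun q => dForm a q (contactField a η q) w + (contactPair a η q).2 * a q w := by
      filter_upwards [hΩ] with q hq using ((h.contact.contactPair_spec η hq).1 w).symm
    have h3 := (h1.congr_of_eventuallyEq h2).unique (hcw η hη)
    have h4 := congrArg (fun f : E × F →L[ℝ] ℝ => f k) h3
    simp [h.contactField_zero hu, h.contactPair_zero hu] at h4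
    rw [dForm_apply]
    linarith

/-- The negative of the contact field is Euler-like along the zero section. -/
theorem IsPreLagrangianOn.fderiv_contactField_inr (h : IsPreLagrangianOn a η Ω)
    (hdim : finrank ℝ F + 1 = finrank ℝ E) {u : E} (hu : (u, (0 : F)) ∈ Ω) (q : F) :
    (fderiv ℝ (contactField a η) (u, 0) (0, q)).2 = -q := by
  set p : E × F := (u, 0) with hp
  set D := fderiv ℝ (contactField a η) p with hD
  obtain ⟨e₁, he₁⟩ := h.transversal u hu
  -- A correction by a vector tangent to `L` brings `(0, q)` into `ker a`. It does not affect `D`,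
  -- which vanishes on `TL`.
  let e₀ : E := (a p (0, q) / a p (e₁, 0)) • e₁
  have he₀ : a p (e₀, 0) = a p (0, q) := by
    have : ((e₀, 0) : E × F) = (a p (0, q) / a p (e₁, 0)) • (e₁, 0) := by simp [e₀]
    rw [this, map_smul, smul_eq_mul, div_mul_cancel₀ _ he₁]
  let k : E × F := (0, q) - (e₀, 0)
  have hk : a p k = 0 := by
    change a p ((0, q) - (e₀, 0)) = 0
    rw [map_sub, he₀, sub_self]
  have hDk : D k = D (0, q) := by
    simp only [k, map_sub]
    rw [hD, hp, h.fderiv_contactField_inl hu, sub_zero]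
  obtain ⟨h1, c, h2⟩ := h.fderiv_contactField_spec hu k
  rw [← hp, ← hD] at h1 h2
  -- The goal is that `v` is tangent to `L`; its fibre component is the required identity.
  let v : E × F := D k + k
  have hv : a p v = 0 := by simp only [v, map_add, h1, hk, add_zero]
  -- For tangent `e` in `ker a`, the linearized equation gives `da(v, e) = Dη(k) e - Da(e) k`.
  -- Closedness of `η` turns the first term into `Dη(e) k`, which equals `Da(e) k`.
  have hve (e : E) (he : a p (e, 0) = 0) : dForm a p v (e, 0) = 0 := by
    have h3 := h2 (e, 0)
    have h4 := h.closed p hu k (e, 0)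
    have h5 := congrArg (fun f : E × F →L[ℝ] ℝ => f k) (h.fderiv_eq_fderiv hu e)
    rw [he] at h3
    simp only [← hp] at h5
    simp only [v, map_add, add_apply]
    rw [dForm_apply a p k]
    linarith
  have hpa : a p ≠ 0 := h.contact.ne_zero p hu
  let K := LinearMap.ker (a p).toLinearMap
  let B : LinearMap.BilinForm ℝ K := LinearMap.mk₂ ℝ (fun v w => dForm a p v w)
    (fun _ _ _ => by simp) (fun _ _ _ => by simp) (fun _ _ _ => by simp; ring) (fun _ _ _ => by simp)
  let b : E →ₗ[ℝ] ℝ := (a p).toLinearMap ∘ₗ LinearMap.inl ℝ E F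
  let j : LinearMap.ker b →ₗ[ℝ] K :=
    ((LinearMap.inl ℝ E F).comp (LinearMap.ker b).subtype).codRestrict K fun e => e.2
  have hj : Function.Injective j := by
    intro x y hxy
    exact Subtype.ext (congrArg (fun z : K => (z : E × F).1) hxy)
  have hK : finrank ℝ K + 1 = finrank ℝ E + finrank ℝ F := by
    have := (a p).toLinearMap.finrank_range_add_finrank_ker
    rw [LinearMap.range_eq_top.mpr (LinearMap.surjective fun h0 => hpa (by
      exact ContinuousLinearMap.coe_injective h0)), finrank_top, finrank_self,
      finrank_prod] at this
    simp only [K]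
    omega
  have hb : finrank ℝ (LinearMap.ker b) + 1 = finrank ℝ E := by
    have := b.finrank_range_add_finrank_ker
    rw [LinearMap.range_eq_top.mpr (LinearMap.surjective fun h0 => he₁
      (congrArg (fun f : E →ₗ[ℝ] ℝ => f e₁) h0)), finrank_top, finrank_self] at this
    omega
  -- Here `dim ker a = dim E + dim F - 1 = 2 dim F`, while the tangent part has dimension `dim E - 1
  -- = dim F`, so it is Lagrangian.
  have hmem := mem_of_lagrangian (v := (⟨v, hv⟩ : K)) B (fun v w => dForm_swap a p v w)
    (fun v hv' => Subtype.ext (h.contact.nondegenerate p hu v v.2 fun w hw => hv' ⟨w, hw⟩))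
    (LinearMap.range j) (by
      rintro _ ⟨s, rfl⟩ _ ⟨t, rfl⟩
      exact h.dForm_eq_zero hu s t) (by
      rw [LinearMap.finrank_range_of_inj hj]; omega) (by
      rintro _ ⟨s, rfl⟩
      exact hve s s.2)
  obtain ⟨s, hs⟩ := hmem
  have h6 : v.2 = 0 := (congrArg (fun z : K => (z : E × F).2) hs).symm
  simp only [v, Prod.snd_add, hDk, k, Prod.snd_sub, sub_zero] at h6
  exact eq_neg_of_add_eq_zero_left h6

end EulerLikeContact

end ContactNbhd
end

noncomputable section

namespace ContactNbhd

/-! ### The fibres of the contraction are Legendrian. -/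

section Legendrian

open Set Module

/-- Uniqueness for the singular linear equation `s b' = g b` with `g = 1 + O(s)`, for solutions that
vanish to second order at `s = 0`. -/
theorem eq_zero_of_mul_deriv_eq_mul {b b' g : ℝ → ℝ} {C : ℝ}
    (hb : ∀ s ∈ Icc (0 : ℝ) 1, HasDerivAt b (b' s) s) (h0 : b 0 = 0) (h0' : b' 0 = 0)
    (hg : ∀ s ∈ Icc (0 : ℝ) 1, |g s - 1| ≤ C * s)
    (h : ∀ s ∈ Ioo (0 : ℝ) 1, s * b' s = g s * b s) : b 1 = 0 := by
  have hC : 0 ≤ C := by simpa using (abs_nonneg _).trans (hg 1 (by simp))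
  have hlim : Filter.Tendsto (fun ε => |b ε / ε| * Real.exp C) (𝓝[>] 0) (𝓝 0) := by
    have h1 := (hasDerivAt_iff_tendsto_slope.mp (hb 0 (by simp))).mono_left
      (nhdsWithin_mono 0 (fun x (hx : 0 < x) => hx.ne' : Ioi (0 : ℝ) ⊆ {0}ᶜ))
    have h2 := (h1.abs.mul_const (Real.exp C))
    rw [h0', abs_zero, zero_mul] at h2
    refine h2.congr fun ε => ?_
    rw [slope_def_field, h0, sub_zero, sub_zero]
  -- The quotient `b / s` satisfies a regular linear equation with coefficient `(g - 1) / s`,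
  -- bounded by `C`. Grönwall's inequality on `[ε, 1]` bounds `b 1` by a multiple of `b ε / ε`,
  -- which tends to `b' 0 = 0`.
  have hle : ∀ᶠ ε in 𝓝[>] (0 : ℝ), |b 1| ≤ |b ε / ε| * Real.exp C := by
    filter_upwards [Ioo_mem_nhdsGT (zero_lt_one' ℝ)] with ε hε
    have hc : ∀ s ∈ Icc ε 1, HasDerivAt (fun s => b s / s) ((b' s * s - b s * 1) / s ^ 2) s :=
      fun s hs => (hb s ⟨hε.1.le.trans hs.1, hs.2⟩).div (hasDerivAt_id s) (hε.1.trans_le hs.1).ne'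
    have := norm_le_gronwallBound_of_norm_deriv_right_le (f := fun s => b s / s)
      (f' := fun s => (b' s * s - b s * 1) / s ^ 2) (δ := |b ε / ε|) (K := C) (ε := 0) (a := ε)
      (b := 1) (fun s hs => (hc s hs).continuousAt.continuousWithinAt)
      (fun s hs => (hc s ⟨hs.1, hs.2.le⟩).hasDerivWithinAt) le_rfl (fun s hs => by
        have hs0 : 0 < s := hε.1.trans_le hs.1
        have h1 := h s ⟨hs0, hs.2⟩
        have h2 : (b' s * s - b s * 1) / s ^ 2 = (g s - 1) / s * (b s / s) := by
          field_simp
          linarith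
        rw [h2, add_zero, norm_mul]
        refine mul_le_mul_of_nonneg_right ?_ (norm_nonneg _)
        rw [Real.norm_eq_abs, abs_div, abs_of_pos hs0, div_le_iff₀ hs0]
        exact hg s ⟨hs0.le, hs.2.le⟩) 1 ⟨hε.2.le, le_rfl⟩
    rw [gronwallBound_ε0, div_one] at this
    refine this.trans (mul_le_mul_of_nonneg_left (Real.exp_le_exp.mpr ?_) (abs_nonneg _))
    nlinarith [hε.1]
  exact abs_nonpos_iff.mp (ge_of_tendsto hlim hle)

variable {E F : Type*} [NormedAddCommGroup E] [NormedSpace ℝ E] [FiniteDimensional ℝ E]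
  [NormedAddCommGroup F] [NormedSpace ℝ F] [FiniteDimensional ℝ F]
  {a η : E × F → E × F →L[ℝ] ℝ} {Ω : Set (E × F)}

/-- The fibres of the contraction along the contact field are Legendrian. -/
theorem IsPreLagrangianOn.legendrian (h : IsPreLagrangianOn a η Ω) {Φ : ℝ × (E × F) → E × F}
    (hΦ : ContDiff ℝ ∞ Φ) {N : Set (E × F)} (hN : IsOpen N)
    (hNΩ : ∀ w ∈ N, ∀ s ∈ Icc (0 : ℝ) 1, Φ (s, w) ∈ Ω)
    (hode : ∀ w ∈ N, ∀ s ∈ Ioo (0 : ℝ) 1,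
      HasDerivAt (fun s => Φ (s, w)) (-(s⁻¹ • contactField a η (Φ (s, w)))) s)
    (h0 : ∀ w, (Φ (0, w)).2 = 0) (h1 : ∀ w, Φ (1, w) = w) {w k : E × F} (hw : w ∈ N)
    (hk : fderiv ℝ (fun w => Φ (0, w)) w k = 0) : a w k = 0 := by
  -- A one-parameter family of flow lines; its variation field `∂_t Ψ` runs from `0` at `s = 0` to
  -- `k` at `s = 1`.
  let Ψ : ℝ × ℝ → E × F := fun x => Φ (x.1, w + x.2 • k)
  have hΨ : ContDiff ℝ ∞ Ψ := hΦ.comp (contDiff_fst.prodMk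
    (contDiff_const.add (contDiff_snd.smul contDiff_const)))
  have hΨd (x : ℝ × ℝ) : HasFDerivAt Ψ (fderiv ℝ Ψ x) x :=
    (hΨ.differentiable (by simp) x).hasFDerivAt
  have hΨt (s : ℝ) : fderiv ℝ Ψ (s, 0) (0, 1) = fderiv ℝ (fun w => Φ (s, w)) w k := by
    have e1 := (hΨd (s, 0)).comp_hasDerivAt (0 : ℝ) ((hasDerivAt_const (0 : ℝ) s).prodMk
      (hasDerivAt_id (0 : ℝ)))
    have e2 : HasFDerivAt (fun w => Φ (s, w)) (fderiv ℝ (fun w => Φ (s, w)) w) w :=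
      ((hΦ.comp (contDiff_const.prodMk contDiff_id)).differentiable (by simp) w).hasFDerivAt
    have e3 : HasDerivAt (fun t : ℝ => w + t • k) k 0 := by
      simpa using ((hasDerivAt_id (0 : ℝ)).smul_const k).const_add w
    have e2' : HasFDerivAt (fun w => Φ (s, w)) (fderiv ℝ (fun w => Φ (s, w)) w)
      (w + (0 : ℝ) • k) := by simpa using e2
    exact e1.unique (e2'.comp_hasDerivAt (0 : ℝ) e3)
  have hΨ1 : fderiv ℝ Ψ (1, 0) (0, 1) = k := by
    rw [hΨt]
    simp [h1]
  have hΨ0 : fderiv ℝ Ψ (0, 0) (0, 1) = 0 := by rw [hΨt, hk]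
  have hΨs {s t : ℝ} (hs : s ∈ Ioo (0 : ℝ) 1) (ht : w + t • k ∈ N) :
      fderiv ℝ Ψ (s, t) (1, 0) = -(s⁻¹ • contactField a η (Ψ (s, t))) := by
    have e1 := (hΨd (s, t)).comp_hasDerivAt s ((hasDerivAt_id s).prodMk (hasDerivAt_const s t))
    exact e1.unique (hode _ ht s hs)
  let T : Set ℝ := {t | w + t • k ∈ N}
  have hT : T ∈ 𝓝 (0 : ℝ) :=
    (by fun_prop : Continuous fun t : ℝ => w + t • k).continuousAt.preimage_mem_nhds
      (hN.mem_nhds (by simpa using hw))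
  have hΩ' : IsOpen (Ψ ⁻¹' Ω) := h.contact.isOpen.preimage hΨ.continuous
  have hmem {s : ℝ} (hs : s ∈ Icc (0 : ℝ) 1) : (s, (0 : ℝ)) ∈ Ψ ⁻¹' Ω :=
    hNΩ _ (by simpa using hw) s hs
  have pull {c : E × F → E × F →L[ℝ] ℝ} (hc : ContDiffOn ℝ ∞ c Ω) :
      ContDiffOn ℝ ∞ (fun x => (c (Ψ x)).comp (fderiv ℝ Ψ x)) (Ψ ⁻¹' Ω) :=
    (hc.comp hΨ.contDiffOn (mapsTo_preimage _ _)).clm_comp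
      (hΨ.fderiv_right (m := ∞) (by norm_cast)).contDiffOn
  -- a one-form on the plane annihilating the `s`-direction
  have key {c : E × F → E × F →L[ℝ] ℝ} (hc : ContDiffOn ℝ ∞ c Ω)
      (hcz : ∀ p ∈ Ω, c p (contactField a η p) = 0) {s : ℝ} (hs : s ∈ Icc (0 : ℝ) 1) :
      HasDerivAt (fun s => c (Ψ (s, 0)) (fderiv ℝ Ψ (s, 0) (0, 1)))
        (dForm c (Ψ (s, 0)) (fderiv ℝ Ψ (s, 0) (1, 0)) (fderiv ℝ Ψ (s, 0) (0, 1))) s := by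
    let c' : ℝ × ℝ → ℝ × ℝ →L[ℝ] ℝ := fun x => (c (Ψ x)).comp (fderiv ℝ Ψ x)
    have hc' : ContDiffOn ℝ ∞ c' (Ψ ⁻¹' Ω) := pull hc
    have hcd {s : ℝ} (hs : s ∈ Icc (0 : ℝ) 1) : HasFDerivAt c' (fderiv ℝ c' (s, 0)) (s, 0) :=
      ((hc'.contDiffAt (hΩ'.mem_nhds (hmem hs))).differentiableAt (by simp)).hasFDerivAt
    have e1 {s : ℝ} (hs : s ∈ Icc (0 : ℝ) 1) :
        dForm c' (s, 0) (1, 0) (0, 1) = dForm c (Ψ (s, 0)) (fderiv ℝ Ψ (s, 0) (1, 0))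
          (fderiv ℝ Ψ (s, 0) (0, 1)) :=
      dForm_pullback hΨ.contDiffAt ((hc.contDiffAt (h.contact.isOpen.mem_nhds
        (hmem hs))).differentiableAt (by simp)) (Filter.Eventually.of_forall fun _ => rfl) _ _
    have e2 {s : ℝ} (hs : s ∈ Icc (0 : ℝ) 1) :
        HasDerivAt (fun s => c' (s, 0) (0, 1)) (fderiv ℝ c' (s, 0) (1, 0) (0, 1)) s := by
      have := (hcd hs).comp_hasDerivAt s ((hasDerivAt_id s).prodMk (hasDerivAt_const s (0 : ℝ)))
      simpa using this.clm_apply (hasDerivAt_const s ((0, 1) : ℝ × ℝ))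
    -- For interior `s`, `∂_s Ψ` is a multiple of the contact field for all small `t`, so `c'` kills
    -- the `s`-direction on a neighbourhood and its `t`-derivative there vanishes.
    have e3 {s : ℝ} (hs : s ∈ Ioo (0 : ℝ) 1) : fderiv ℝ c' (s, 0) (0, 1) (1, 0) = 0 := by
      have d1 := (hcd (Ioo_subset_Icc_self hs)).comp_hasDerivAt (0 : ℝ)
        ((hasDerivAt_const (0 : ℝ) s).prodMk (hasDerivAt_id (0 : ℝ)))
      have d2 := d1.clm_apply (hasDerivAt_const (0 : ℝ) ((1, 0) : ℝ × ℝ))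
      have d3 : (fun t : ℝ => c' (s, t) (1, 0)) =ᶠ[𝓝 0] fun _ => 0 := by
        filter_upwards [hT] with t ht
        change c (Ψ (s, t)) (fderiv ℝ Ψ (s, t) (1, 0)) = 0
        rw [hΨs hs ht, map_neg, map_smul, hcz _ (hNΩ _ ht s (Ioo_subset_Icc_self hs)), smul_zero,
          neg_zero]
      have d4 := (d2.congr_of_eventuallyEq (f₁ := fun t : ℝ => c' (s, t) (1, 0))
        (Filter.Eventually.of_forall fun _ => rfl)).unique
        ((hasDerivAt_const (0 : ℝ) (0 : ℝ)).congr_of_eventuallyEq d3)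
      simpa using d4
    -- The differential equation is known only for `0 < s < 1`; continuity carries the identity to
    -- both endpoints.
    have e4 : ContinuousOn (fun s => fderiv ℝ c' (s, 0) (0, 1) (1, 0)) (Icc 0 1) := by
      have d1 : ContinuousOn (fderiv ℝ c') (Ψ ⁻¹' Ω) := hc'.continuousOn_fderiv_of_isOpen hΩ' (by simp)
      have d2 : ContinuousOn (fun s : ℝ => fderiv ℝ c' (s, 0)) (Icc 0 1) :=
        d1.comp (by fun_prop) fun s hs => hmem hs
      exact (d2.clm_apply continuousOn_const).clm_apply continuousOn_const
    have e5 : ∀ s ∈ Icc (0 : ℝ) 1, fderiv ℝ c' (s, 0) (0, 1) (1, 0) = 0 := by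
      have hcl : closure (Ioo (0 : ℝ) 1) = Icc 0 1 := closure_Ioo zero_ne_one
      intro s hs
      exact EqOn.of_subset_closure (s := Ioo (0 : ℝ) 1) (t := Icc 0 1) (g := fun _ => 0)
        (fun s hs => e3 hs) e4 continuousOn_const Ioo_subset_Icc_self hcl.symm.subset hs
    have := e2 hs
    rw [← e1 hs, dForm_apply, e5 s hs, sub_zero]
    exact this
  have haz : ∀ p ∈ Ω, a p (contactField a η p) = 0 := fun p hp => (h.contact.contactPair_spec η hp).2
  have hηz : ∀ p ∈ Ω, η p (contactField a η p) = 0 := fun p hp => by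
    rw [← (h.contact.contactPair_spec η hp).1, haz p hp, dForm_apply, sub_self, mul_zero, add_zero]
  -- Since `η` is closed and kills the contact field, its value on the variation field is constant
  -- in `s`, and it is zero at `s = 0`.
  have hηt : ∀ s ∈ Icc (0 : ℝ) 1, η (Ψ (s, 0)) (fderiv ℝ Ψ (s, 0) (0, 1)) = 0 := by
    intro s hs
    have d (s : ℝ) (hs : s ∈ Icc (0 : ℝ) 1) :
        HasDerivAt (fun s => η (Ψ (s, 0)) (fderiv ℝ Ψ (s, 0) (0, 1))) 0 s := by
      convert! key h.contDiffOn hηz hs using 1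
      rw [dForm_apply, h.closed _ (hmem hs), sub_self]
    rw [constant_of_has_deriv_right_zero (fun s hs => (d s hs).continuousAt.continuousWithinAt)
      (fun s hs => (d s ⟨hs.1, hs.2.le⟩).hasDerivWithinAt) s hs, hΨ0, map_zero]
  let γ : ℝ → ℝ := fun s => (contactPair a η (Ψ (s, 0))).2
  have hγ : ContDiffOn ℝ ∞ γ (Icc 0 1) :=
    ((h.contact.contDiffOn_contactPair h.contDiffOn).comp
      (hΨ.comp (contDiff_id.prodMk contDiff_const)).contDiffOn fun s hs => hmem hs).snd
  have hγ0 : γ 0 = 1 := by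
    have : Ψ (0, 0) = ((Ψ (0, 0)).1, 0) := Prod.ext rfl (h0 _)
    have hm : ((Ψ (0, 0)).1, (0 : F)) ∈ Ω := this ▸ hmem (s := 0) (by simp)
    simp only [γ]
    rw [this, h.contactPair_zero hm]
  obtain ⟨C, hC⟩ : ∃ C, ∀ s ∈ Icc (0 : ℝ) 1, |γ s - 1| ≤ C * s := by
    obtain ⟨K, hK⟩ := hγ.exists_lipschitzOnWith (by simp) (convex_Icc 0 1) isCompact_Icc
    refine ⟨K, fun s hs => ?_⟩
    have := hK.dist_le_mul s hs 0 (by simp)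
    rwa [hγ0, Real.dist_eq, Real.dist_eq, sub_zero, abs_of_nonneg hs.1] at this
  -- With `b = a(∂_t Ψ)`, one has `s b' = -da(z, ∂_t Ψ) = g b - η(∂_t Ψ)`, and the last term is
  -- zero. Both `b` and `b'` vanish at `0` because `∂_t Ψ` does.
  have := eq_zero_of_mul_deriv_eq_mul (g := γ) (fun s hs => key h.contact.contDiffOn haz hs)
    (by simp only [hΨ0, map_zero]) (by simp only [hΨ0, map_zero]) hC (fun s hs => by
      have hs' := Ioo_subset_Icc_self hs
      have e1 := (h.contact.contactPair_spec η (hmem hs')).1 (fderiv ℝ Ψ (s, 0) (0, 1))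
      rw [hηt s hs'] at e1
      rw [hΨs hs (by simpa using hw)]
      simp only [map_neg, map_smul, neg_apply, smul_apply, smul_eq_mul]
      rw [mul_neg, mul_inv_cancel_left₀ hs.1.ne']
      change _ = (contactPair a η (Ψ (s, 0))).2 * _
      linarith)
  rw [hΨ1] at this
  simpa [Ψ, h1] using this

end Legendrian

end ContactNbhd
end

noncomputable section

namespace ContactNbhd

/-! ### Smooth charts and one-forms in smooth charts -/

section SmoothCharts

open Set

variable {d : ℕ} {N : Type*} [TopologicalSpace N] [ChartedSpace (EuclideanSpace ℝ (Fin d)) N]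
  {W W' : Type*} [NormedAddCommGroup W] [NormedSpace ℝ W] [NormedAddCommGroup W']
  [NormedSpace ℝ W']

/-- A local diffeomorphism from the manifold `N` to a vector space. -/
structure IsSmoothChart (P : OpenPartialHomeomorph N W) : Prop where
  contMDiffOn : ContMDiffOn (𝓡 d) 𝓘(ℝ, W) ∞ P P.source
  contMDiffOn_symm : ContMDiffOn 𝓘(ℝ, W) (𝓡 d) ∞ P.symm P.target

namespace IsSmoothChart

variable {P : OpenPartialHomeomorph N W} {P' : OpenPartialHomeomorph N W'}

theorem mdifferentiableAt (hP : IsSmoothChart (d := d) P) {x : N} (hx : x ∈ P.source) :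
    MDifferentiableAt (𝓡 d) 𝓘(ℝ, W) P x :=
  (hP.contMDiffOn.contMDiffAt (P.open_source.mem_nhds hx)).mdifferentiableAt (by simp)

theorem mdifferentiableAt_symm (hP : IsSmoothChart (d := d) P) {p : W} (hp : p ∈ P.target) :
    MDifferentiableAt 𝓘(ℝ, W) (𝓡 d) P.symm p :=
  (hP.contMDiffOn_symm.contMDiffAt (P.open_target.mem_nhds hp)).mdifferentiableAt (by simp)

theorem mfderiv_mfderiv_symm (hP : IsSmoothChart (d := d) P) {p : W} (hp : p ∈ P.target) (v : W) :
    mfderiv (𝓡 d) 𝓘(ℝ, W) P (P.symm p) (mfderiv 𝓘(ℝ, W) (𝓡 d) P.symm p v) = v := by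
  have h1 := (hP.mdifferentiableAt (P.map_target hp)).hasMFDerivAt.comp p
    (hP.mdifferentiableAt_symm hp).hasMFDerivAt
  have h2 : P ∘ P.symm =ᶠ[𝓝 p] id := by
    filter_upwards [P.open_target.mem_nhds hp] with q hq using P.right_inv hq
  have h3 := h1.congr_of_eventuallyEq h2.symm
  exact congrArg (fun f : W →L[ℝ] W => f v) (hasMFDerivAt_unique h3 (hasMFDerivAt_id p))

theorem mfderiv_symm_mfderiv (hP : IsSmoothChart (d := d) P) {p : W} (hp : p ∈ P.target)
    (v : TangentSpace (𝓡 d) (P.symm p)) :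
    mfderiv 𝓘(ℝ, W) (𝓡 d) P.symm p (mfderiv (𝓡 d) 𝓘(ℝ, W) P (P.symm p) v) = v := by
  have h0 : HasMFDerivAt 𝓘(ℝ, W) (𝓡 d) P.symm (P (P.symm p)) (mfderiv 𝓘(ℝ, W) (𝓡 d) P.symm p) := by
    have := (hP.mdifferentiableAt_symm hp).hasMFDerivAt
    refine (P.right_inv hp).symm ▸ this
  have h1 := h0.comp (P.symm p) (hP.mdifferentiableAt (P.map_target hp)).hasMFDerivAt
  have h2 : P.symm ∘ P =ᶠ[𝓝 (P.symm p)] id := by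
    filter_upwards [P.open_source.mem_nhds (P.map_target hp)] with q hq using P.left_inv hq
  have h3 := h1.congr_of_eventuallyEq h2.symm
  exact congrArg (fun f : TangentSpace (𝓡 d) (P.symm p) →L[ℝ] TangentSpace (𝓡 d) (P.symm p) => f v)
    (hasMFDerivAt_unique h3 (hasMFDerivAt_id (P.symm p)))

theorem mfderiv_injective (hP : IsSmoothChart (d := d) P) {x : N} (hx : x ∈ P.source)
    {v : TangentSpace (𝓡 d) x} (hv : mfderiv (𝓡 d) 𝓘(ℝ, W) P x v = 0) : v = 0 := by
  obtain ⟨p, hp, rfl⟩ : ∃ p ∈ P.target, P.symm p = x := ⟨P x, P.map_source hx, P.left_inv hx⟩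
  rw [← hP.mfderiv_symm_mfderiv hp v, hv]
  exact map_zero _

theorem mfderiv_surjective (hP : IsSmoothChart (d := d) P) {x : N} (hx : x ∈ P.source) (w : W) :
    ∃ v : TangentSpace (𝓡 d) x, mfderiv (𝓡 d) 𝓘(ℝ, W) P x v = w := by
  obtain ⟨p, hp, rfl⟩ : ∃ p ∈ P.target, P.symm p = x := ⟨P x, P.map_source hx, P.left_inv hx⟩
  exact ⟨_, hP.mfderiv_mfderiv_symm hp w⟩

theorem contDiffAt_trans (hP : IsSmoothChart (d := d) P) (hP' : IsSmoothChart (d := d) P') {p : W}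
    (hp : p ∈ P.target) (hp' : P.symm p ∈ P'.source) : ContDiffAt ℝ ∞ (P' ∘ P.symm) p :=
  contMDiffAt_iff_contDiffAt.mp
    ((hP'.contMDiffOn.contMDiffAt (P'.open_source.mem_nhds hp')).comp p
      (hP.contMDiffOn_symm.contMDiffAt (P.open_target.mem_nhds hp)))

theorem fderiv_trans (hP : IsSmoothChart (d := d) P) (hP' : IsSmoothChart (d := d) P') {p : W}
    (hp : p ∈ P.target) (hp' : P.symm p ∈ P'.source) (v : W) :
    fderiv ℝ (P' ∘ P.symm) p v =
      mfderiv (𝓡 d) 𝓘(ℝ, W') P' (P.symm p) (mfderiv 𝓘(ℝ, W) (𝓡 d) P.symm p v) := by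
  have h1 := (hP'.mdifferentiableAt hp').hasMFDerivAt.comp p
    (hP.mdifferentiableAt_symm hp).hasMFDerivAt
  have h2 := ((hP.contDiffAt_trans hP' hp hp').differentiableAt (by simp)).hasFDerivAt.hasMFDerivAt
  exact congrArg (fun f : W →L[ℝ] W' => f v) (hasMFDerivAt_unique h2 h1)

theorem mono (hP : IsSmoothChart (d := d) P) {s : Set N} (hs : IsOpen s) :
    IsSmoothChart (d := d) (P.restrOpen s hs) :=
  ⟨hP.contMDiffOn.mono (by simp),
    hP.contMDiffOn_symm.mono (by
      rintro p hp
      have := (P.restrOpen s hs).map_target hp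
      have h2 := (P.restrOpen s hs).right_inv hp
      rw [OpenPartialHomeomorph.restrOpen_source] at this
      rw [← h2]
      exact P.map_source this.1)⟩

end IsSmoothChart

theorem isSmoothChart_of_mem_maximalAtlas [IsManifold (𝓡 d) ∞ N]
    {P : OpenPartialHomeomorph N (EuclideanSpace ℝ (Fin d))}
    (hP : P ∈ IsManifold.maximalAtlas (𝓡 d) ∞ N) : IsSmoothChart (d := d) P :=
  ⟨contMDiffOn_of_mem_maximalAtlas hP, contMDiffOn_symm_of_mem_maximalAtlas hP⟩

theorem isSmoothChart_chartAt [IsManifold (𝓡 d) ∞ N] (x : N) :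
    IsSmoothChart (d := d) (chartAt (EuclideanSpace ℝ (Fin d)) x) :=
  isSmoothChart_of_mem_maximalAtlas (IsManifold.chart_mem_maximalAtlas x)

/-- The one-form `α` in the smooth chart `P`. -/
def formIn (α : CovectorField d N) (P : OpenPartialHomeomorph N W) : W → W →L[ℝ] ℝ :=
  fun p => (α (P.symm p)).comp (mfderiv 𝓘(ℝ, W) (𝓡 d) P.symm p)

variable {P : OpenPartialHomeomorph N W} {P' : OpenPartialHomeomorph N W'}

theorem formIn_mfderiv (α : CovectorField d N) (hP : IsSmoothChart (d := d) P) {x : N}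
    (hx : x ∈ P.source) (v : TangentSpace (𝓡 d) x) :
    formIn α P (P x) (mfderiv (𝓡 d) 𝓘(ℝ, W) P x v) = α x v := by
  obtain ⟨p, hp, rfl⟩ : ∃ p ∈ P.target, P.symm p = x := ⟨P x, P.map_source hx, P.left_inv hx⟩
  rw [P.right_inv hp]
  exact congrArg (α (P.symm p)) (hP.mfderiv_symm_mfderiv hp v)

theorem formIn_trans (α : CovectorField d N) (hP : IsSmoothChart (d := d) P)
    (hP' : IsSmoothChart (d := d) P') {p : W} (hp : p ∈ P.target) (hp' : P.symm p ∈ P'.source) :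
    formIn α P p = (formIn α P' ((P' ∘ P.symm) p)).comp (fderiv ℝ (P' ∘ P.symm) p) := by
  ext v
  rw [ContinuousLinearMap.comp_apply, hP.fderiv_trans hP' hp hp']
  exact (formIn_mfderiv α hP' hp' (mfderiv 𝓘(ℝ, W) (𝓡 d) P.symm p v)).symm

theorem eventually_formIn_trans (α : CovectorField d N) (hP : IsSmoothChart (d := d) P)
    (hP' : IsSmoothChart (d := d) P') {p : W} (hp : p ∈ P.target) (hp' : P.symm p ∈ P'.source) :
    ∀ᶠ q in 𝓝 p,
      formIn α P q = (formIn α P' ((P' ∘ P.symm) q)).comp (fderiv ℝ (P' ∘ P.symm) q) := by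
  filter_upwards [P.open_target.mem_nhds hp,
    (P.continuousAt_symm hp).preimage_mem_nhds (P'.open_source.mem_nhds hp')] with q hq hq'
  exact formIn_trans α hP hP' hq hq'

theorem IsSmoothForm.contDiffOn_formIn [IsManifold (𝓡 d) ∞ N] [FiniteDimensional ℝ W]
    {α : CovectorField d N} (hα : IsSmoothForm α) (hP : IsSmoothChart (d := d) P) :
    ContDiffOn ℝ ∞ (formIn α P) P.target := by
  refine contDiffOn_clm_apply.mpr fun w => ?_
  have h1 : ContMDiffOn 𝓘(ℝ, W) ((𝓡 d).prod 𝓘(ℝ, EuclideanSpace ℝ (Fin d) →L[ℝ] ℝ)) ∞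
      (fun p => (TotalSpace.mk' (EuclideanSpace ℝ (Fin d) →L[ℝ] ℝ) (P.symm p) (α (P.symm p)) :
      TotalSpace (EuclideanSpace ℝ (Fin d) →L[ℝ] ℝ)
        (fun x : N => TangentSpace (𝓡 d) x →L[ℝ] Trivial N ℝ x))) P.target :=
    ContMDiff.comp_contMDiffOn hα hP.contMDiffOn_symm
  have h2 : ContMDiffOn 𝓘(ℝ, W) ((𝓡 d).prod 𝓘(ℝ, EuclideanSpace ℝ (Fin d))) ∞
      (fun p => (TotalSpace.mk' (EuclideanSpace ℝ (Fin d)) (P.symm p)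
        (mfderiv 𝓘(ℝ, W) (𝓡 d) P.symm p w) : TangentBundle (𝓡 d) N)) P.target := by
    have e1 := hP.contMDiffOn_symm.contMDiffOn_tangentMapWithin (m := ∞) (by norm_cast)
      P.open_target.uniqueMDiffOn
    have e2 : ContMDiff 𝓘(ℝ, W) (𝓘(ℝ, W).prod 𝓘(ℝ, W)) ∞
        (fun p : W => (TotalSpace.mk' W p w : TangentBundle 𝓘(ℝ, W) W)) := by
      exact contMDiff_vectorSpace_iff_contDiff.mpr contDiff_const
    refine (e1.comp e2.contMDiffOn fun p hp => hp).congr fun p hp => ?_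
    simp only [Function.comp, tangentMapWithin]
    rw [mfderivWithin_of_isOpen P.open_target hp]
  have h3 := h1.clm_bundle_apply (F₂ := ℝ) (E₂ := Trivial N ℝ) h2
  have h4 : ContMDiffOn 𝓘(ℝ, W) 𝓘(ℝ, ℝ) ∞ (fun p => formIn α P p w) P.target := fun p hp =>
    (Bundle.contMDiffWithinAt_totalSpace.mp (h3 p hp)).2
  exact contMDiffOn_iff_contDiffOn.mp h4

/-- `extDerivForm` is computed in the preferred chart at `x`; naturality of the exterior derivative
under the transition map allows any smooth chart, in particular slice charts valued in a product. -/
theorem extDerivForm_eq_dForm [IsManifold (𝓡 d) ∞ N] (α : CovectorField d N)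
    (hP : IsSmoothChart (d := d) P) {x : N} (hx : x ∈ P.source)
    (ha : DifferentiableAt ℝ (formIn α P) (P x)) (u v : TangentSpace (𝓡 d) x) :
    extDerivForm α x u v = dForm (formIn α P) (P x) (mfderiv (𝓡 d) 𝓘(ℝ, W) P x u)
      (mfderiv (𝓡 d) 𝓘(ℝ, W) P x v) := by
  let c := chartAt (EuclideanSpace ℝ (Fin d)) x
  have hc : IsSmoothChart (d := d) c := isSmoothChart_chartAt x
  have hxc : x ∈ c.source := mem_chart_source _ x
  have hcx : c.symm (c x) = x := c.left_inv hxc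
  have hp : c x ∈ c.target := c.map_source hxc
  have hp' : c.symm (c x) ∈ P.source := by rwa [hcx]
  have hPx : (P ∘ c.symm) (c x) = P x := congrArg P hcx
  have key := dForm_pullback (hc.contDiffAt_trans hP hp hp') (by rwa [hPx])
    (eventually_formIn_trans α hc hP hp hp') (mfderiv (𝓡 d) (𝓡 d) c x u)
    (mfderiv (𝓡 d) (𝓡 d) c x v)
  have hv (v : TangentSpace (𝓡 d) x) : fderiv ℝ (P ∘ c.symm) (c x) (mfderiv (𝓡 d) (𝓡 d) c x v) =
      mfderiv (𝓡 d) 𝓘(ℝ, W) P x v := by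
    have h1 := (hc.contDiffAt_trans hP hp hp').differentiableAt (by simp) |>.hasFDerivAt.hasMFDerivAt
    have h2 := h1.comp x (hc.mdifferentiableAt hxc).hasMFDerivAt
    have h3 : P =ᶠ[𝓝 x] (P ∘ c.symm) ∘ c := by
      filter_upwards [c.open_source.mem_nhds hxc] with y hy
      simp [c.left_inv hy]
    exact congrArg (fun f : TangentSpace (𝓡 d) x →L[ℝ] W => f v)
      (hasMFDerivAt_unique (h2.congr_of_eventuallyEq h3) (hP.mdifferentiableAt hx).hasMFDerivAt)
  rw [hv, hv, hPx] at key
  exact key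

theorem IsContactForm.isContactOn_formIn [IsManifold (𝓡 d) ∞ N] [FiniteDimensional ℝ W]
    {α : CovectorField d N} (hα : IsContactForm α) (hP : IsSmoothChart (d := d) P) :
    IsContactOn (formIn α P) P.target := by
  have hs := hα.smooth.contDiffOn_formIn hP
  refine ⟨P.open_target, hs, fun p hp h0 => ?_, fun p hp v hv h => ?_⟩
  · refine hα.ne_zero (P.symm p) ?_
    ext v
    rw [← formIn_mfderiv α hP (P.map_target hp), P.right_inv hp, h0]
    rfl
  · have hx := P.map_target hp
    have h1 := hα.nondegenerate (P.symm p) (mfderiv 𝓘(ℝ, W) (𝓡 d) P.symm p v) hv fun w hw => by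
      rw [extDerivForm_eq_dForm α hP hx (by
        rw [P.right_inv hp]
        exact (hs.contDiffAt (P.open_target.mem_nhds hp)).differentiableAt (by simp)),
        P.right_inv hp]
      exact (congrArg (fun z : W => dForm (formIn α P) p z (mfderiv (𝓡 d) 𝓘(ℝ, W) P (P.symm p) w))
        (hP.mfderiv_mfderiv_symm hp v)).trans (h _ (by
          rw [← hw, ← formIn_mfderiv α hP hx, P.right_inv hp]))
    rw [← hP.mfderiv_mfderiv_symm hp v, h1]
    exact map_zero _

end SmoothCharts

end ContactNbhd
end

noncomputable section

namespace ContactNbhd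

/-! ### Charts adapted to the embedded submanifold. -/

section SliceCharts

open Set

variable {k d : ℕ} {L : Type*} [TopologicalSpace L] [ChartedSpace (EuclideanSpace ℝ (Fin k)) L]
  {M : Type*} [TopologicalSpace M] [ChartedSpace (EuclideanSpace ℝ (Fin d)) M]
  {F : Type*} [NormedAddCommGroup F] [NormedSpace ℝ F]

/-- A slice chart for the embedding `ι`, extending the preferred chart of `L` at `x₀`. -/
structure IsSliceChart (ι : L → M) (x₀ : L)
    (P : OpenPartialHomeomorph M (EuclideanSpace ℝ (Fin k) × F)) : Prop where
  smooth : IsSmoothChart (d := d) P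
  mem_source : ι x₀ ∈ P.source
  of_mem : ∀ x, ι x ∈ P.source → x ∈ (chartAt (EuclideanSpace ℝ (Fin k)) x₀).source ∧
    P (ι x) = (chartAt (EuclideanSpace ℝ (Fin k)) x₀ x, 0)
  of_zero : ∀ u, (u, (0 : F)) ∈ P.target → u ∈ (chartAt (EuclideanSpace ℝ (Fin k)) x₀).target ∧
    P.symm (u, 0) = ι ((chartAt (EuclideanSpace ℝ (Fin k)) x₀).symm u)

/-- The normal form of an immersion gives charts in which `ι` is `u ↦ (u, 0)`; the embedding
topology then excludes other sheets of `L`. -/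
theorem exists_isSliceChart [IsManifold (𝓡 k) ∞ L] [IsManifold (𝓡 d) ∞ M] {ι : L → M}
    (hι : Manifold.IsSmoothEmbedding (𝓡 k) (𝓡 d) ∞ ι) {m : ℕ} (hd : k + m = d) (x₀ : L) :
    ∃ P : OpenPartialHomeomorph M (EuclideanSpace ℝ (Fin k) × EuclideanSpace ℝ (Fin m)),
      IsSliceChart (d := d) ι x₀ P := by
  obtain ⟨F₀, _, _, h⟩ := hι.isImmersion.isImmersionAt x₀
  let c := chartAt (EuclideanSpace ℝ (Fin k)) x₀
  let χ := h.codChart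
  let φ := h.domChart
  have hχ : IsSmoothChart (d := d) χ := isSmoothChart_of_mem_maximalAtlas h.codChart_mem_maximalAtlas
  have hφ : IsSmoothChart (d := k) φ := isSmoothChart_of_mem_maximalAtlas h.domChart_mem_maximalAtlas
  have hc : IsSmoothChart (d := k) c := isSmoothChart_chartAt x₀
  have : FiniteDimensional ℝ F₀ := by
    have : FiniteDimensional ℝ (EuclideanSpace ℝ (Fin k) × F₀) :=
      LinearEquiv.finiteDimensional h.equiv.symm.toLinearEquiv
    exact FiniteDimensional.of_injective (LinearMap.inr ℝ (EuclideanSpace ℝ (Fin k)) F₀)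
      LinearMap.inr_injective
  have hF₀ : Module.finrank ℝ F₀ = Module.finrank ℝ (EuclideanSpace ℝ (Fin m)) := by
    have := h.equiv.toLinearEquiv.finrank_eq
    simp only [Module.finrank_prod, finrank_euclideanSpace_fin] at this ⊢
    omega
  let l : F₀ ≃L[ℝ] EuclideanSpace ℝ (Fin m) := ContinuousLinearEquiv.ofFinrankEq hF₀
  let e : EuclideanSpace ℝ (Fin d) ≃L[ℝ] EuclideanSpace ℝ (Fin k) × EuclideanSpace ℝ (Fin m) :=
    h.equiv.symm.trans ((ContinuousLinearEquiv.refl ℝ (EuclideanSpace ℝ (Fin k))).prodCongr l)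
  have hwr : ∀ x ∈ φ.source, e (χ (ι x)) = (φ x, 0) := by
    intro x hx
    have hm : φ x ∈ (φ.extend (𝓡 k)).target := by simpa using φ.map_source hx
    have h1 := h.writtenInCharts hm
    simp only [Function.comp_apply, mfld_simps] at h1
    rw [φ.left_inv hx] at h1
    change e (χ (ι x)) = _
    change χ (ι x) = _ at h1
    rw [h1]
    simp [e]
  -- The domain chart supplied by the immersion is replaced by the preferred chart, through a
  -- transition map acting on the first factor.
  let κ := φ.symm.trans c
  let P₁ := (χ.trans e.toHomeomorph.toOpenPartialHomeomorph).trans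
    (κ.prod (OpenPartialHomeomorph.refl (EuclideanSpace ℝ (Fin m))))
  -- The open set `O` meets `ι(L)` only in the sheet described by the charts; this is where
  -- injectivity with the induced topology is used.
  obtain ⟨O, hO, hOe⟩ := hι.isEmbedding.isInducing.isOpen_iff.mp (φ.open_source.inter c.open_source)
  have hmem : ∀ x, ι x ∈ O ↔ x ∈ φ.source ∧ x ∈ c.source := fun x => by
    rw [← mem_preimage, hOe]; rfl
  have hP₁ : ∀ x, x ∈ φ.source → x ∈ c.source → ι x ∈ P₁.source ∧ P₁ (ι x) = (c x, 0) := by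
    intro x hx hx'
    have hs : ι x ∈ χ.source := h.source_subset_preimage_source hx
    refine ⟨?_, ?_⟩
    · simp only [P₁, κ, mem_inter_iff, mem_preimage, mfld_simps]
      simp [hs, hwr x hx, φ.map_source hx, φ.left_inv hx, hx']
    · simp [P₁, κ, hwr x hx, φ.left_inv hx]
  have hsm : IsSmoothChart (d := d) P₁ := by
    have hκ : ContDiffOn ℝ ∞ κ κ.source := fun u hu => (hφ.contDiffAt_trans hc (by
      simpa [κ] using (show u ∈ φ.target from hu.1)) hu.2).contDiffWithinAt
    have hκ' : ContDiffOn ℝ ∞ κ.symm κ.target := fun u hu => (hc.contDiffAt_trans hφ hu.1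
      hu.2).contDiffWithinAt
    constructor
    · have e1 : ContMDiffOn (𝓡 d) 𝓘(ℝ, EuclideanSpace ℝ (Fin k) × EuclideanSpace ℝ (Fin m)) ∞
          (fun y => e (χ y)) χ.source :=
        e.contDiff.contMDiff.comp_contMDiffOn hχ.contMDiffOn
      have e2 : ContDiffOn ℝ ∞ (fun p : EuclideanSpace ℝ (Fin k) × EuclideanSpace ℝ (Fin m) =>
          (κ p.1, p.2)) (Prod.fst ⁻¹' κ.source) :=
        (hκ.comp contDiffOn_fst fun p hp => hp).prodMk contDiffOn_snd
      exact e2.contMDiffOn.comp (e1.mono fun y hy => hy.1.1) fun y hy => hy.2.1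
    · have e1 : ContMDiffOn 𝓘(ℝ, EuclideanSpace ℝ (Fin k) × EuclideanSpace ℝ (Fin m)) (𝓡 d) ∞
          (fun p => χ.symm (e.symm p)) (e.symm ⁻¹' χ.target) :=
        hχ.contMDiffOn_symm.comp e.symm.contDiff.contMDiff.contMDiffOn fun p hp => hp
      have e2 : ContDiffOn ℝ ∞ (fun p : EuclideanSpace ℝ (Fin k) × EuclideanSpace ℝ (Fin m) =>
          (κ.symm p.1, p.2)) (Prod.fst ⁻¹' κ.target) :=
        (hκ'.comp contDiffOn_fst fun p hp => hp).prodMk contDiffOn_snd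
      exact e1.comp (e2.contMDiffOn.mono fun y hy => hy.1.1) fun y hy => hy.2.2
  refine ⟨P₁.restrOpen O hO, hsm.mono hO, ?_, ?_, ?_⟩
  · rw [OpenPartialHomeomorph.restrOpen_source]
    have hx := h.mem_domChart_source
    have hx' := mem_chart_source (EuclideanSpace ℝ (Fin k)) x₀
    exact ⟨(hP₁ x₀ hx hx').1, (hmem x₀).mpr ⟨hx, hx'⟩⟩
  · intro x hx
    rw [OpenPartialHomeomorph.restrOpen_source] at hx
    obtain ⟨h1, h2⟩ := (hmem x).mp hx.2
    exact ⟨h2, (hP₁ x h1 h2).2⟩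
  · intro u hu
    have hu1 : (u, (0 : EuclideanSpace ℝ (Fin m))) ∈ P₁.target := by
      have h1 := (P₁.restrOpen O hO).map_target hu
      rw [OpenPartialHomeomorph.restrOpen_source] at h1
      rw [← (P₁.restrOpen O hO).right_inv hu]
      exact P₁.map_source h1.1
    have huκ : u ∈ κ.target := hu1.1.1
    have huc : u ∈ c.target := huκ.1
    have hφu : c.symm u ∈ φ.source := by simpa using huκ.2
    refine ⟨huc, ?_⟩
    have h2 := hP₁ _ hφu (c.map_target huc)
    rw [c.right_inv huc] at h2
    change P₁.symm (u, 0) = _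
    rw [← h2.2, P₁.left_inv h2.1]

end SliceCharts

end ContactNbhd
end

noncomputable section

namespace ContactNbhd

/-! ### Local potentials along a pre-Lagrangian submanifold -/

section LocalPotentials

open Set

variable {k d : ℕ} {L : Type*} [TopologicalSpace L] [ChartedSpace (EuclideanSpace ℝ (Fin k)) L]
  {M : Type*} [TopologicalSpace M] [ChartedSpace (EuclideanSpace ℝ (Fin d)) M]
  {F : Type*} [NormedAddCommGroup F] [NormedSpace ℝ F] {ι : L → M} {x₀ : L}
  {P : OpenPartialHomeomorph M (EuclideanSpace ℝ (Fin k) × F)}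

theorem IsSliceChart.mem_source_of_zero (hP : IsSliceChart (d := d) ι x₀ P)
    {u : EuclideanSpace ℝ (Fin k)} (hu : (u, (0 : F)) ∈ P.target) :
    ι ((chartAt (EuclideanSpace ℝ (Fin k)) x₀).symm u) ∈ P.source := by
  rw [← (hP.of_zero u hu).2]
  exact P.map_target hu

theorem IsSliceChart.apply_of_zero (hP : IsSliceChart (d := d) ι x₀ P)
    {u : EuclideanSpace ℝ (Fin k)} (hu : (u, (0 : F)) ∈ P.target) :
    P (ι ((chartAt (EuclideanSpace ℝ (Fin k)) x₀).symm u)) = (u, 0) := by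
  rw [← (hP.of_zero u hu).2, P.right_inv hu]

variable [IsManifold (𝓡 k) ∞ L]

/-- The pullback of a one-form to `L`, in a slice chart. -/
theorem IsSliceChart.formIn_pullbackForm (hP : IsSliceChart (d := d) ι x₀ P)
    (hι : ContMDiff (𝓡 k) (𝓡 d) ∞ ι) (α : CovectorField d M) {u : EuclideanSpace ℝ (Fin k)}
    (hu : (u, (0 : F)) ∈ P.target) :
    formIn (pullbackForm (k := k) ι α) (chartAt (EuclideanSpace ℝ (Fin k)) x₀) u =
      (formIn α P (u, 0)).comp (ContinuousLinearMap.inl ℝ (EuclideanSpace ℝ (Fin k)) F) := by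
  let c := chartAt (EuclideanSpace ℝ (Fin k)) x₀
  have hc : IsSmoothChart (d := k) c := isSmoothChart_chartAt x₀
  have huc : u ∈ c.target := (hP.of_zero u hu).1
  have hs : ι (c.symm u) ∈ P.source := hP.mem_source_of_zero hu
  have h1 := (((hP.smooth.mdifferentiableAt hs).hasMFDerivAt.comp (c.symm u)
    ((hι (c.symm u)).mdifferentiableAt (by simp)).hasMFDerivAt).comp u
    (hc.mdifferentiableAt_symm huc).hasMFDerivAt)
  have h2 : (fun u' => (u', (0 : F))) =ᶠ[𝓝 u] (P ∘ ι) ∘ c.symm := by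
    have : Continuous fun u' : EuclideanSpace ℝ (Fin k) => (u', (0 : F)) := by fun_prop
    filter_upwards [this.continuousAt.preimage_mem_nhds (P.open_target.mem_nhds hu)] with u' hu'
    exact (hP.apply_of_zero hu').symm
  have h3 : HasMFDerivAt 𝓘(ℝ, EuclideanSpace ℝ (Fin k)) 𝓘(ℝ, EuclideanSpace ℝ (Fin k) × F)
      (fun u' : EuclideanSpace ℝ (Fin k) => (u', (0 : F))) u
      (ContinuousLinearMap.inl ℝ (EuclideanSpace ℝ (Fin k)) F) :=
    (ContinuousLinearMap.inl ℝ (EuclideanSpace ℝ (Fin k)) F).hasFDerivAt.hasMFDerivAt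
  have h4 := hasMFDerivAt_unique h3 (h1.congr_of_eventuallyEq h2)
  ext v
  have h5 := formIn_mfderiv α hP.smooth hs
    (mfderiv (𝓡 k) (𝓡 d) ι (c.symm u) (mfderiv (𝓡 k) (𝓡 k) c.symm u v))
  rw [hP.apply_of_zero hu] at h5
  refine h5.symm.trans ?_
  exact congrArg (fun f : EuclideanSpace ℝ (Fin k) →L[ℝ] EuclideanSpace ℝ (Fin k) × F =>
    formIn α P (u, 0) (f v)) h4.symm

variable [IsManifold (𝓡 d) ∞ M]

/-- This expresses closedness of `ι^*α` as symmetry of a derivative, the form needed for the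
Poincaré lemma on a ball. -/
theorem IsSliceChart.fderiv_symm_of_isClosedForm [FiniteDimensional ℝ F]
    (hP : IsSliceChart (d := d) ι x₀ P)
    (hι : ContMDiff (𝓡 k) (𝓡 d) ∞ ι) {α : CovectorField d M} (hα : IsSmoothForm α)
    (hclosed : IsClosedForm (pullbackForm (k := k) ι α)) {u : EuclideanSpace ℝ (Fin k)}
    (hu : (u, (0 : F)) ∈ P.target) (v w : EuclideanSpace ℝ (Fin k)) :
    fderiv ℝ (fun u => (formIn α P (u, 0)).comp
      (ContinuousLinearMap.inl ℝ (EuclideanSpace ℝ (Fin k)) F)) u v w =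
    fderiv ℝ (fun u => (formIn α P (u, 0)).comp
      (ContinuousLinearMap.inl ℝ (EuclideanSpace ℝ (Fin k)) F)) u w v := by
  let c := chartAt (EuclideanSpace ℝ (Fin k)) x₀
  have hc : IsSmoothChart (d := k) c := isSmoothChart_chartAt x₀
  have huc : u ∈ c.target := (hP.of_zero u hu).1
  have hcont : Continuous fun u' : EuclideanSpace ℝ (Fin k) => (u', (0 : F)) := by fun_prop
  have heq : formIn (pullbackForm (k := k) ι α) c =ᶠ[𝓝 u] fun u => (formIn α P (u, 0)).comp
      (ContinuousLinearMap.inl ℝ (EuclideanSpace ℝ (Fin k)) F) := by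
    filter_upwards [hcont.continuousAt.preimage_mem_nhds (P.open_target.mem_nhds hu)] with u' hu'
    exact hP.formIn_pullbackForm hι α hu'
  have hd : DifferentiableAt ℝ (formIn (pullbackForm (k := k) ι α) c) u := by
    refine DifferentiableAt.congr_of_eventuallyEq ?_ heq
    have h1 := ((hα.contDiffOn_formIn hP.smooth).contDiffAt
      (P.open_target.mem_nhds hu)).differentiableAt (by simp)
    have h2 : DifferentiableAt ℝ (fun u => formIn α P (u, 0)) u :=
      DifferentiableAt.comp u (g := formIn α P) (f := fun u => (u, (0 : F))) h1 (by fun_prop)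
    exact h2.clm_comp (differentiableAt_const _)
  have h1 := fun v w => hclosed (c.symm u) (mfderiv (𝓡 k) (𝓡 k) c.symm u v)
    (mfderiv (𝓡 k) (𝓡 k) c.symm u w)
  have h2 := h1 v w
  rw [extDerivForm_eq_dForm _ hc (c.map_target huc) (by rwa [c.right_inv huc]),
    c.right_inv huc] at h2
  have h3 : dForm (formIn (pullbackForm (k := k) ι α) c) u v w = 0 := by
    rw [← h2]
    exact congrArg₂ (fun v w => dForm (formIn (pullbackForm (k := k) ι α) c) u v w)
      (hc.mfderiv_mfderiv_symm huc v).symm (hc.mfderiv_mfderiv_symm huc w).symm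
  rw [dForm_apply, heq.fderiv_eq, sub_eq_zero] at h3
  exact h3

/-- Near each point of `L` there is a function on `M` whose differential agrees with `α` along
`L`. -/
theorem exists_local_potential {m : ℕ} (hd : k + m = d)
    (hι : Manifold.IsSmoothEmbedding (𝓡 k) (𝓡 d) ∞ ι) {α : CovectorField d M}
    (hα : IsSmoothForm α) (hclosed : IsClosedForm (pullbackForm (k := k) ι α)) (x₀ : L) :
    ∃ (S : Set M) (f : M → ℝ), IsOpen S ∧ ι x₀ ∈ S ∧ ContMDiffOn (𝓡 d) 𝓘(ℝ, ℝ) ∞ f S ∧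
      ∀ x, ι x ∈ S → HasMFDerivAt (𝓡 d) 𝓘(ℝ, ℝ) f (ι x) (α (ι x)) := by
  obtain ⟨P, hP⟩ := exists_isSliceChart hι hd x₀
  let c := chartAt (EuclideanSpace ℝ (Fin k)) x₀
  have ha := hα.contDiffOn_formIn hP.smooth
  have h0 : P (ι x₀) = (c x₀, 0) := (hP.of_mem x₀ hP.mem_source).2
  obtain ⟨r, hr, hrP⟩ := Metric.isOpen_iff.mp P.open_target (c x₀, 0)
    (h0 ▸ P.map_source hP.mem_source)
  have hz : ∀ u ∈ Metric.ball (c x₀) r, (u, (0 : EuclideanSpace ℝ (Fin m))) ∈ P.target := by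
    intro u hu
    refine hrP ?_
    rw [← ball_prod_same]
    exact ⟨hu, Metric.mem_ball_self hr⟩
  have hinc : ContDiffOn ℝ ∞ (fun u => formIn α P (u, 0)) (Metric.ball (c x₀) r) :=
    ha.comp (f := fun u => (u, (0 : EuclideanSpace ℝ (Fin m))))
      (contDiffOn_id.prodMk contDiffOn_const) hz
  have hb : ContDiffOn ℝ ∞ (fun u => (formIn α P (u, 0)).comp
      (ContinuousLinearMap.inl ℝ (EuclideanSpace ℝ (Fin k)) (EuclideanSpace ℝ (Fin m))))
      (Metric.ball (c x₀) r) := hinc.clm_comp contDiffOn_const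
  obtain ⟨h, hh⟩ := (convex_ball (c x₀) r).exists_forall_hasFDerivAt_of_fderiv_symmetric
    Metric.isOpen_ball (hb.differentiableOn (by simp)) fun u hu v w =>
      hP.fderiv_symm_of_isClosedForm hι.contMDiff hα hclosed (hz u hu) v w
  have hhs : ContDiffOn ℝ ∞ h (Metric.ball (c x₀) r) :=
    (contDiffOn_infty_iff_fderiv_of_isOpen Metric.isOpen_ball).mpr
      ⟨fun u hu => (hh u hu).differentiableAt.differentiableWithinAt,
        hb.congr fun u hu => (hh u hu).fderiv⟩
  -- The potential `h` of `ι^*α` fixes the tangential derivatives along `L`; the term linear in the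
  -- fibre variable adds the normal part of `α`.
  let f : EuclideanSpace ℝ (Fin k) × EuclideanSpace ℝ (Fin m) → ℝ :=
    fun p => h p.1 + formIn α P (p.1, 0) (0, p.2)
  let B : Set (EuclideanSpace ℝ (Fin k) × EuclideanSpace ℝ (Fin m)) :=
    Prod.fst ⁻¹' Metric.ball (c x₀) r
  have hB : IsOpen B := Metric.isOpen_ball.preimage continuous_fst
  have hf : ContDiffOn ℝ ∞ f B := by
    refine (hhs.comp contDiffOn_fst fun p hp => hp).add
      (ContDiffOn.clm_apply (hinc.comp contDiffOn_fst fun p hp => hp)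
        (contDiffOn_const.prodMk contDiffOn_snd))
  have hfd : ∀ u ∈ Metric.ball (c x₀) r, HasFDerivAt f (formIn α P (u, 0)) (u, 0) := by
    intro u hu
    have e1 : HasFDerivAt (fun p : EuclideanSpace ℝ (Fin k) × EuclideanSpace ℝ (Fin m) => h p.1) _
      (u, 0) := HasFDerivAt.comp (u, (0 : EuclideanSpace ℝ (Fin m))) (f := Prod.fst) (hh u hu)
        hasFDerivAt_fst
    have e2 : HasFDerivAt (fun p : EuclideanSpace ℝ (Fin k) × EuclideanSpace ℝ (Fin m) =>
        formIn α P (p.1, 0)) _ (u, 0) :=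
      HasFDerivAt.comp (u, (0 : EuclideanSpace ℝ (Fin m))) (f := Prod.fst)
        ((hinc.contDiffAt (Metric.isOpen_ball.mem_nhds hu)).differentiableAt (by simp)).hasFDerivAt
        hasFDerivAt_fst
    have e3 : HasFDerivAt (fun p : EuclideanSpace ℝ (Fin k) × EuclideanSpace ℝ (Fin m) =>
        ((0 : EuclideanSpace ℝ (Fin k)), p.2)) ((0 : _ →L[ℝ] _).prod
          (ContinuousLinearMap.snd ℝ _ _)) (u, 0) :=
      (hasFDerivAt_const _ _).prodMk hasFDerivAt_snd
    convert! e1.add (e2.clm_apply e3) using 1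
    refine ContinuousLinearMap.ext fun w => ?_
    have : w = (w.1, 0) + (0, w.2) := by simp
    conv_lhs => rw [this, map_add]
    have hz0 (l : EuclideanSpace ℝ (Fin k) × EuclideanSpace ℝ (Fin m) →L[ℝ] ℝ) : l (0, 0) = 0 :=
      map_zero l
    simp [hz0]
  refine ⟨P.source ∩ P ⁻¹' B, fun y => f (P y), P.isOpen_inter_preimage hB,
    ⟨hP.mem_source, ?_⟩, ?_, ?_⟩
  · change (P (ι x₀)).1 ∈ Metric.ball (c x₀) r
    rw [h0]
    exact Metric.mem_ball_self hr
  · exact hf.contMDiffOn.comp (hP.smooth.contMDiffOn.mono inter_subset_left) fun y hy => hy.2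
  · rintro x ⟨hx, hxB⟩
    have hPx := (hP.of_mem x hx).2
    have hu : c x ∈ Metric.ball (c x₀) r := by
      have : (P (ι x)).1 ∈ Metric.ball (c x₀) r := hxB
      rwa [hPx] at this
    have e1 : HasMFDerivAt 𝓘(ℝ, EuclideanSpace ℝ (Fin k) × EuclideanSpace ℝ (Fin m)) 𝓘(ℝ, ℝ) f
        (P (ι x)) (formIn α P (P (ι x))) := by
      rw [hPx]
      exact (hfd _ hu).hasMFDerivAt
    have e2 := e1.comp (ι x) (hP.smooth.mdifferentiableAt hx).hasMFDerivAt
    refine e2.congr_mfderiv ?_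
    ext v
    exact formIn_mfderiv α hP.smooth hx v

end LocalPotentials

end ContactNbhd
end

noncomputable section

namespace ContactNbhd

/-! ### A closed extension of the contact form along the submanifold. -/

section Gluing

open Set

/-- Neighbourhoods so small that any two which meet lie in one of the two given larger ones. -/
theorem exists_nbhds_subset_of_nonempty_inter {X A : Type*} [TopologicalSpace X]
    [TopologicalSpace.MetrizableSpace X] (f : A → X) (O : A → Set X) (hO : ∀ i, O i ∈ 𝓝 (f i)) :
    ∃ U : A → Set X, (∀ i, IsOpen (U i)) ∧ (∀ i, f i ∈ U i) ∧ (∀ i, U i ⊆ O i) ∧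
      ∀ i j, (U i ∩ U j).Nonempty → U j ⊆ O i ∨ U i ⊆ O j := by
  let _ := TopologicalSpace.metrizableSpaceMetric X
  choose r hr hrO using fun i => Metric.mem_nhds_iff.mp (hO i)
  -- With radii `r / 4`, a point of the smaller ball is at distance less than `r i / 4 + 2 (r j / 4)
  -- < r i` from `f i`.
  have key : ∀ i j, r j ≤ r i →
      (Metric.ball (f i) (r i / 4) ∩ Metric.ball (f j) (r j / 4)).Nonempty →
      Metric.ball (f j) (r j / 4) ⊆ O i := by
    rintro i j hij ⟨y, hyi, hyj⟩ z hz
    refine hrO i ?_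
    rw [Metric.mem_ball] at *
    have h1 := dist_triangle z (f j) (f i)
    have h2 := dist_triangle (f j) y (f i)
    rw [dist_comm (f j) y] at h2
    have := hr i
    linarith
  refine ⟨fun i => Metric.ball (f i) (r i / 4), fun i => Metric.isOpen_ball,
    fun i => Metric.mem_ball_self (by linarith [hr i]), fun i =>
      (Metric.ball_subset_ball (by linarith [hr i])).trans (hrO i), fun i j h => ?_⟩
  rcases le_total (r j) (r i) with hij | hij
  · exact Or.inl (key i j hij h)
  · exact Or.inr (key j i hij (by rwa [inter_comm]))

variable {k d : ℕ} {L : Type*} [TopologicalSpace L] [ChartedSpace (EuclideanSpace ℝ (Fin k)) L]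
  {M : Type*} [TopologicalSpace M] [ChartedSpace (EuclideanSpace ℝ (Fin d)) M]

/-- The terms with derivatives of the weights drop out because each `f i` vanishes at `y`. Hence
gluing local potentials normalized at a point of `L` keeps their common differential there. -/
theorem hasMFDerivAt_sum_mul {A : Type*} (K : Finset A) {ρ f : A → M → ℝ} {y : M}
    {a : TangentSpace (𝓡 d) y →L[ℝ] ℝ} (hρ : ∀ i ∈ K, MDifferentiableAt (𝓡 d) 𝓘(ℝ, ℝ) (ρ i) y)
    (hf : ∀ i ∈ K, HasMFDerivAt (𝓡 d) 𝓘(ℝ, ℝ) (f i) y a) (hy : ∀ i ∈ K, f i y = 0) :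
    HasMFDerivAt (𝓡 d) 𝓘(ℝ, ℝ) (fun z => ∑ i ∈ K, ρ i z * f i z) y ((∑ i ∈ K, ρ i y) • a) := by
  classical
  induction K using Finset.induction_on with
  | empty => simpa using! hasMFDerivAt_const (0 : ℝ) y
  | insert i s hi ih =>
    have h1 := ih (fun j hj => hρ j (Finset.mem_insert_of_mem hj))
      (fun j hj => hf j (Finset.mem_insert_of_mem hj))
      (fun j hj => hy j (Finset.mem_insert_of_mem hj))
    have h2 := (hρ i (Finset.mem_insert_self i s)).hasMFDerivAt.mul
      (hf i (Finset.mem_insert_self i s))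
    have h2' : HasMFDerivAt (𝓡 d) 𝓘(ℝ, ℝ) (ρ i * f i) y (ρ i y • a) := by
      refine h2.congr_mfderiv (ContinuousLinearMap.ext fun v => ?_)
      have e0 (t : ℝ) : f i y * t = 0 := by rw [hy i (Finset.mem_insert_self i s), zero_mul]
      exact (congrArg (ρ i y * a v + ·) (e0 (mfderiv (𝓡 d) 𝓘(ℝ, ℝ) (ρ i) y v))).trans (add_zero _)
    have h3 := h2'.add h1
    have e1 : (fun z => ∑ j ∈ insert i s, ρ j z * f j z) =
        ρ i * f i + fun z => ∑ j ∈ s, ρ j z * f j z := by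
      funext z
      rw [Finset.sum_insert hi]
      rfl
    rw [e1, Finset.sum_insert hi, add_smul]
    exact h3

variable [IsManifold (𝓡 k) ∞ L]

/-- A function on `L` with vanishing differential is locally constant. -/
theorem eventually_eq_of_hasMFDerivAt_zero {g : L → ℝ} {x₀ : L}
    (hg : ∀ᶠ x in 𝓝 x₀, HasMFDerivAt (𝓡 k) 𝓘(ℝ, ℝ) g x
      (0 : TangentSpace (𝓡 k) x →L[ℝ] ℝ)) : ∀ᶠ x in 𝓝 x₀, g x = g x₀ := by
  let c := chartAt (EuclideanSpace ℝ (Fin k)) x₀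
  have hc : IsSmoothChart (d := k) c := isSmoothChart_chartAt x₀
  have hx₀ : x₀ ∈ c.source := mem_chart_source _ x₀
  have hcx : c.symm (c x₀) = x₀ := c.left_inv hx₀
  have h1 : ∀ᶠ u in 𝓝 (c x₀), u ∈ c.target ∧ HasMFDerivAt (𝓡 k) 𝓘(ℝ, ℝ) g (c.symm u)
      (0 : TangentSpace (𝓡 k) (c.symm u) →L[ℝ] ℝ) := by
    have h2 : ∀ᶠ u in 𝓝 (c x₀), u ∈ c.target := c.open_target.mem_nhds (c.map_source hx₀)
    have h3 := (c.continuousAt_symm (c.map_source hx₀)).eventually (by rwa [hcx])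
    exact h2.and h3
  obtain ⟨r, hr, hrs⟩ := Metric.eventually_nhds_iff_ball.mp h1
  have h2 : ∀ u ∈ Metric.ball (c x₀) r, HasFDerivAt (g ∘ c.symm)
      (0 : EuclideanSpace ℝ (Fin k) →L[ℝ] ℝ) u := by
    intro u hu
    have h3 := (hrs u hu).2.comp u (hc.mdifferentiableAt_symm (hrs u hu).1).hasMFDerivAt
    have h4 := h3.hasFDerivAt
    exact h4
  have h3 : ∀ u ∈ Metric.ball (c x₀) r, (g ∘ c.symm) u = (g ∘ c.symm) (c x₀) := by
    intro u hu
    exact (convex_ball (c x₀) r).is_const_of_fderivWithin_eq_zero (𝕜 := ℝ)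
      (fun v hv => (h2 v hv).differentiableAt.differentiableWithinAt)
      (fun v hv => by
        rw [fderivWithin_of_isOpen Metric.isOpen_ball hv]
        exact (h2 v hv).fderiv) hu (Metric.mem_ball_self hr)
  filter_upwards [c.open_source.mem_nhds hx₀,
    (c.continuousAt hx₀).preimage_mem_nhds (Metric.ball_mem_nhds _ hr)] with x hx hx'
  have := h3 _ hx'
  simpa [c.left_inv hx, hcx] using this

variable [IsManifold (𝓡 d) ∞ M] [T2Space M] [SigmaCompactSpace M]

/-- The restriction of `α` to `TM|_L` extends to a one-form near `L` which is locally exact. -/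
theorem exists_closed_extension [CompactSpace L] {m : ℕ} (hd : k + m = d) {ι : L → M}
    (hι : Manifold.IsSmoothEmbedding (𝓡 k) (𝓡 d) ∞ ι) {α : CovectorField d M}
    (hα : IsSmoothForm α) (hclosed : IsClosedForm (pullbackForm (k := k) ι α)) :
    ∃ η : CovectorField d M, (∀ x, η (ι x) = α (ι x)) ∧ ∀ x₀, ∃ (O : Set M) (G : M → ℝ),
      IsOpen O ∧ ι x₀ ∈ O ∧ ContMDiffOn (𝓡 d) 𝓘(ℝ, ℝ) ∞ G O ∧
      ∀ y ∈ O, HasMFDerivAt (𝓡 d) 𝓘(ℝ, ℝ) G y (η y) := by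
  classical
  have := Manifold.metrizableSpace (𝓡 d) M
  have hιc : Continuous ι := hι.isEmbedding.continuous
  choose S f hS hmem hf hfα using exists_local_potential hd hι hα hclosed
  -- The extra index `none`, with the zero function on the complement of `ι(L)`, completes the cover
  -- to all of `M`; its condition along `L` is vacuous.
  let S' : Option L → Set M := fun o => o.elim (range ι)ᶜ S
  let f' : Option L → M → ℝ := fun o => o.elim 0 f
  have hS' : ∀ i, IsOpen (S' i) := by
    rintro (_ | i)
    · exact (isCompact_range hιc).isClosed.isOpen_compl
    · exact hS i
  have hf' : ∀ i, ContMDiffOn (𝓡 d) 𝓘(ℝ, ℝ) ∞ (f' i) (S' i) := by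
    rintro (_ | i)
    · exact contMDiffOn_const (c := (0 : ℝ))
    · exact hf i
  have hfα' : ∀ i x, ι x ∈ S' i → HasMFDerivAt (𝓡 d) 𝓘(ℝ, ℝ) (f' i) (ι x) (α (ι x)) := by
    rintro (_ | i) x hx
    · exact absurd (mem_range_self x) hx
    · exact hfα i x hx
  obtain ⟨ρ, hρ⟩ := SmoothPartitionOfUnity.exists_isSubordinate (𝓡 d) isClosed_univ S' hS' (by
    intro y _
    by_cases hy : y ∈ range ι
    · obtain ⟨x, rfl⟩ := hy
      exact mem_iUnion.mpr ⟨some x, hmem x⟩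
    · exact mem_iUnion.mpr ⟨none, hy⟩)
  let K : L → Finset (Option L) := fun x => ρ.fintsupport (ι x)
  have hKS : ∀ x, ∀ i ∈ K x, ι x ∈ S' i := fun x i hi =>
    hρ i ((ρ.mem_fintsupport_iff (ι x) i).mp hi)
  have hsum : ∀ x, ∀ y, ρ.fintsupport y ⊆ K x → ∑ i ∈ K x, ρ i y = 1 := fun x y h =>
    ρ.sum_finsupport' y (mem_univ y) ((ρ.finsupport_subset_fintsupport y).trans h)
  -- the neighbourhoods on which the local potentials can be compared
  let O : L → Set M := fun x₀ => {y | ρ.fintsupport y ⊆ K x₀ ∧ (∀ i ∈ K x₀, y ∈ S' i) ∧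
    ∀ x, ι x = y → ∀ i ∈ K x₀, ∀ j ∈ K x₀,
      f' i (ι x) - f' j (ι x) = f' i (ι x₀) - f' j (ι x₀)}
  have hO : ∀ x₀, O x₀ ∈ 𝓝 (ι x₀) := by
    intro x₀
    have h1 : ∀ᶠ y in 𝓝 (ι x₀), ∀ i ∈ K x₀, y ∈ S' i :=
      (Finset.eventually_all (K x₀)).mpr fun i hi => (hS' i).mem_nhds (hKS x₀ i hi)
    have h2 : ∀ᶠ x in 𝓝 x₀, ∀ i ∈ K x₀, ∀ j ∈ K x₀,
        f' i (ι x) - f' j (ι x) = f' i (ι x₀) - f' j (ι x₀) := by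
      refine (Finset.eventually_all (K x₀)).mpr fun i hi =>
        (Finset.eventually_all (K x₀)).mpr fun j hj => ?_
      refine eventually_eq_of_hasMFDerivAt_zero (k := k) (g := fun x => f' i (ι x) - f' j (ι x)) ?_
      filter_upwards [hιc.continuousAt.eventually ((hS' i).mem_nhds (hKS x₀ i hi)),
        hιc.continuousAt.eventually ((hS' j).mem_nhds (hKS x₀ j hj))] with x hxi hxj
      have e := ((hι.contMDiff x).mdifferentiableAt (by simp)).hasMFDerivAt
      have e1 := ((hfα' i x hxi).comp x e).sub ((hfα' j x hxj).comp x e)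
      refine e1.congr_mfderiv ?_
      exact sub_self _
    rw [hι.isEmbedding.isInducing.nhds_eq_comap, Filter.eventually_comap] at h2
    filter_upwards [ρ.eventually_fintsupport_subset (ι x₀), h1, h2] with y hy1 hy2 hy3
    exact ⟨hy1, hy2, hy3⟩
  obtain ⟨U, hU, hιU, hUO, hUU⟩ := exists_nbhds_subset_of_nonempty_inter ι O hO
  -- The local potentials are normalized to vanish at `ι x₀` before being averaged.
  let G : L → M → ℝ := fun x₀ y => ∑ i ∈ K x₀, ρ i y * (f' i y - f' i (ι x₀))
  have hG : ∀ x₀, ContMDiffOn (𝓡 d) 𝓘(ℝ, ℝ) ∞ (G x₀) (U x₀) := by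
    intro x₀
    refine contMDiffOn_finsetSum fun i hi => ?_
    exact (ρ i).contMDiff.contMDiffOn.mul
      (((hf' i).mono fun y hy => (hUO x₀ hy).2.1 i hi).sub contMDiffOn_const)
  -- On `O x₀` the differences of potentials are constant along `L`, so moving the base point from
  -- `x₀` to `x₁` shifts every `f' i` by the same amount. As the weights sum to `1`, the two
  -- averages differ by that amount.
  have hGG : ∀ x₀ x₁, U x₁ ⊆ O x₀ → ∀ y ∈ U x₀ ∩ U x₁,
      ∃ c : ℝ, ∀ᶠ y' in 𝓝 y, G x₀ y' = G x₁ y' + c := by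
    intro x₀ x₁ h01 y hy
    have h1 := h01 (hιU x₁)
    obtain ⟨i₀, hi₀⟩ : (K x₀).Nonempty := by
      rw [Finset.nonempty_iff_ne_empty]
      intro h0
      have := hsum x₀ (ι x₀) subset_rfl
      rw [h0] at this
      simp at this
    refine ⟨f' i₀ (ι x₁) - f' i₀ (ι x₀), ?_⟩
    filter_upwards [(hU x₀).mem_nhds hy.1, (hU x₁).mem_nhds hy.2] with y' hy0 hy1
    have e1 : G x₁ y' = ∑ i ∈ K x₀, ρ i y' * (f' i y' - f' i (ι x₁)) := by
      refine Finset.sum_subset h1.1 fun i _ hi => ?_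
      have : i ∉ ρ.finsupport y' := fun h => hi ((hUO x₁ hy1).1
        (ρ.finsupport_subset_fintsupport y' h))
      rw [ρ.mem_finsupport, Function.notMem_support] at this
      rw [this, zero_mul]
    have e2 : f' i₀ (ι x₁) - f' i₀ (ι x₀) =
        ∑ i ∈ K x₀, ρ i y' * (f' i₀ (ι x₁) - f' i₀ (ι x₀)) := by
      rw [← Finset.sum_mul, hsum x₀ y' (hUO x₀ hy0).1, one_mul]
    rw [e1, e2, ← Finset.sum_add_distrib]
    refine Finset.sum_congr rfl fun i hi => ?_
    have := h1.2.2 x₁ rfl i hi i₀ hi₀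
    rw [← mul_add]
    congr 1
    linarith
  have hGd : ∀ x₀ x₁, ∀ y ∈ U x₀ ∩ U x₁, HasMFDerivAt (𝓡 d) 𝓘(ℝ, ℝ) (G x₀) y
      (mfderiv (𝓡 d) 𝓘(ℝ, ℝ) (G x₁) y) := by
    intro x₀ x₁ y hy
    have h1 : HasMFDerivAt (𝓡 d) 𝓘(ℝ, ℝ) (G x₁) y (mfderiv (𝓡 d) 𝓘(ℝ, ℝ) (G x₁) y) :=
      (((hG x₁).contMDiffAt ((hU x₁).mem_nhds hy.2)).mdifferentiableAt (by simp)).hasMFDerivAt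
    have h2 : ∃ c : ℝ, ∀ᶠ y' in 𝓝 y, G x₀ y' = G x₁ y' + c := by
      rcases hUU x₀ x₁ ⟨y, hy⟩ with h | h
      · exact hGG x₀ x₁ h y hy
      · obtain ⟨c, hc⟩ := hGG x₁ x₀ h y hy.symm
        refine ⟨-c, hc.mono fun y' h => by rw [h]; ring⟩
    obtain ⟨c, hc⟩ := h2
    have h3 := h1.add (hasMFDerivAt_const (I := 𝓡 d) (I' := 𝓘(ℝ, ℝ)) c y)
    refine (h3.congr_of_eventuallyEq (f₁ := G x₀) hc).congr_mfderiv ?_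
    exact add_zero _
  -- Overlapping primitives differ locally by constants, so the differential does not depend on the
  -- chosen index.
  let η : CovectorField d M := fun y =>
    if h : ∃ x, y ∈ U x then mfderiv (𝓡 d) 𝓘(ℝ, ℝ) (G h.choose) y else 0
  have hη : ∀ x₀, ∀ y ∈ U x₀, HasMFDerivAt (𝓡 d) 𝓘(ℝ, ℝ) (G x₀) y (η y) := by
    intro x₀ y hy
    have h : ∃ x, y ∈ U x := ⟨x₀, hy⟩
    have e : η y = mfderiv (𝓡 d) 𝓘(ℝ, ℝ) (G h.choose) y := dif_pos h
    rw [e]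
    exact hGd x₀ h.choose y ⟨hy, h.choose_spec⟩
  refine ⟨η, fun x => ?_, fun x₀ => ⟨U x₀, G x₀, hU x₀, hιU x₀, hG x₀, hη x₀⟩⟩
  have h1 := hasMFDerivAt_sum_mul (K x) (ρ := fun i => ρ i)
    (f := fun i y => f' i y - f' i (ι x)) (y := ι x) (a := α (ι x))
    (fun i _ => ((ρ i).contMDiff (ι x)).mdifferentiableAt (by simp))
    (fun i hi => ((hfα' i x (hKS x i hi)).sub (hasMFDerivAt_const (f' i (ι x)) (ι x))).congr_mfderiv
      (sub_zero _)) (fun i _ => sub_self _)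
  rw [hsum x (ι x) subset_rfl, one_smul] at h1
  exact hasMFDerivAt_unique (hη x (ι x) (hιU x)) h1

end Gluing

end ContactNbhd
end

noncomputable section

namespace ContactNbhd

/-! ### The Legendrian retraction -/

section SingularODE

open Set

variable {W : Type*} [NormedAddCommGroup W] [NormedSpace ℝ W]

/-- The equation is given on the open interval; continuity of its right-hand side yields the left
derivative at `s = 1`, where the uniqueness argument starts. -/
theorem hasDerivWithinAt_Iic_of_singular {z : W → W} {Ω : Set W} (hz : ContinuousOn z Ω)
    {x : ℝ → W} (hx : ContinuousOn x (Icc 0 1)) (hxΩ : ∀ s ∈ Icc (0 : ℝ) 1, x s ∈ Ω)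
    (hxd : ∀ s ∈ Ioo (0 : ℝ) 1, HasDerivAt x (-(s⁻¹ • z (x s))) s) {s : ℝ} (hs : s ∈ Ioc (0 : ℝ) 1) :
    HasDerivWithinAt x (-(s⁻¹ • z (x s))) (Iic s) s := by
  rcases hs.2.lt_or_eq with h | rfl
  · exact (hxd s ⟨hs.1, h⟩).hasDerivWithinAt
  have hnb : Ioo (0 : ℝ) 1 ∈ 𝓝[<] (1 : ℝ) := Ioo_mem_nhdsLT one_pos
  refine hasDerivWithinAt_Iic_of_tendsto_deriv (s := Ioo 0 1)
    (fun s hs => (hxd s hs).differentiableAt.differentiableWithinAt)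
    ((hx 1 (by simp)).mono Ioo_subset_Icc_self) hnb ?_
  have h1 : Filter.Tendsto x (𝓝[<] 1) (𝓝[Ω] (x 1)) := by
    refine tendsto_nhdsWithin_iff.mpr ⟨?_, ?_⟩
    · exact (hx 1 (by simp)).mono_left (nhdsWithin_le_of_mem (Filter.mem_of_superset hnb
        Ioo_subset_Icc_self))
    · filter_upwards [hnb] with s hs using hxΩ s (Ioo_subset_Icc_self hs)
  have h2 : Filter.Tendsto (fun s : ℝ => -(s⁻¹ • z (x s))) (𝓝[<] 1) (𝓝 (-((1 : ℝ)⁻¹ • z (x 1)))) :=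
    (((Filter.tendsto_id.mono_left nhdsWithin_le_nhds).inv₀ one_ne_zero).smul
      ((hz (x 1) (hxΩ 1 (by simp))).tendsto.comp h1)).neg
  refine h2.congr' ?_
  filter_upwards [hnb] with s hs using (hxd s hs).deriv.symm

/-- Two solutions of `s x' = -z(x)` on `[0, 1]` which agree at `s = 1` agree at `s = 0`. -/
theorem eq_at_zero_of_singular {z : W → W} {Ω : Set W} (hΩ : IsOpen Ω) (hz : ContDiffOn ℝ ∞ z Ω)
    {x y : ℝ → W} (hx : ContinuousOn x (Icc 0 1)) (hxΩ : ∀ s ∈ Icc (0 : ℝ) 1, x s ∈ Ω)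
    (hxd : ∀ s ∈ Ioo (0 : ℝ) 1, HasDerivAt x (-(s⁻¹ • z (x s))) s)
    (hy : ContinuousOn y (Icc 0 1)) (hyΩ : ∀ s ∈ Icc (0 : ℝ) 1, y s ∈ Ω)
    (hyd : ∀ s ∈ Ioo (0 : ℝ) 1, HasDerivAt y (-(s⁻¹ • z (y s))) s) (h1 : x 1 = y 1) :
    x 0 = y 0 := by
  let K : Set W := x '' Icc 0 1 ∪ y '' Icc 0 1
  have hK : IsCompact K := (isCompact_Icc.image_of_continuousOn hx).union
    (isCompact_Icc.image_of_continuousOn hy)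
  have hKΩ : K ⊆ Ω := union_subset (image_subset_iff.mpr hxΩ) (image_subset_iff.mpr hyΩ)
  obtain ⟨C, hC⟩ : ∃ C, LipschitzOnWith C z K := by
    refine LocallyLipschitzOn.exists_lipschitzOnWith_of_compact hK fun p hp => ?_
    obtain ⟨C, t, ht, hCt⟩ := ((hz.contDiffAt (hΩ.mem_nhds (hKΩ hp))).of_le
      (show (1 : WithTop ℕ∞) ≤ ∞ by exact_mod_cast le_top)).exists_lipschitzOnWith
    exact ⟨C, t, nhdsWithin_le_nhds ht, hCt⟩
  -- Away from `s = 0` the equation is Lipschitz with constant `ε⁻¹ C`, so uniqueness holds on each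
  -- `[ε, 1]`; the value at `0` follows by continuity.
  have key : ∀ ε ∈ Ioo (0 : ℝ) 1, x ε = y ε := by
    intro ε hε
    have hIcc : Icc ε 1 ⊆ Icc (0 : ℝ) 1 := Icc_subset_Icc_left hε.1.le
    have hIoc : ∀ s ∈ Ioc ε 1, s ∈ Ioc (0 : ℝ) 1 := fun s hs => ⟨hε.1.trans hs.1, hs.2⟩
    refine ODE_solution_unique_of_mem_Icc_left (v := fun s w => -(s⁻¹ • z w)) (s := fun _ => K)
      (K := ⟨ε⁻¹, (inv_pos.mpr hε.1).le⟩ * C) ?_ (hx.mono hIcc)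
      (fun s hs => hasDerivWithinAt_Iic_of_singular hz.continuousOn hx hxΩ hxd (hIoc s hs))
      (fun s hs => Or.inl ⟨s, Ioc_subset_Icc_self (hIoc s hs), rfl⟩) (hy.mono hIcc)
      (fun s hs => hasDerivWithinAt_Iic_of_singular hz.continuousOn hy hyΩ hyd (hIoc s hs))
      (fun s hs => Or.inr ⟨s, Ioc_subset_Icc_self (hIoc s hs), rfl⟩) h1 ⟨le_rfl, hε.2.le⟩
    intro s hs
    refine LipschitzOnWith.of_dist_le_mul fun p hp q hq => ?_
    have hs0 : 0 < s := hε.1.trans hs.1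
    have e1 := hC.dist_le_mul p hp q hq
    rw [dist_neg_neg, dist_smul₀, Real.norm_of_nonneg (inv_pos.mpr hs0).le]
    change _ ≤ ε⁻¹ * C * dist p q
    rw [mul_assoc]
    exact mul_le_mul (inv_anti₀ hε.1 hs.1.le) e1 dist_nonneg (inv_pos.mpr hε.1).le
  have hnb : Ioo (0 : ℝ) 1 ∈ 𝓝[>] (0 : ℝ) := Ioo_mem_nhdsGT one_pos
  have hlim {x : ℝ → W} (hx : ContinuousOn x (Icc 0 1)) :
      Filter.Tendsto x (𝓝[>] 0) (𝓝 (x 0)) := (hx 0 (by simp)).mono_left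
    (nhdsWithin_le_of_mem (Filter.mem_of_superset hnb Ioo_subset_Icc_self))
  refine tendsto_nhds_unique (hlim hx) ((hlim hy).congr' ?_)
  filter_upwards [hnb] with s hs using (key s hs).symm

end SingularODE

/-! ### The retraction in one slice chart. -/

section LocalRetraction

open Set

variable {m k d : ℕ} {L : Type*} [TopologicalSpace L] [ChartedSpace (EuclideanSpace ℝ (Fin k)) L]
  [IsManifold (𝓡 k) ∞ L] {M : Type*} [TopologicalSpace M]
  [ChartedSpace (EuclideanSpace ℝ (Fin d)) M] {ι : L → M} {x₀ : L}
  {P : OpenPartialHomeomorph M (EuclideanSpace ℝ (Fin k) × EuclideanSpace ℝ (Fin m))}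

/-- In a slice chart, flowing along the contact field retracts a neighbourhood of a point of `L` to
`L`, with Legendrian fibres. -/
theorem IsSliceChart.exists_local_retraction (hP : IsSliceChart (d := d) ι x₀ P)
    (hkm : m + 1 = k) {α η : CovectorField d M}
    {Ω : Set (EuclideanSpace ℝ (Fin k) × EuclideanSpace ℝ (Fin m))}
    (hΩ : IsPreLagrangianOn (formIn α P) (formIn η P) Ω) (hΩP : Ω ⊆ P.target)
    (hx₀ : P (ι x₀) ∈ Ω) :
    ∃ (V : Set M) (ϖ : M → L)
      (γ : M → ℝ → EuclideanSpace ℝ (Fin k) × EuclideanSpace ℝ (Fin m)),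
      IsOpen V ∧ ι x₀ ∈ V ∧ V ⊆ P.source ∧ ContMDiffOn (𝓡 d) (𝓡 k) ∞ ϖ V ∧
      (∀ y ∈ V, ∀ v, mfderiv (𝓡 d) (𝓡 k) ϖ y v = 0 → α y v = 0) ∧
      (∀ x, ι x ∈ V → ϖ (ι x) = x) ∧
      ∀ y ∈ V, γ y 1 = P y ∧ ContinuousOn (γ y) (Icc 0 1) ∧ (∀ s ∈ Icc (0 : ℝ) 1, γ y s ∈ Ω) ∧
        (∀ s ∈ Ioo (0 : ℝ) 1, HasDerivAt (γ y)
          (-(s⁻¹ • contactField (formIn α P) (formIn η P) (γ y s))) s) ∧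
        P.symm (γ y 0) = ι (ϖ y) := by
  let c := chartAt (EuclideanSpace ℝ (Fin k)) x₀
  have hc : IsSmoothChart (d := k) c := isSmoothChart_chartAt x₀
  have h0 : P (ι x₀) = (c x₀, 0) := (hP.of_mem x₀ hP.mem_source).2
  obtain ⟨Φ, N, hΦ, hN, hu₀, hNΩ, hΦ1, hΦ0, hΦΩ, hode, hfix⟩ := exists_contraction hΩ.contact.isOpen
    hΩ.contDiffOn_contactField (u₀ := c x₀) (h0 ▸ hx₀) (fun u hu => hΩ.contactField_zero hu)
    (fun u hu q => hΩ.fderiv_contactField_inr (by simp [hkm]) hu q)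
  let ϕ : M → EuclideanSpace ℝ (Fin k) := fun y => (Φ (0, P y)).1
  let V : Set M := P.source ∩ P ⁻¹' N
  have hz : ∀ w, Φ (0, w) = ((Φ (0, w)).1, 0) := fun w => Prod.ext rfl (hΦ0 w)
  have hϕ0 : ∀ y ∈ V, (ϕ y, (0 : EuclideanSpace ℝ (Fin m))) ∈ P.target := by
    intro y hy
    have := hΩP (hΦΩ _ hy.2 0 (by simp))
    rwa [hz] at this
  have hϕt : ∀ y ∈ V, ϕ y ∈ c.target := fun y hy => (hP.of_zero _ (hϕ0 y hy)).1
  have hV : IsOpen V := P.isOpen_inter_preimage hN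
  have hϕs : ContMDiffOn (𝓡 d) 𝓘(ℝ, EuclideanSpace ℝ (Fin k)) ∞ ϕ V :=
    ((contDiff_fst.comp (hΦ.comp (contDiff_const.prodMk contDiff_id))).contMDiff.comp_contMDiffOn
      hP.smooth.contMDiffOn).mono inter_subset_left
  have hϖs : ContMDiffOn (𝓡 d) (𝓡 k) ∞ (fun y => c.symm (ϕ y)) V :=
    hc.contMDiffOn_symm.comp hϕs hϕt
  refine ⟨V, fun y => c.symm (ϕ y), fun y s => Φ (s, P y), hV, ⟨hP.mem_source, ?_⟩,
    inter_subset_left, hϖs, ?_, ?_, fun y hy => ⟨hΦ1 _, ?_, hΦΩ _ hy.2, hode _ hy.2, ?_⟩⟩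
  · change P (ι x₀) ∈ N
    rwa [h0]
  · intro y hy v hv
    rw [← formIn_mfderiv α hP.smooth hy.1]
    refine hΩ.legendrian hΦ hN hΦΩ hode hΦ0 hΦ1 hy.2 ?_
    have e0 : HasFDerivAt (fun w => Φ (0, w)) (fderiv ℝ (fun w => Φ (0, w)) (P y)) (P y) :=
      ((hΦ.comp (contDiff_const.prodMk contDiff_id)).differentiable (by simp) _).hasFDerivAt
    have e1 := e0.hasMFDerivAt.comp y (hP.smooth.mdifferentiableAt hy.1).hasMFDerivAt
    have e2 := (hc.mdifferentiableAt (c.map_target (hϕt y hy))).hasMFDerivAt.comp y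
      ((hϖs.contMDiffAt (hV.mem_nhds hy)).mdifferentiableAt (by simp)).hasMFDerivAt
    -- In the chart, `Φ (0, ·)` is `(c ∘ ϖ, 0)`, so a vector killed by `dϖ` is killed by the
    -- derivative of `Φ (0, ·)`, as the Legendrian property requires.
    have e3 : ((fun w => Φ (0, w)) ∘ P) =ᶠ[𝓝 y]
        fun y => (c (c.symm (ϕ y)), (0 : EuclideanSpace ℝ (Fin m))) := by
      filter_upwards [hV.mem_nhds hy] with y' hy'
      rw [c.right_inv (hϕt y' hy')]
      exact hz _
    have e4 := ((ContinuousLinearMap.inl ℝ (EuclideanSpace ℝ (Fin k))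
      (EuclideanSpace ℝ (Fin m))).hasFDerivAt.hasMFDerivAt).comp y e2
    have e5 := hasMFDerivAt_unique e1 (e4.congr_of_eventuallyEq e3)
    have e6 := congrArg (fun f : EuclideanSpace ℝ (Fin d) →L[ℝ]
      EuclideanSpace ℝ (Fin k) × EuclideanSpace ℝ (Fin m) => f v) e5
    refine e6.trans (Prod.ext ?_ rfl)
    exact (congrArg (mfderiv (𝓡 k) (𝓡 k) c (c.symm (ϕ y))) hv).trans (map_zero _)
  · intro x hx
    obtain ⟨hxc, hPx⟩ := hP.of_mem x hx.1
    have hxN : (c x, (0 : EuclideanSpace ℝ (Fin m))) ∈ N := hPx ▸ hx.2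
    change c.symm (Φ (0, P (ι x))).1 = x
    rw [hPx, hfix _ hxN 0 (by simp)]
    exact c.left_inv hxc
  · exact (hΦ.continuous.comp (by fun_prop : Continuous fun s : ℝ => (s, P y))).continuousOn
  · change P.symm (Φ (0, P y)) = _
    rw [hz]
    exact (hP.of_zero _ (hϕ0 y hy)).2

end LocalRetraction

end ContactNbhd
end

noncomputable section

namespace ContactNbhd

/-! ### Agreement of the local retractions and the global one. -/

section Retraction

open Set

variable {m k d : ℕ} {L : Type*} [TopologicalSpace L] [ChartedSpace (EuclideanSpace ℝ (Fin k)) L]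
  [IsManifold (𝓡 k) ∞ L] {M : Type*} [TopologicalSpace M]
  [ChartedSpace (EuclideanSpace ℝ (Fin d)) M] [IsManifold (𝓡 d) ∞ M] {α η : CovectorField d M}
  {ι : L → M} {x₀ : L}

/-- A closed one-form which agrees with the contact form along `L`, in a slice chart. -/
theorem IsSliceChart.isPreLagrangianOn {F : Type*} [NormedAddCommGroup F] [NormedSpace ℝ F]
    [FiniteDimensional ℝ F]
    {P : OpenPartialHomeomorph M (EuclideanSpace ℝ (Fin k) × F)} (hP : IsSliceChart (d := d) ι x₀ P)
    (hα : IsContactForm α) (hι : IsCoisotropicEmbedding (k := k) α ι)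
    (hηα : ∀ x, η (ι x) = α (ι x)) {O : Set M} (hO : IsOpen O) {G : M → ℝ}
    (hG : ContMDiffOn (𝓡 d) 𝓘(ℝ, ℝ) ∞ G O) (hGη : ∀ y ∈ O, HasMFDerivAt (𝓡 d) 𝓘(ℝ, ℝ) G y (η y)) :
    IsPreLagrangianOn (formIn α P) (formIn η P) (P.target ∩ P.symm ⁻¹' O) := by
  have hopen : IsOpen (P.target ∩ P.symm ⁻¹' O) := P.symm.isOpen_inter_preimage hO
  have hg : ContDiffOn ℝ ∞ (G ∘ P.symm) (P.target ∩ P.symm ⁻¹' O) :=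
    (hG.comp (hP.smooth.contMDiffOn_symm.mono inter_subset_left) fun p hp => hp.2).contDiffOn
  have hgd : ∀ p ∈ P.target ∩ P.symm ⁻¹' O, formIn η P p = fderiv ℝ (G ∘ P.symm) p := by
    intro p hp
    have h1 := (hGη _ hp.2).comp p (hP.smooth.mdifferentiableAt_symm hp.1).hasMFDerivAt
    have h2 := ((hg.contDiffAt (hopen.mem_nhds hp)).differentiableAt
      (by simp)).hasFDerivAt.hasMFDerivAt
    exact hasMFDerivAt_unique h1 h2
  refine ⟨(hα.isContactOn_formIn hP.smooth).mono hopen inter_subset_left,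
    (hg.fderiv_of_isOpen hopen (m := ∞) (by norm_cast)).congr hgd, fun p hp v w => ?_,
    fun u hu => ?_, fun u hu => ?_⟩
  · have h1 : formIn η P =ᶠ[𝓝 p] fderiv ℝ (G ∘ P.symm) := by
      filter_upwards [hopen.mem_nhds hp] with q hq using hgd q hq
    rw [h1.fderiv_eq]
    exact (hg.contDiffAt (hopen.mem_nhds hp)).isSymmSndFDerivAt
      (by rw [minSmoothness_of_isRCLikeNormedField]; exact WithTop.coe_le_coe.mpr le_top) v w
  · have h1 : ∀ y ∈ range ι, η y = α y := by
      rintro _ ⟨x, rfl⟩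
      exact hηα x
    have h2 : P.symm (u, 0) ∈ range ι := ⟨_, (hP.of_zero u hu.1).2.symm⟩
    unfold formIn
    rw [h1 _ h2]
  · let c := chartAt (EuclideanSpace ℝ (Fin k)) x₀
    have hc : IsSmoothChart (d := k) c := isSmoothChart_chartAt x₀
    have huc : u ∈ c.target := (hP.of_zero u hu.1).1
    have h1 := hι.pullbackForm_ne_zero hα (c.symm u)
    obtain ⟨v, hv⟩ : ∃ v, pullbackForm (k := k) ι α (c.symm u) v ≠ 0 := by
      by_contra! h
      exact h1 (ContinuousLinearMap.ext h)
    refine ⟨mfderiv (𝓡 k) (𝓡 k) c (c.symm u) v, ?_⟩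
    rw [← formIn_mfderiv _ hc (c.map_target huc), c.right_inv huc,
      hP.formIn_pullbackForm hι.isSmoothEmbedding.contMDiff α hu.1] at hv
    exact hv

/-- Local retractions along the contact field agree on overlaps. -/
theorem retraction_eq_of_contraction {W W' : Type*} [NormedAddCommGroup W] [NormedSpace ℝ W]
    [FiniteDimensional ℝ W] [NormedAddCommGroup W'] [NormedSpace ℝ W'] [FiniteDimensional ℝ W']
    {P : OpenPartialHomeomorph M W} {P' : OpenPartialHomeomorph M W'}
    (hP : IsSmoothChart (d := d) P) (hP' : IsSmoothChart (d := d) P') (hα : IsContactForm α)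
    {Ω : Set W} {Ω' : Set W'} (hΩP : Ω ⊆ P.target) (hΩ : IsOpen Ω) (hΩP' : Ω' ⊆ P'.target)
    (hηs : ContDiffOn ℝ ∞ (formIn η P) Ω)
    (hsub : ∀ p ∈ Ω', P'.symm p ∈ P.source ∧ P (P'.symm p) ∈ Ω)
    {x : ℝ → W} {x' : ℝ → W'} (hx : ContinuousOn x (Icc 0 1)) (hxΩ : ∀ s ∈ Icc (0 : ℝ) 1, x s ∈ Ω)
    (hxd : ∀ s ∈ Ioo (0 : ℝ) 1,
      HasDerivAt x (-(s⁻¹ • contactField (formIn α P) (formIn η P) (x s))) s)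
    (hx' : ContinuousOn x' (Icc 0 1)) (hxΩ' : ∀ s ∈ Icc (0 : ℝ) 1, x' s ∈ Ω')
    (hxd' : ∀ s ∈ Ioo (0 : ℝ) 1,
      HasDerivAt x' (-(s⁻¹ • contactField (formIn α P') (formIn η P') (x' s))) s)
    (h1 : P.symm (x 1) = P'.symm (x' 1)) : P.symm (x 0) = P'.symm (x' 0) := by
  have hΩc := (hα.isContactOn_formIn hP).mono hΩ hΩP
  have hmem : ∀ s ∈ Icc (0 : ℝ) 1, x' s ∈ P'.target ∧ P'.symm (x' s) ∈ P.source := fun s hs =>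
    ⟨hΩP' (hxΩ' s hs), (hsub _ (hxΩ' s hs)).1⟩
  have hψ : ∀ s ∈ Icc (0 : ℝ) 1, ContDiffAt ℝ ∞ (P ∘ P'.symm) (x' s) := fun s hs =>
    hP'.contDiffAt_trans hP (hmem s hs).1 (hmem s hs).2
  have key := eq_at_zero_of_singular hΩ
    ((hΩc.contDiffOn_contactPair hηs).fst) hx hxΩ hxd
    (y := fun s => (P ∘ P'.symm) (x' s))
    (fun s hs => (hψ s hs).continuousAt.comp_continuousWithinAt (hx' s hs))
    (fun s hs => (hsub _ (hxΩ' s hs)).2) (fun s hs => ?_) ?_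
  · have h2 := congrArg P.symm key
    rw [h2]
    exact P.left_inv (hmem 0 (by simp)).2
  · have hs' := Ioo_subset_Icc_self hs
    obtain ⟨hp, hp'⟩ := hmem s hs'
    have e1 := ((hψ s hs').differentiableAt (by simp)).hasFDerivAt.comp_hasDerivAt s (hxd' s hs)
    -- The transition map carries contact field to contact field, hence the second flow line to a
    -- solution of the same singular equation as the first.
    have e2 := contactField_pullback (η := formIn η P') (η' := formIn η P)
      (hα.isContactOn_formIn hP') hΩc hp (hsub _ (hxΩ' s hs')).2
      (hψ s hs') (fun w => by
        obtain ⟨v, hv⟩ := hP.mfderiv_surjective hp' w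
        refine ⟨mfderiv (𝓡 d) 𝓘(ℝ, W') P' (P'.symm (x' s)) v, ?_⟩
        exact ((hP'.fderiv_trans hP hp hp' _).trans (congrArg
          (mfderiv (𝓡 d) 𝓘(ℝ, W) P (P'.symm (x' s))) (hP'.mfderiv_symm_mfderiv hp v))).trans hv)
      (eventually_formIn_trans α hP' hP hp hp') (formIn_trans η hP' hP hp hp')
    rw [map_neg, map_smul, ← e2] at e1
    exact e1
  · have h2 := congrArg P h1
    rw [P.right_inv (hΩP (hxΩ 1 (by simp)))] at h2
    exact h2

variable [T2Space M] [SigmaCompactSpace M] [CompactSpace L] [Nonempty L]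

/-- A pre-Lagrangian submanifold on which the contact form is closed has a neighbourhood which
retracts to it with Legendrian fibres. -/
theorem exists_legendrian_retraction (hkm : m + 1 = k) (hd : k + m = d) (hα : IsContactForm α)
    (hι : IsCoisotropicEmbedding (k := k) α ι)
    (hclosed : IsClosedForm (pullbackForm (k := k) ι α)) :
    ∃ (V : Set M) (ϖ : M → L), IsOpen V ∧ (∀ x, ι x ∈ V) ∧ ContMDiffOn (𝓡 d) (𝓡 k) ∞ ϖ V ∧
      (∀ x, ϖ (ι x) = x) ∧ ∀ y ∈ V, ∀ v, mfderiv (𝓡 d) (𝓡 k) ϖ y v = 0 → α y v = 0 := by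
  classical
  have := Manifold.metrizableSpace (𝓡 d) M
  obtain ⟨η, hηα, hη⟩ := exists_closed_extension hd hι.isSmoothEmbedding hα.smooth hclosed
  choose O G hO hιO hG hGη using hη
  choose P hP using exists_isSliceChart (k := k) (d := d) hι.isSmoothEmbedding hd
  let Ω : L → Set (EuclideanSpace ℝ (Fin k) × EuclideanSpace ℝ (Fin m)) := fun x =>
    (P x).target ∩ (P x).symm ⁻¹' O x
  have hΩ : ∀ x, IsPreLagrangianOn (formIn α (P x)) (formIn η (P x)) (Ω x) := fun x =>
    (hP x).isPreLagrangianOn hα hι hηα (hO x) (hG x) (hGη x)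
  obtain ⟨U, hU, hιU, hUO, hUU⟩ := exists_nbhds_subset_of_nonempty_inter ι
    (fun x => (P x).source ∩ O x) fun x => Filter.inter_mem
      ((P x).open_source.mem_nhds (hP x).mem_source) ((hO x).mem_nhds (hιO x))
  -- Flow lines are confined to the small sets `U x`. When two of these meet, one lies in the larger
  -- chart domain of the other, so the entire flow line, and not only its starting point, can be
  -- compared in one chart.
  let Ω' : L → Set (EuclideanSpace ℝ (Fin k) × EuclideanSpace ℝ (Fin m)) := fun x =>
    (P x).target ∩ (P x).symm ⁻¹' U x
  have hΩ'o : ∀ x, IsOpen (Ω' x) := fun x => (P x).symm.isOpen_inter_preimage (hU x)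
  have hΩ'Ω : ∀ x, Ω' x ⊆ Ω x := fun x p hp => ⟨hp.1, (hUO x hp.2).2⟩
  have hΩ' : ∀ x, IsPreLagrangianOn (formIn α (P x)) (formIn η (P x)) (Ω' x) := fun x =>
    (hΩ x).mono (hΩ'o x) (hΩ'Ω x)
  choose V ϖ γ hV hιV hVP hϖs hϖα hϖι hγ using fun x =>
    (hP x).exists_local_retraction hkm (hΩ' x) inter_subset_left
      ⟨(P x).map_source (hP x).mem_source, by
        rw [mem_preimage, (P x).left_inv (hP x).mem_source]
        exact hιU x⟩
  have hVU : ∀ x, V x ⊆ U x := by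
    intro x y hy
    obtain ⟨h1, -, h2, -⟩ := hγ x y hy
    have := (h2 1 (by simp)).2
    rw [h1, mem_preimage, (P x).left_inv (hVP x hy)] at this
    exact this
  have key : ∀ x x', U x' ⊆ (P x).source ∩ O x → ∀ y ∈ V x ∩ V x', ϖ x y = ϖ x' y := by
    rintro x x' h y ⟨hy, hy'⟩
    obtain ⟨a1, a2, a3, a4, a5⟩ := hγ x y hy
    obtain ⟨b1, b2, b3, b4, b5⟩ := hγ x' y hy'
    apply hι.isSmoothEmbedding.isEmbedding.injective
    rw [← a5, ← b5]
    refine retraction_eq_of_contraction (hP x).smooth (hP x').smooth hα (Ω := Ω x) (Ω' := Ω' x')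
      inter_subset_left (hΩ x).contact.isOpen inter_subset_left (hΩ x).contDiffOn ?_ a2
      (fun s hs => hΩ'Ω x (a3 s hs)) a4 b2 b3 b4 ?_
    · intro p hp
      have h1 := h hp.2
      refine ⟨h1.1, (P x).map_source h1.1, ?_⟩
      rw [mem_preimage, (P x).left_inv h1.1]
      exact h1.2
    · rw [a1, b1, (P x).left_inv (hVP x hy), (P x').left_inv (hVP x' hy')]
  have key' : ∀ x x', ∀ y ∈ V x ∩ V x', ϖ x y = ϖ x' y := by
    intro x x' y hy
    rcases hUU x x' ⟨y, hVU x hy.1, hVU x' hy.2⟩ with h | h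
    · exact key x x' h y hy
    · exact (key x' x h y hy.symm).symm
  let ϖ' : M → L := fun y => if h : ∃ x, y ∈ V x then ϖ h.choose y else Classical.arbitrary L
  have hϖ' : ∀ x, ∀ y ∈ V x, ϖ' y = ϖ x y := by
    intro x y hy
    have h : ∃ x, y ∈ V x := ⟨x, hy⟩
    have e : ϖ' y = ϖ h.choose y := dif_pos h
    rw [e]
    exact key' _ _ y ⟨h.choose_spec, hy⟩
  refine ⟨⋃ x, V x, ϖ', isOpen_iUnion hV, fun x => mem_iUnion.mpr ⟨x, hιV x⟩, ?_, fun x => ?_, ?_⟩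
  · intro y hy
    obtain ⟨x, hx⟩ := mem_iUnion.mp hy
    refine (((hϖs x).contMDiffAt ((hV x).mem_nhds hx)).congr_of_eventuallyEq ?_).contMDiffWithinAt
    filter_upwards [(hV x).mem_nhds hx] with y' hy' using hϖ' x y' hy'
  · rw [hϖ' x _ (hιV x), hϖι x x (hιV x)]
  · intro y hy v hv
    obtain ⟨x, hx⟩ := mem_iUnion.mp hy
    refine hϖα x y hx v ?_
    have e : ϖ' =ᶠ[𝓝 y] ϖ x := by
      filter_upwards [(hV x).mem_nhds hx] with y' hy' using hϖ' x y' hy'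
    have e1 := ((hϖs x).contMDiffAt ((hV x).mem_nhds hx)).mdifferentiableAt (by simp)
    have e2 := (e1.hasMFDerivAt.congr_of_eventuallyEq e).mfderiv
    have e3 := congrArg (fun f : EuclideanSpace ℝ (Fin d) →L[ℝ] EuclideanSpace ℝ (Fin k) => f v) e2
    exact e3.symm.trans hv

end Retraction

end ContactNbhd
end

noncomputable section

namespace ContactNbhd

/-! ### The map to the unit cotangent bundle in coordinates -/

section Coordinates

open Set Module

variable {W E : Type*} [NormedAddCommGroup W] [NormedSpace ℝ W]
  [NormedAddCommGroup E] [NormedSpace ℝ E]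

theorem isOpen_setOf_isInvertible {A B : Type*} [NormedAddCommGroup A] [NormedSpace ℝ A]
    [CompleteSpace A] [NormedAddCommGroup B] [NormedSpace ℝ B] :
    IsOpen {f : A →L[ℝ] B | f.IsInvertible} :=
  ContinuousLinearEquiv.isOpen (𝕜 := ℝ) (E := A) (F := B)

/-- A smooth map with injective differential between spaces of the same dimension is a local
diffeomorphism. -/
theorem exists_smooth_local_inverse [FiniteDimensional ℝ W] [FiniteDimensional ℝ E] {f : W → E} {Ω : Set W} (hΩ : IsOpen Ω)
    (hf : ContDiffOn ℝ ∞ f Ω) (hd : ∀ p ∈ Ω, ∀ v, fderiv ℝ f p v = 0 → v = 0)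
    (hdim : finrank ℝ W = finrank ℝ E) {p₀ : W} (hp₀ : p₀ ∈ Ω) :
    ∃ e : OpenPartialHomeomorph W E, p₀ ∈ e.source ∧ e.source ⊆ Ω ∧ (∀ p, e p = f p) ∧
      ContDiffOn ℝ ∞ e.symm e.target := by
  have hinv : ∀ p ∈ Ω, ∃ f' : W ≃L[ℝ] E, HasFDerivAt f (f' : W →L[ℝ] E) p := by
    intro p hp
    obtain ⟨f', hf'⟩ := isInvertible_of_injective (hd p hp) hdim
    refine ⟨f', ?_⟩
    rw [hf']
    exact ((hf.contDiffAt (hΩ.mem_nhds hp)).differentiableAt (by simp)).hasFDerivAt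
  obtain ⟨f', hf'⟩ := hinv p₀ hp₀
  have hf₀ := hf.contDiffAt (hΩ.mem_nhds hp₀)
  let e₀ := hf₀.toOpenPartialHomeomorph f hf' (by simp)
  let e := e₀.restrOpen Ω hΩ
  have hes : e.source = e₀.source ∩ Ω := e₀.restrOpen_source Ω hΩ
  refine ⟨e, ?_, ?_, fun p => rfl, fun y hy => ?_⟩
  · rw [hes]
    exact ⟨hf₀.mem_toOpenPartialHomeomorph_source hf' (by simp), hp₀⟩
  · rw [hes]
    exact inter_subset_right
  · have hy' : e.symm y ∈ Ω := (hes ▸ e.map_target hy).2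
    obtain ⟨g, hg⟩ := hinv _ hy'
    exact (e.contDiffAt_symm hy hg (hf.contDiffAt (hΩ.mem_nhds hy'))).contDiffWithinAt

/-- If a one-form `a` vanishes on the kernel of `DR`, then it is locally of the form `q ∘ DR` with
`q` smooth. -/
theorem exists_quotient_covector [FiniteDimensional ℝ E] {R : W → E} {a : W → W →L[ℝ] ℝ} {Ω : Set W} (hΩ : IsOpen Ω)
    (hR : ContDiffOn ℝ ∞ R Ω) (ha : ContDiffOn ℝ ∞ a Ω)
    (hker : ∀ p ∈ Ω, ∀ v, fderiv ℝ R p v = 0 → a p v = 0) {p₀ : W} (hp₀ : p₀ ∈ Ω)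
    (hsurj : Function.Surjective (fderiv ℝ R p₀)) :
    ∃ (Ω' : Set W) (q : W → E →L[ℝ] ℝ), IsOpen Ω' ∧ p₀ ∈ Ω' ∧ Ω' ⊆ Ω ∧ ContDiffOn ℝ ∞ q Ω' ∧
      ∀ p ∈ Ω', Function.Surjective (fderiv ℝ R p) ∧ a p = (q p).comp (fderiv ℝ R p) := by
  -- A fixed right inverse `B` of `DR(p₀)` remains one for nearby `p` after correction by `(DR(p)
  -- B)⁻¹`, so `q = a B (DR B)⁻¹` is smooth.
  obtain ⟨B, hB⟩ := (fderiv ℝ R p₀).exists_rightInverse_of_surjective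
    (LinearMap.range_eq_top.mpr hsurj)
  have hDR : ContDiffOn ℝ ∞ (fderiv ℝ R) Ω := hR.fderiv_of_isOpen hΩ (by norm_cast)
  let T : W → E →L[ℝ] E := fun p => (fderiv ℝ R p).comp B
  have hT : ContDiffOn ℝ ∞ T Ω := hDR.clm_comp contDiffOn_const
  let Ω' : Set W := Ω ∩ T ⁻¹' {f | f.IsInvertible}
  have hΩ' : IsOpen Ω' := hT.continuousOn.isOpen_inter_preimage hΩ isOpen_setOf_isInvertible
  refine ⟨Ω', fun p => ((a p).comp B).comp (T p).inverse, hΩ', ⟨hp₀, ?_⟩, inter_subset_left, ?_,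
    fun p hp => ?_⟩
  · change (T p₀).IsInvertible
    exact ⟨ContinuousLinearEquiv.refl ℝ E, by rw [show T p₀ = _ from hB]; rfl⟩
  · refine ((ha.mono inter_subset_left).clm_comp contDiffOn_const).clm_comp fun p hp => ?_
    exact (ContinuousLinearMap.IsInvertible.contDiffAt_map_inverse (n := ∞)
      hp.2).comp_contDiffWithinAt p ((hT.mono inter_subset_left) p hp)
  · have hTT : ∀ e, fderiv ℝ R p (B ((T p).inverse e)) = e := fun e =>
      ContinuousLinearMap.IsInvertible.self_apply_inverse hp.2 e
    refine ⟨fun e => ⟨_, hTT e⟩, ContinuousLinearMap.ext fun v => ?_⟩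
    have h1 := hker p hp.1 (v - B ((T p).inverse (fderiv ℝ R p v))) (by
      rw [map_sub, hTT, sub_self])
    rw [map_sub, sub_eq_zero] at h1
    exact h1

/-- If the form `q ∘ DR` is contact, then `(R, [q])` is an immersion. -/
theorem eq_zero_of_fderiv_quotient {R : W → E} {a : W → W →L[ℝ] ℝ} {q : W → E →L[ℝ] ℝ} {Ω : Set W}
    (ha : IsContactOn a Ω) (hR : ContDiffOn ℝ ∞ R Ω) (hq : ContDiffOn ℝ ∞ q Ω)
    (haq : ∀ p ∈ Ω, a p = (q p).comp (fderiv ℝ R p)) {p v : W} (hp : p ∈ Ω)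
    (hv : fderiv ℝ R p v = 0) {c : ℝ} (hc : fderiv ℝ q p v = c • q p) : v = 0 := by
  have hΩ := ha.isOpen.mem_nhds hp
  have hqd := ((hq.contDiffAt hΩ).differentiableAt (by simp)).hasFDerivAt
  have hR2 : HasFDerivAt (fderiv ℝ R) (fderiv ℝ (fderiv ℝ R) p) p :=
    (((hR.contDiffAt hΩ).fderiv_right (m := ∞) (by norm_cast)).differentiableAt
      (by simp)).hasFDerivAt
  have hsymm : IsSymmSndFDerivAt ℝ R p := (hR.contDiffAt hΩ).isSymmSndFDerivAt
    (by rw [minSmoothness_of_isRCLikeNormedField]; exact WithTop.coe_le_coe.mpr le_top)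
  have hd : ∀ v w, fderiv ℝ a p v w =
      q p (fderiv ℝ (fderiv ℝ R) p v w) + fderiv ℝ q p v (fderiv ℝ R p w) := by
    intro v w
    have h1 : a =ᶠ[𝓝 p] fun p => (q p).comp (fderiv ℝ R p) := by
      filter_upwards [hΩ] with p hp using haq p hp
    rw [h1.fderiv_eq, (hqd.clm_comp hR2).fderiv]
    simp
  -- For `w` in `ker a`, symmetry of `D²R` and `DR v = 0` leave `da(v, w) = Dq(v)(DR w) = c q(DR w)
  -- = c a(w) = 0`.
  refine ha.nondegenerate p hp v (by rw [haq p hp]; simp [hv]) fun w hw => ?_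
  rw [dForm_apply, hd, hd, hsymm v w, hv, hc]
  rw [haq p hp] at hw
  have hw' : q p (fderiv ℝ R p w) = 0 := hw
  simp [hw']

end Coordinates

/-! ### Affine coordinates on the rays. -/

section AffineChart

open Set Module

variable {W : Type*} [NormedAddCommGroup W] [NormedSpace ℝ W] {m : ℕ}

/-- The affine coordinates `(x, (q_j / |q_i|)_{j ≠ i})` of the ray of the covector `q` at `x`, if
`q_i` has the sign `s`. -/
def affineCoord (i : Fin (m + 1)) (s : ℤˣ) (R : W → EuclideanSpace ℝ (Fin (m + 1)))
    (q : W → EuclideanSpace ℝ (Fin (m + 1)) →L[ℝ] ℝ) (p : W) :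
    EuclideanSpace ℝ (Fin (m + 1)) × EuclideanSpace ℝ (Fin m) :=
  (R p, WithLp.toLp 2 fun j => q p (EuclideanSpace.single (i.succAbove j) 1) /
    (((s : ℤ) : ℝ) * q p (EuclideanSpace.single i 1)))

theorem contDiffOn_affineCoord {i : Fin (m + 1)} {s : ℤˣ} {R : W → EuclideanSpace ℝ (Fin (m + 1))}
    {q : W → EuclideanSpace ℝ (Fin (m + 1)) →L[ℝ] ℝ} {Ω : Set W} (hR : ContDiffOn ℝ ∞ R Ω)
    (hq : ContDiffOn ℝ ∞ q Ω)
    (hpos : ∀ p ∈ Ω, 0 < ((s : ℤ) : ℝ) * q p (EuclideanSpace.single i 1)) :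
    ContDiffOn ℝ ∞ (affineCoord i s R q) Ω := by
  refine hR.prodMk ?_
  rw [contDiffOn_euclidean]
  intro j
  exact (hq.clm_apply contDiffOn_const).div
    (contDiffOn_const.mul (hq.clm_apply contDiffOn_const)) fun p hp => (hpos p hp).ne'

/-- If the derivatives of all ratios `q_j / |q_i|` vanish along `v`, then `Dq(v)` is a multiple of
`q`, with factor `Dq(v)_i / q_i`; this is the projective form of the immersion criterion. -/
theorem eq_zero_of_fderiv_affineCoord {i : Fin (m + 1)} {s : ℤˣ}
    {R : W → EuclideanSpace ℝ (Fin (m + 1))} {a : W → W →L[ℝ] ℝ}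
    {q : W → EuclideanSpace ℝ (Fin (m + 1)) →L[ℝ] ℝ} {Ω : Set W} (ha : IsContactOn a Ω)
    (hR : ContDiffOn ℝ ∞ R Ω) (hq : ContDiffOn ℝ ∞ q Ω)
    (haq : ∀ p ∈ Ω, a p = (q p).comp (fderiv ℝ R p))
    (hpos : ∀ p ∈ Ω, 0 < ((s : ℤ) : ℝ) * q p (EuclideanSpace.single i 1)) {p : W} (hp : p ∈ Ω)
    {v : W} (hv : fderiv ℝ (affineCoord i s R q) p v = 0) : v = 0 := by
  have hΩ := ha.isOpen.mem_nhds hp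
  have hqd := ((hq.contDiffAt hΩ).differentiableAt (by simp)).hasFDerivAt
  have hA := (((contDiffOn_affineCoord hR hq hpos).contDiffAt hΩ).differentiableAt
    (by simp)).hasFDerivAt
  have hRv : fderiv ℝ R p v = 0 := by
    have h1 : HasFDerivAt R _ p := hA.fst
    rw [h1.fderiv]
    simp [hv]
  let e : Fin (m + 1) → EuclideanSpace ℝ (Fin (m + 1)) := fun l => EuclideanSpace.single l 1
  have hqe (l : Fin (m + 1)) : HasFDerivAt (fun p => q p (e l)) ((fderiv ℝ q p).flip (e l)) p := by
    simpa using hqd.clm_apply (hasFDerivAt_const (e l) p)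
  have hne : ((s : ℤ) : ℝ) * q p (e i) ≠ 0 := (hpos p hp).ne'
  have hs : ((s : ℤ) : ℝ) ≠ 0 := left_ne_zero_of_mul hne
  have hqi : q p (e i) ≠ 0 := right_ne_zero_of_mul hne
  refine eq_zero_of_fderiv_quotient (c := fderiv ℝ q p v (e i) / q p (e i)) ha hR hq haq hp hRv ?_
  have key : ∀ l, fderiv ℝ q p v (e l) = fderiv ℝ q p v (e i) / q p (e i) * q p (e l) := by
    intro l
    refine Fin.succAboveCases i ?_ (fun j => ?_) l
    · rw [div_mul_cancel₀ _ hqi]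
    · have h1 := (((EuclideanSpace.proj j : EuclideanSpace ℝ (Fin m) →L[ℝ] ℝ).comp
        (ContinuousLinearMap.snd ℝ (EuclideanSpace ℝ (Fin (m + 1)))
          (EuclideanSpace ℝ (Fin m)))).hasFDerivAt.comp p hA)
      have h2 : HasFDerivAt (fun p => q p (e (i.succAbove j)) / (((s : ℤ) : ℝ) * q p (e i))) _ p :=
        h1
      have h3 := h2.mul ((hqe i).const_mul ((s : ℤ) : ℝ))
      have h4 : (fun p => q p (e (i.succAbove j))) =ᶠ[𝓝 p]
          (fun p => q p (e (i.succAbove j)) / (((s : ℤ) : ℝ) * q p (e i))) *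
            fun p => ((s : ℤ) : ℝ) * q p (e i) := by
        filter_upwards [hΩ] with p' hp'
        exact (div_mul_cancel₀ _ (hpos p' hp').ne').symm
      have h5 := congrArg (fun f : W →L[ℝ] ℝ => f v)
        ((h3.congr_of_eventuallyEq h4).unique (hqe (i.succAbove j)))
      simp [hv] at h5
      rw [← h5]
      field_simp
  have hexp (l : EuclideanSpace ℝ (Fin (m + 1)) →L[ℝ] ℝ) (w : EuclideanSpace ℝ (Fin (m + 1))) :
      l w = ∑ j, w j * l (e j) := by
    conv_lhs => rw [show w = ∑ j, w j • e j by
      ext j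
      simp [e, Pi.single_apply]]
    simp
  ext w
  rw [hexp (fderiv ℝ q p v), hexp _ w]
  refine Finset.sum_congr rfl fun l _ => ?_
  rw [key l]
  rfl

end AffineChart

end ContactNbhd
end

noncomputable section

namespace ContactNbhd

/-! ### The map to the unit cotangent bundle -/

section Lift

open Set Module

variable {m d : ℕ} {L : Type*} [TopologicalSpace L]
  [ChartedSpace (EuclideanSpace ℝ (Fin (m + 1))) L]
  {M : Type*} [TopologicalSpace M] [ChartedSpace (EuclideanSpace ℝ (Fin d)) M]

theorem nonempty_covector_ne_zero (x : L) :
    Nonempty {p : TangentSpace (𝓡 (m + 1)) x →L[ℝ] ℝ // p ≠ 0} := by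
  refine ⟨⟨(EuclideanSpace.proj 0 : EuclideanSpace ℝ (Fin (m + 1)) →L[ℝ] ℝ), fun h => ?_⟩⟩
  have := congrArg (fun p : EuclideanSpace ℝ (Fin (m + 1)) →L[ℝ] ℝ =>
    p (EuclideanSpace.single 0 1)) h
  change (EuclideanSpace.single (0 : Fin (m + 1)) (1 : ℝ)) 0 = 0 at this
  simp at this

/-- The nonzero covector `p` at `ϖ y` such that `α_y = p ∘ dϖ_y` (arbitrary if there is none). -/
def quotientCovector (α : CovectorField d M) (ϖ : M → L) (y : M) :
    {p : TangentSpace (𝓡 (m + 1)) (ϖ y) →L[ℝ] ℝ // p ≠ 0} :=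
  @Classical.epsilon _ (nonempty_covector_ne_zero (ϖ y))
    fun p => ∀ v, α y v = p.1 (mfderiv (𝓡 d) (𝓡 (m + 1)) ϖ y v)

/-- Surjectivity of `dϖ` makes the covector unique, so the arbitrary choice in the definition is
harmless. -/
theorem quotientCovector_eq {α : CovectorField d M} {ϖ : M → L} {y : M} (hα : α y ≠ 0)
    (hsurj : Function.Surjective (mfderiv (𝓡 d) (𝓡 (m + 1)) ϖ y))
    {p : TangentSpace (𝓡 (m + 1)) (ϖ y) →L[ℝ] ℝ}
    (hp : ∀ v, α y v = p (mfderiv (𝓡 d) (𝓡 (m + 1)) ϖ y v)) :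
    (quotientCovector α ϖ y).1 = p := by
  have hp0 : p ≠ 0 := by
    rintro rfl
    exact hα (ContinuousLinearMap.ext hp)
  have h := Classical.epsilon_spec_aux (nonempty_covector_ne_zero (ϖ y))
    (fun p => ∀ v, α y v = p.1 (mfderiv (𝓡 d) (𝓡 (m + 1)) ϖ y v)) ⟨⟨p, hp0⟩, hp⟩
  refine ContinuousLinearMap.ext fun w => ?_
  obtain ⟨v, rfl⟩ := hsurj w
  exact (h v).symm.trans (hp v)

/-- The map sending `y` to the ray of the covector `p` at `ϖ y` such that `α_y = p ∘ dϖ_y`. -/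
def contactLift (α : CovectorField d M) (ϖ : M → L) (y : M) : SphereCotangent m L :=
  SphereCotangent.mk' (ϖ y) (quotientCovector α ϖ y).1 (quotientCovector α ϖ y).2

theorem mfderiv_chartAt_symmL [IsManifold (𝓡 (m + 1)) ∞ L] {x₀ x : L}
    (hx : x ∈ (chartAt (EuclideanSpace ℝ (Fin (m + 1))) x₀).source)
    (w : EuclideanSpace ℝ (Fin (m + 1))) :
    mfderiv (𝓡 (m + 1)) (𝓡 (m + 1)) (chartAt (EuclideanSpace ℝ (Fin (m + 1))) x₀) x
      ((SphereCotangent.triv (m := m) x₀).symmL ℝ x w) = w := by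
  have hx' : x ∈ (SphereCotangent.triv (m := m) x₀).baseSet := by simpa using hx
  have h := (SphereCotangent.triv (m := m) x₀).continuousLinearMapAt_symmL (R := ℝ) hx' w
  have := IsManifold.of_le (I := 𝓡 (m + 1)) (M := L) (m := 1) (n := ∞) (by norm_cast)
  rw [TangentBundle.continuousLinearMapAt_trivializationAt hx] at h
  convert! h using 2

variable [IsManifold (𝓡 d) ∞ M]

/-- If `ker dϖ ⊆ ker α`, then locally `α = q ∘ d(c ∘ ϖ)` for a chart `c` of `L`, with `q` smooth. -/
theorem exists_local_quotient {α : CovectorField d M} (hα : IsContactForm α) {V : Set M}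
    {ϖ : M → L} (hV : IsOpen V) (hϖ : ContMDiffOn (𝓡 d) (𝓡 (m + 1)) ∞ ϖ V)
    (hker : ∀ y ∈ V, ∀ v, mfderiv (𝓡 d) (𝓡 (m + 1)) ϖ y v = 0 → α y v = 0) {y₀ : M}
    (hy₀ : y₀ ∈ V) (hsurj : Function.Surjective (mfderiv (𝓡 d) (𝓡 (m + 1)) ϖ y₀))
    {P : OpenPartialHomeomorph M (EuclideanSpace ℝ (Fin d))} (hP : IsSmoothChart (d := d) P)
    (hy₀P : y₀ ∈ P.source)
    {c : OpenPartialHomeomorph L (EuclideanSpace ℝ (Fin (m + 1)))}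
    (hc : IsSmoothChart (d := m + 1) c) (hy₀c : ϖ y₀ ∈ c.source) :
    ∃ (Ω : Set (EuclideanSpace ℝ (Fin d)))
      (q : EuclideanSpace ℝ (Fin d) → EuclideanSpace ℝ (Fin (m + 1)) →L[ℝ] ℝ),
      IsOpen Ω ∧ P y₀ ∈ Ω ∧ Ω ⊆ P.target ∧ (∀ p ∈ Ω, P.symm p ∈ V ∧ ϖ (P.symm p) ∈ c.source) ∧
      ContDiffOn ℝ ∞ q Ω ∧ ContDiffOn ℝ ∞ (c ∘ ϖ ∘ P.symm) Ω ∧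
      (∀ p ∈ Ω, formIn α P p = (q p).comp (fderiv ℝ (c ∘ ϖ ∘ P.symm) p)) ∧
      ∀ y ∈ P.source, P y ∈ Ω →
        Function.Surjective (mfderiv (𝓡 d) (𝓡 (m + 1)) ϖ y) ∧
        ∀ v, α y v = q (P y) (mfderiv (𝓡 (m + 1)) 𝓘(ℝ, EuclideanSpace ℝ (Fin (m + 1))) c (ϖ y)
          (mfderiv (𝓡 d) (𝓡 (m + 1)) ϖ y v)) := by
  have hV' : IsOpen (V ∩ ϖ ⁻¹' c.source) := hϖ.continuousOn.isOpen_inter_preimage hV c.open_source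
  let Ω : Set (EuclideanSpace ℝ (Fin d)) := P.target ∩ P.symm ⁻¹' (V ∩ ϖ ⁻¹' c.source)
  have hΩ : IsOpen Ω := P.isOpen_inter_preimage_symm hV'
  let R := c ∘ ϖ ∘ P.symm
  have hR : ContDiffOn ℝ ∞ R Ω := by
    rw [← contMDiffOn_iff_contDiffOn]
    exact hc.contMDiffOn.comp (hϖ.comp (hP.contMDiffOn_symm.mono fun p hp => hp.1)
      fun p hp => hp.2.1) fun p hp => hp.2.2
  have hDR : ∀ p ∈ Ω, ∀ v, fderiv ℝ R p v =
      mfderiv (𝓡 (m + 1)) 𝓘(ℝ, EuclideanSpace ℝ (Fin (m + 1))) c (ϖ (P.symm p))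
        (mfderiv (𝓡 d) (𝓡 (m + 1)) ϖ (P.symm p)
          (mfderiv 𝓘(ℝ, EuclideanSpace ℝ (Fin d)) (𝓡 d) P.symm p v)) := by
    intro p hp v
    have h1 := ((hR.contDiffAt (hΩ.mem_nhds hp)).differentiableAt
      (by simp)).hasFDerivAt.hasMFDerivAt
    have h2 := (hP.mdifferentiableAt_symm hp.1).hasMFDerivAt
    have h3 := ((hϖ.contMDiffAt (hV.mem_nhds hp.2.1)).mdifferentiableAt (by simp)).hasMFDerivAt
    have h4 := (hc.mdifferentiableAt hp.2.2).hasMFDerivAt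
    have h5 := h4.comp p (h3.comp p h2)
    exact congrArg (fun f : EuclideanSpace ℝ (Fin d) →L[ℝ] EuclideanSpace ℝ (Fin (m + 1)) => f v)
      (hasMFDerivAt_unique h1 h5)
  have hDR' : ∀ y ∈ P.source, P y ∈ Ω → ∀ v, fderiv ℝ R (P y)
      (mfderiv (𝓡 d) 𝓘(ℝ, EuclideanSpace ℝ (Fin d)) P y v) =
      mfderiv (𝓡 (m + 1)) 𝓘(ℝ, EuclideanSpace ℝ (Fin (m + 1))) c (ϖ y)
        (mfderiv (𝓡 d) (𝓡 (m + 1)) ϖ y v) := by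
    intro y hy
    obtain ⟨p, hp, rfl⟩ : ∃ p ∈ P.target, P.symm p = y := ⟨P y, P.map_source hy, P.left_inv hy⟩
    rw [P.right_inv hp]
    intro hpΩ v
    refine (hDR p hpΩ _).trans ?_
    exact congrArg (fun w => mfderiv (𝓡 (m + 1)) 𝓘(ℝ, EuclideanSpace ℝ (Fin (m + 1))) c (ϖ (P.symm p))
        (mfderiv (𝓡 d) (𝓡 (m + 1)) ϖ (P.symm p) w)) (hP.mfderiv_symm_mfderiv hp v)
  have hy₀Ω : P y₀ ∈ Ω := ⟨P.map_source hy₀P, by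
    change P.symm (P y₀) ∈ V ∩ ϖ ⁻¹' c.source
    rw [P.left_inv hy₀P]; exact ⟨hy₀, hy₀c⟩⟩
  have ha := (hα.isContactOn_formIn hP).mono hΩ inter_subset_left
  obtain ⟨Ω', q, hΩ', hp₀, hsub, hq, hΩq⟩ := exists_quotient_covector hΩ hR ha.contDiffOn
    (fun p hp v hv => hker _ hp.2.1 _ (hc.mfderiv_injective hp.2.2 ((hDR p hp v).symm.trans hv)))
    hy₀Ω (fun w => by
      obtain ⟨w', hw'⟩ := hc.mfderiv_surjective hy₀c w
      obtain ⟨v, rfl⟩ := hsurj w'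
      exact ⟨_, (hDR' y₀ hy₀P hy₀Ω v).trans hw'⟩)
  refine ⟨Ω', q, hΩ', hp₀, fun p hp => (hsub hp).1, fun p hp => (hsub hp).2, hq, hR.mono hsub,
    fun p hp => (hΩq p hp).2, fun y hy hyΩ => ⟨fun w => ?_, fun v => ?_⟩⟩
  · obtain ⟨u, hu⟩ := (hΩq _ hyΩ).1
      (mfderiv (𝓡 (m + 1)) 𝓘(ℝ, EuclideanSpace ℝ (Fin (m + 1))) c (ϖ y) w)
    obtain ⟨v, rfl⟩ := hP.mfderiv_surjective hy u
    refine ⟨v, ?_⟩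
    have h1 := (hDR' y hy (hsub hyΩ) v).symm.trans hu
    have hyc : ϖ y ∈ c.source := by
      have := (hsub hyΩ).2.2
      change ϖ (P.symm (P y)) ∈ c.source at this
      rwa [P.left_inv hy] at this
    refine sub_eq_zero.mp (hc.mfderiv_injective hyc ?_)
    rw [map_sub, h1]
    exact sub_self _
  · refine (formIn_mfderiv α hP hy v).symm.trans ?_
    refine (congrArg (fun f : EuclideanSpace ℝ (Fin d) →L[ℝ] ℝ => f
      (mfderiv (𝓡 d) 𝓘(ℝ, EuclideanSpace ℝ (Fin d)) P y v)) (hΩq _ hyΩ).2).trans ?_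
    exact congrArg (q (P y)) (hDR' y hy (hsub hyΩ) v)

end Lift

end ContactNbhd
end

noncomputable section

namespace ContactNbhd

/-! ### The lift to the unit cotangent bundle is a local diffeomorphism. -/

section LocalDiffeo

open Set Module

variable {m d : ℕ} {L : Type*} [TopologicalSpace L]
  [ChartedSpace (EuclideanSpace ℝ (Fin (m + 1))) L] [IsManifold (𝓡 (m + 1)) ∞ L]

/-- The affine charts of `ST^*L`, as local homeomorphisms. -/
def SphereCotangent.affineChart (x₀ : L) (i : Fin (m + 1)) (s : ℤˣ) :
    OpenPartialHomeomorph (SphereCotangent m L)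
      (ModelProd (EuclideanSpace ℝ (Fin (m + 1))) (EuclideanSpace ℝ (Fin m))) :=
  (SphereCotangent.core m L).openPartialHomeomorph (SphereCotangent.chart x₀ i s) ⟨_, _, _, rfl⟩

theorem SphereCotangent.affineChart_mem_maximalAtlas (x₀ : L) (i : Fin (m + 1)) (s : ℤˣ) :
    SphereCotangent.affineChart x₀ i s ∈
      IsManifold.maximalAtlas ((𝓡 (m + 1)).prod (𝓡 m)) ∞ (SphereCotangent m L) := by
  refine IsManifold.subset_maximalAtlas ?_
  exact mem_iUnion₂.mpr ⟨SphereCotangent.chart x₀ i s, ⟨_, _, _, rfl⟩, rfl⟩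

/-- Homogeneous coordinates come from a chosen representative of the ray, so they are determined
only up to the positive factor `a`; signs and ratios do not see it. -/
theorem SphereCotangent.homCoord_mk'_of_comp {x₀ x : L}
    (hx : x ∈ (chartAt (EuclideanSpace ℝ (Fin (m + 1))) x₀).source)
    {p : TangentSpace (𝓡 (m + 1)) x →L[ℝ] ℝ} (hp : p ≠ 0)
    {q : EuclideanSpace ℝ (Fin (m + 1)) →L[ℝ] ℝ}
    (hq : ∀ v, p v = q (mfderiv (𝓡 (m + 1)) (𝓡 (m + 1))
      (chartAt (EuclideanSpace ℝ (Fin (m + 1))) x₀) x v)) :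
    ∃ a : ℝ, 0 < a ∧ ∀ i, homCoord x₀ (mk' x p hp) i = a * q (EuclideanSpace.single i 1) := by
  obtain ⟨a, ha, h⟩ := homCoord_mk' x₀ x p hp
  refine ⟨a, ha, fun i => ?_⟩
  rw [h]
  refine congrArg (a * ·) ((hq _).trans (congrArg q (mfderiv_chartAt_symmL hx _)))

theorem SphereCotangent.mk'_mem_chart_source {x₀ x : L}
    (hx : x ∈ (chartAt (EuclideanSpace ℝ (Fin (m + 1))) x₀).source)
    {p : TangentSpace (𝓡 (m + 1)) x →L[ℝ] ℝ} (hp : p ≠ 0)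
    {q : EuclideanSpace ℝ (Fin (m + 1)) →L[ℝ] ℝ}
    (hq : ∀ v, p v = q (mfderiv (𝓡 (m + 1)) (𝓡 (m + 1))
      (chartAt (EuclideanSpace ℝ (Fin (m + 1))) x₀) x v)) {i : Fin (m + 1)} {s : ℤˣ}
    (hs : 0 < ((s : ℤ) : ℝ) * q (EuclideanSpace.single i 1)) :
    mk' x p hp ∈ (chart x₀ i s).source := by
  obtain ⟨a, ha, h⟩ := homCoord_mk'_of_comp hx hp hq
  refine ⟨hx, ?_⟩
  rw [h, mul_left_comm]
  exact mul_pos ha hs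

theorem SphereCotangent.chart_mk' {x₀ x : L}
    (hx : x ∈ (chartAt (EuclideanSpace ℝ (Fin (m + 1))) x₀).source)
    {p : TangentSpace (𝓡 (m + 1)) x →L[ℝ] ℝ} (hp : p ≠ 0)
    {q : EuclideanSpace ℝ (Fin (m + 1)) →L[ℝ] ℝ}
    (hq : ∀ v, p v = q (mfderiv (𝓡 (m + 1)) (𝓡 (m + 1))
      (chartAt (EuclideanSpace ℝ (Fin (m + 1))) x₀) x v)) (i : Fin (m + 1)) (s : ℤˣ) :
    chart x₀ i s (mk' x p hp) = (chartAt (EuclideanSpace ℝ (Fin (m + 1))) x₀ x,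
      WithLp.toLp 2 fun j => q (EuclideanSpace.single (i.succAbove j) 1) /
        (((s : ℤ) : ℝ) * q (EuclideanSpace.single i 1))) := by
  obtain ⟨a, ha, h⟩ := homCoord_mk'_of_comp hx hp hq
  refine Prod.ext rfl ?_
  ext j
  simp only [chart, h]
  rw [mul_left_comm, mul_div_mul_left _ _ ha.ne']

variable {M : Type*} [TopologicalSpace M] [ChartedSpace (EuclideanSpace ℝ (Fin d)) M]
  [IsManifold (𝓡 d) ∞ M]

/-- If `ϖ` is a submersion at `y₀` whose fibres are Legendrian, then the induced map to `ST^*L` is a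
diffeomorphism near `y₀`. -/
theorem exists_contactLift_diffeo {α : CovectorField d M} (hα : IsContactForm α)
    (hd : d = 2 * m + 1) {V : Set M}
    {ϖ : M → L} (hV : IsOpen V) (hϖ : ContMDiffOn (𝓡 d) (𝓡 (m + 1)) ∞ ϖ V)
    (hker : ∀ y ∈ V, ∀ v, mfderiv (𝓡 d) (𝓡 (m + 1)) ϖ y v = 0 → α y v = 0) {y₀ : M}
    (hy₀ : y₀ ∈ V) (hsurj : Function.Surjective (mfderiv (𝓡 d) (𝓡 (m + 1)) ϖ y₀)) :
    ∃ E : OpenPartialHomeomorph M (SphereCotangent m L), y₀ ∈ E.source ∧ E.source ⊆ V ∧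
      (∀ y ∈ E.source, E y = contactLift α ϖ y ∧
        ∀ v, α y v = (quotientCovector α ϖ y).1 (mfderiv (𝓡 d) (𝓡 (m + 1)) ϖ y v)) ∧
      ContMDiffOn (𝓡 d) ((𝓡 (m + 1)).prod (𝓡 m)) ∞ E E.source ∧
      ContMDiffOn ((𝓡 (m + 1)).prod (𝓡 m)) (𝓡 d) ∞ E.symm E.target := by
  let P := chartAt (EuclideanSpace ℝ (Fin d)) y₀
  let x₀ := ϖ y₀
  let c := chartAt (EuclideanSpace ℝ (Fin (m + 1))) x₀
  have hP : IsSmoothChart (d := d) P := isSmoothChart_chartAt y₀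
  have hy₀P : y₀ ∈ P.source := mem_chart_source _ y₀
  have hy₀c : ϖ y₀ ∈ c.source := mem_chart_source _ x₀
  obtain ⟨Ω, q, hΩ, hp₀, hΩP, hΩV, hq, hR, haq, hΩy⟩ := exists_local_quotient hα hV hϖ hker hy₀
    hsurj hP hy₀P (isSmoothChart_chartAt x₀) hy₀c
  have hquot : ∀ y ∈ P.source, P y ∈ Ω → ∀ v, (quotientCovector α ϖ y).1 v =
      q (P y) (mfderiv (𝓡 (m + 1)) (𝓡 (m + 1)) c (ϖ y) v) := by
    intro y hy hyΩ v
    have h := quotientCovector_eq (hα.ne_zero y) (hΩy y hy hyΩ).1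
      (p := (q (P y)).comp (mfderiv (𝓡 (m + 1)) (𝓡 (m + 1)) c (ϖ y))) (hΩy y hy hyΩ).2
    exact congrArg (fun f : TangentSpace (𝓡 (m + 1)) (ϖ y) →L[ℝ] ℝ => f v) h
  have hy₀' := hquot y₀ hy₀P hp₀
  obtain ⟨i, s, his⟩ : ∃ (i : Fin (m + 1)) (s : ℤˣ),
      0 < ((s : ℤ) : ℝ) * q (P y₀) (EuclideanSpace.single i 1) := by
    obtain ⟨i, hi⟩ := SphereCotangent.exists_coeff_ne_zero hy₀c (quotientCovector α ϖ y₀).2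
    have h : SphereCotangent.coeff x₀ (ϖ y₀) (quotientCovector α ϖ y₀).1 i =
        q (P y₀) (EuclideanSpace.single i 1) :=
      (hy₀' _).trans (congrArg (q (P y₀)) (mfderiv_chartAt_symmL hy₀c _))
    rw [h] at hi
    rcases lt_or_gt_of_ne hi with h | h
    · exact ⟨i, -1, by simpa using h⟩
    · exact ⟨i, 1, by simpa using h⟩
  let R := c ∘ ϖ ∘ P.symm
  let Ω' := Ω ∩ (fun p => ((s : ℤ) : ℝ) * q p (EuclideanSpace.single i 1)) ⁻¹' Ioi 0
  have hΩ' : IsOpen Ω' := (continuousOn_const.mul (hq.continuousOn.clm_apply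
    continuousOn_const)).isOpen_inter_preimage hΩ isOpen_Ioi
  have hsub : Ω' ⊆ Ω := inter_subset_left
  have hA := contDiffOn_affineCoord (hR.mono hsub) (hq.mono hsub) (fun p hp => hp.2)
  obtain ⟨e, he₀, heΩ, he, hes⟩ := exists_smooth_local_inverse hΩ' hA
    (fun p hp v hv => eq_zero_of_fderiv_affineCoord
      ((hα.isContactOn_formIn hP).mono hΩ' (hsub.trans hΩP)) (hR.mono hsub) (hq.mono hsub)
      (fun p hp => haq p hp.1) (fun p hp => hp.2) hp hv)
    (by simp [hd]; ring) (p₀ := P y₀) ⟨hp₀, his⟩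
  let Q := SphereCotangent.affineChart x₀ i s
  let e' : OpenPartialHomeomorph (EuclideanSpace ℝ (Fin d))
    (ModelProd (EuclideanSpace ℝ (Fin (m + 1))) (EuclideanSpace ℝ (Fin m))) := e
  have hQ : ∀ y ∈ P.source, P y ∈ e.source → contactLift α ϖ y ∈ Q.source ∧
      Q (contactLift α ϖ y) = e' (P y) := by
    intro y hy hye
    have h1 := heΩ hye
    have hyc : ϖ y ∈ c.source := by
      have := (hΩV _ h1.1).2
      rwa [P.left_inv hy] at this
    have h2 := hquot y hy h1.1
    refine ⟨SphereCotangent.mk'_mem_chart_source hyc _ h2 h1.2,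
      (SphereCotangent.chart_mk' hyc _ h2 i s).trans ?_⟩
    refine Eq.trans ?_ (he (P y)).symm
    refine Prod.ext ?_ rfl
    exact congrArg (fun z => c (ϖ z)) (P.left_inv hy).symm
  let E := P.trans (e'.trans Q.symm)
  -- The target condition for the affine chart is automatic, because the point is the image of
  -- `contactLift α ϖ y`.
  have hE : ∀ y, y ∈ E.source ↔ y ∈ P.source ∧ P y ∈ e.source := by
    intro y
    have h : y ∈ E.source ↔ y ∈ P.source ∧ P y ∈ e.source ∧ e' (P y) ∈ Q.target := by
      simp only [E, OpenPartialHomeomorph.trans_source, mem_inter_iff, mem_preimage,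
        OpenPartialHomeomorph.symm_source, e']
    rw [h]
    refine ⟨fun h => ⟨h.1, h.2.1⟩, fun h => ⟨h.1, h.2, ?_⟩⟩
    rw [← (hQ y h.1 h.2).2]
    exact Q.map_source (hQ y h.1 h.2).1
  have he' : ContMDiffOn (𝓡 d) ((𝓡 (m + 1)).prod (𝓡 m)) ∞ e' e'.source := by
    have h1 : ContDiffOn ℝ ∞ e e.source := (hA.mono heΩ).congr fun p _ => he p
    have h2 := contMDiffOn_iff_contDiffOn.mpr h1
    rw [modelWithCornersSelf_prod] at h2
    exact h2
  have hes' : ContMDiffOn ((𝓡 (m + 1)).prod (𝓡 m)) (𝓡 d) ∞ e'.symm e'.target := by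
    have h2 := contMDiffOn_iff_contDiffOn.mpr hes
    rw [modelWithCornersSelf_prod] at h2
    exact h2
  have hQs := SphereCotangent.affineChart_mem_maximalAtlas x₀ i s
  refine ⟨E, (hE y₀).mpr ⟨hy₀P, he₀⟩, ?_, ?_, ?_, ?_⟩
  · intro y hy
    obtain ⟨hy, hye⟩ := (hE y).mp hy
    have := (hΩV _ (heΩ hye).1).1
    rwa [P.left_inv hy] at this
  · intro y hy
    obtain ⟨hy, hye⟩ := (hE y).mp hy
    refine ⟨?_, fun v => ?_⟩
    · change Q.symm (e' (P y)) = _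
      rw [← (hQ y hy hye).2, Q.left_inv (hQ y hy hye).1]
    · rw [hquot y hy (heΩ hye).1]
      exact (hΩy y hy (heΩ hye).1).2 v
  · refine (contMDiffOn_symm_of_mem_maximalAtlas hQs).comp (he'.comp (hP.contMDiffOn.mono ?_) ?_) ?_
    · exact fun y hy => hy.1
    · exact fun y hy => hy.2.1
    · exact fun y hy => hy.2.2
  · refine hP.contMDiffOn_symm.comp (hes'.comp
      ((contMDiffOn_of_mem_maximalAtlas hQs).mono ?_) ?_) ?_
    · exact fun y hy => hy.1.1
    · exact fun y hy => hy.1.2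
    · exact fun y hy => hy.2

end LocalDiffeo

end ContactNbhd
end

noncomputable section

namespace ContactNbhd

/-! ### Injectivity near the submanifold and gluing of the local inverses. -/

section Neighborhood

open Set

variable {m d : ℕ} {L : Type*} [TopologicalSpace L]
  [ChartedSpace (EuclideanSpace ℝ (Fin (m + 1))) L]
  {M : Type*} [TopologicalSpace M] [ChartedSpace (EuclideanSpace ℝ (Fin d)) M]

theorem mfderiv_mfderiv_of_retraction {V : Set M} {ϖ : M → L} (hV : IsOpen V)
    (hϖ : ContMDiffOn (𝓡 d) (𝓡 (m + 1)) ∞ ϖ V) {ι : L → M}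
    (hι : ContMDiff (𝓡 (m + 1)) (𝓡 d) ∞ ι) (hret : ∀ x, ϖ (ι x) = x) {x : L} (hx : ι x ∈ V)
    (v : EuclideanSpace ℝ (Fin (m + 1))) :
    (mfderiv (𝓡 d) (𝓡 (m + 1)) ϖ (ι x) (mfderiv (𝓡 (m + 1)) (𝓡 d) ι x v) :
      EuclideanSpace ℝ (Fin (m + 1))) = v := by
  have h1 := ((hϖ.contMDiffAt (hV.mem_nhds hx)).mdifferentiableAt (by simp)).hasMFDerivAt
  have h2 := ((hι x).mdifferentiableAt (by simp)).hasMFDerivAt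
  have h3 := h1.comp x h2
  have h4 : HasMFDerivAt (𝓡 (m + 1)) (𝓡 (m + 1)) id x _ :=
    h3.congr_of_eventuallyEq (Filter.Eventually.of_forall fun x => (hret x).symm)
  exact congrArg (fun f : EuclideanSpace ℝ (Fin (m + 1)) →L[ℝ] EuclideanSpace ℝ (Fin (m + 1)) => f v)
    (hasMFDerivAt_unique h4 (hasMFDerivAt_id x))

/-- Local diffeomorphisms which agree with a map that is injective on an open set `U` glue on `U`. -/
theorem exists_openPartialHomeomorph_of_injOn {X Y : Type*} [TopologicalSpace X]
    [TopologicalSpace Y] {ψ : X → Y} {U : Set X} (hU : IsOpen U) (hinj : InjOn ψ U)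
    (hloc : ∀ x ∈ U, ∃ e : OpenPartialHomeomorph X Y, x ∈ e.source ∧ EqOn e ψ e.source)
    (hX : Nonempty X) :
    ∃ Ψ : OpenPartialHomeomorph X Y, Ψ.source = U ∧ (∀ x, Ψ x = ψ x) := by
  let e := hinj.toPartialEquiv
  have hc : ContinuousOn ψ U := fun x hx => by
    obtain ⟨e, hxe, he⟩ := hloc x hx
    exact ((e.continuousOn.congr he.symm).continuousAt (e.open_source.mem_nhds hxe)).continuousWithinAt
  have ho : ∀ s ⊆ U, IsOpen s → IsOpen (ψ '' s) := by
    intro s hs hso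
    refine isOpen_iff_mem_nhds.mpr ?_
    rintro _ ⟨x, hx, rfl⟩
    obtain ⟨e, hxe, he⟩ := hloc x (hs hx)
    have h1 : IsOpen (e '' (e.source ∩ s)) :=
      e.isOpen_image_of_subset_source (e.open_source.inter hso) inter_subset_left
    refine Filter.mem_of_superset (h1.mem_nhds ⟨x, ⟨hxe, hx⟩, he hxe⟩) ?_
    rintro _ ⟨z, hz, rfl⟩
    exact ⟨z, hz.2, (he hz.1).symm⟩
  refine ⟨OpenPartialHomeomorph.ofContinuousOpenRestrict e hc ?_ hU, rfl, fun x => rfl⟩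
  intro s hs
  obtain ⟨t, ht, rfl⟩ := isOpen_induced_iff.mp hs
  have := ho (U ∩ t) inter_subset_left (hU.inter ht)
  convert! this using 1
  ext y
  constructor
  · rintro ⟨⟨x, hx⟩, hxt, rfl⟩
    exact ⟨x, ⟨hx, hxt⟩, rfl⟩
  · rintro ⟨x, ⟨hx, hxt⟩, rfl⟩
    exact ⟨⟨x, hx⟩, hxt, rfl⟩

variable [IsManifold (𝓡 (m + 1)) ∞ L] [IsManifold (𝓡 d) ∞ M]

/-- A retraction onto `L` with Legendrian fibres induces a diffeomorphism from a neighborhood of `L`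
to an open subset of `ST^*L`. -/
theorem exists_contactLift_openPartialHomeomorph [T2Space M] [SigmaCompactSpace M] [CompactSpace L]
    [Nonempty L] {α : CovectorField d M} (hα : IsContactForm α) (hd : d = 2 * m + 1) {V : Set M}
    {ϖ : M → L} (hV : IsOpen V) (hϖ : ContMDiffOn (𝓡 d) (𝓡 (m + 1)) ∞ ϖ V)
    (hker : ∀ y ∈ V, ∀ v, mfderiv (𝓡 d) (𝓡 (m + 1)) ϖ y v = 0 → α y v = 0) {ι : L → M}
    (hι : ContMDiff (𝓡 (m + 1)) (𝓡 d) ∞ ι) (hret : ∀ x, ϖ (ι x) = x) (hιV : ∀ x, ι x ∈ V) :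
    ∃ Ψ : OpenPartialHomeomorph M (SphereCotangent m L), (∀ x, ι x ∈ Ψ.source) ∧ Ψ.source ⊆ V ∧
      (∀ y, Ψ y = contactLift α ϖ y) ∧ (∀ y ∈ Ψ.source,
        ∀ v, α y v = (quotientCovector α ϖ y).1 (mfderiv (𝓡 d) (𝓡 (m + 1)) ϖ y v)) ∧
      ContMDiffOn (𝓡 d) ((𝓡 (m + 1)).prod (𝓡 m)) ∞ Ψ Ψ.source ∧
      ContMDiffOn ((𝓡 (m + 1)).prod (𝓡 m)) (𝓡 d) ∞ Ψ.symm Ψ.target := by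
  have hsurj : ∀ x, Function.Surjective (mfderiv (𝓡 d) (𝓡 (m + 1)) ϖ (ι x)) := fun x w =>
    ⟨_, mfderiv_mfderiv_of_retraction hV hϖ hι hret (hιV x) w⟩
  choose E hιE hEV hE hEs hEs' using fun x : L =>
    exists_contactLift_diffeo hα hd hV hϖ hker (hιV x) (hsurj x)
  have := Manifold.metrizableSpace (𝓡 d) M
  let _ : MetricSpace M := TopologicalSpace.metrizableSpaceMetric M
  obtain ⟨δ, hδ, hball⟩ := lebesgue_number_lemma_of_metric (isCompact_range hι.continuous)
    (fun x => (E x).open_source) (by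
      rintro _ ⟨x, rfl⟩
      exact mem_iUnion.mpr ⟨x, hιE x⟩)
  -- Points with the same lift have the same `ϖ y`. If both are within a Lebesgue number `δ` of `ι
  -- (ϖ y)`, they lie in one source `(E x).source`, where the lift is injective.
  let U₁ : Set M := V ∩ (fun y => dist y (ι (ϖ y))) ⁻¹' Iio δ
  have hU₁ : IsOpen U₁ := (continuous_dist.comp_continuousOn (continuousOn_id.prodMk
    (hι.continuous.comp_continuousOn hϖ.continuousOn))).isOpen_inter_preimage hV isOpen_Iio
  let U : Set M := U₁ ∩ ⋃ x, (E x).source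
  have hU : IsOpen U := hU₁.inter (isOpen_iUnion fun x => (E x).open_source)
  have hinj : InjOn (contactLift (m := m) α ϖ) U := by
    intro y hy y' hy' h
    have hb : ϖ y = ϖ y' := congrArg SphereCotangent.base h
    obtain ⟨x, hx⟩ := hball (ι (ϖ y)) (mem_range_self _)
    have h1 : y ∈ (E x).source := hx hy.1.2
    have h2 : y' ∈ (E x).source := hx (by
      rw [hb]
      exact hy'.1.2)
    refine (E x).injOn h1 h2 ?_
    rw [(hE x y h1).1, (hE x y' h2).1, h]
  have hloc : ∀ y ∈ U, ∃ x, y ∈ (E x).source := fun y hy => mem_iUnion.mp hy.2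
  obtain ⟨Ψ, hΨU, hΨ⟩ := exists_openPartialHomeomorph_of_injOn hU hinj
    (fun y hy => by
      obtain ⟨x, hx⟩ := hloc y hy
      exact ⟨E x, hx, fun z hz => (hE x z hz).1⟩) ⟨ι (Classical.arbitrary L)⟩
  refine ⟨Ψ, fun x => ?_, ?_, hΨ, ?_, ?_, ?_⟩
  · rw [hΨU]
    refine ⟨⟨hιV x, ?_⟩, mem_iUnion.mpr ⟨x, hιE x⟩⟩
    change dist (ι x) (ι (ϖ (ι x))) < δ
    rwa [hret, dist_self]
  · rw [hΨU]
    exact fun y hy => hy.1.1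
  · intro y hy
    obtain ⟨x, hx⟩ := hloc y (hΨU ▸ hy)
    exact (hE x y hx).2
  · intro y hy
    obtain ⟨x, hx⟩ := hloc y (hΨU ▸ hy)
    refine ContMDiffAt.contMDiffWithinAt ?_
    refine ((hEs x).contMDiffAt ((E x).open_source.mem_nhds hx)).congr_of_eventuallyEq ?_
    filter_upwards [(E x).open_source.mem_nhds hx] with z hz
    rw [hΨ, (hE x z hz).1]
  · intro q hq
    obtain ⟨y, hy, rfl⟩ : ∃ y ∈ Ψ.source, Ψ y = q :=
      ⟨Ψ.symm q, Ψ.map_target hq, Ψ.right_inv hq⟩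
    obtain ⟨x, hx⟩ := hloc y (hΨU ▸ hy)
    have hEx : Ψ y = E x y := by rw [hΨ, (hE x y hx).1]
    have hqx : Ψ y ∈ (E x).target := hEx ▸ (E x).map_source hx
    refine ContMDiffAt.contMDiffWithinAt ?_
    -- Smoothness of the inverse is local: near `Ψ y` it coincides with the smooth inverse of `E x`.
    refine ((hEs' x).contMDiffAt ((E x).open_target.mem_nhds hqx)).congr_of_eventuallyEq ?_
    have h1 : ContinuousAt (E x).symm (Ψ y) := (E x).continuousAt_symm hqx
    have h2 : (E x).symm (Ψ y) = y := by rw [hEx, (E x).left_inv hx]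
    filter_upwards [(E x).open_target.mem_nhds hqx, h1.preimage_mem_nhds
      (Ψ.open_source.mem_nhds (h2.symm ▸ hy))] with z hz hzΨ
    have hzE := (E x).map_target hz
    have h3 : Ψ ((E x).symm z) = z := by rw [hΨ, ← (hE x _ hzE).1, (E x).right_inv hz]
    conv_lhs => rw [← h3]
    exact Ψ.left_inv hzΨ

end Neighborhood

end ContactNbhd
end

noncomputable section

namespace ContactNbhd

/-! ### The contact property and the value on the zero section of the retraction. -/

section Contact

open Set

variable {m d : ℕ} {L : Type*} [TopologicalSpace L]
  [ChartedSpace (EuclideanSpace ℝ (Fin (m + 1))) L]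
  {M : Type*} [TopologicalSpace M] [ChartedSpace (EuclideanSpace ℝ (Fin d)) M]

/-- Composing `α = p ∘ dϖ` with `dι` and using `ϖ ∘ ι = id` gives `ι^*α = p`. The auxiliary `key`
moves `p` from the fibre over `ϖ (ι x)` to the one over `x`. -/
theorem contactLift_eq_ofForm {α : CovectorField d M} {V : Set M} {ϖ : M → L}
    (hV : IsOpen V) (hϖ : ContMDiffOn (𝓡 d) (𝓡 (m + 1)) ∞ ϖ V) {ι : L → M}
    (hι : ContMDiff (𝓡 (m + 1)) (𝓡 d) ∞ ι) (hret : ∀ x, ϖ (ι x) = x) {x : L} (hx : ι x ∈ V)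
    (hα : ∀ v, α (ι x) v =
      (quotientCovector α ϖ (ι x)).1 (mfderiv (𝓡 d) (𝓡 (m + 1)) ϖ (ι x) v))
    (hb : ∀ x, (pullbackForm (k := m + 1) ι α x : TangentSpace (𝓡 (m + 1)) x →L[ℝ] ℝ) ≠ 0) :
    contactLift α ϖ (ι x) = SphereCotangent.ofForm (pullbackForm (k := m + 1) ι α) hb x := by
  have key : ∀ (x' : L) (p' : EuclideanSpace ℝ (Fin (m + 1)) →L[ℝ] ℝ) (hp' : p' ≠ 0)
      (p : EuclideanSpace ℝ (Fin (m + 1)) →L[ℝ] ℝ) (hp : p ≠ 0), x' = x → p' = p →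
      SphereCotangent.mk' (m := m) x' p' hp' = SphereCotangent.mk' x p hp := by
    rintro x' p' hp' p hp rfl rfl
    rfl
  refine key _ _ _ _ _ (hret x) (ContinuousLinearMap.ext fun v => ?_)
  refine Eq.trans ?_ (hα (mfderiv (𝓡 (m + 1)) (𝓡 d) ι x v)).symm
  exact congrArg ((quotientCovector α ϖ (ι x)).1 : EuclideanSpace ℝ (Fin (m + 1)) →L[ℝ] ℝ)
    (mfderiv_mfderiv_of_retraction hV hϖ hι hret hx v).symm

variable [IsManifold (𝓡 (m + 1)) ∞ L]

/-- The inverse of the map induced by a retraction onto `L` with Legendrian fibres is a contact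
diffeomorphism. -/
theorem isContactDiffeo_symm_of_contactLift {α : CovectorField d M} {V : Set M} {ϖ : M → L}
    (hV : IsOpen V) (hϖ : ContMDiffOn (𝓡 d) (𝓡 (m + 1)) ∞ ϖ V)
    {Ψ : OpenPartialHomeomorph M (SphereCotangent m L)} (hΨV : Ψ.source ⊆ V)
    (hΨ : ∀ y, Ψ y = contactLift α ϖ y)
    (hα : ∀ y ∈ Ψ.source,
      ∀ v, α y v = (quotientCovector α ϖ y).1 (mfderiv (𝓡 d) (𝓡 (m + 1)) ϖ y v))
    (hs : ContMDiffOn (𝓡 d) ((𝓡 (m + 1)).prod (𝓡 m)) ∞ Ψ Ψ.source)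
    (hs' : ContMDiffOn ((𝓡 (m + 1)).prod (𝓡 m)) (𝓡 d) ∞ Ψ.symm Ψ.target) :
    SphereCotangent.IsContactDiffeo α Ψ.symm := by
  refine ⟨hs', hs, fun q hq => ?_⟩
  obtain ⟨y, hy, hyq⟩ : ∃ y ∈ Ψ.source, contactLift α ϖ y = q :=
    ⟨Ψ.symm q, Ψ.map_target hq, by rw [← hΨ]; exact Ψ.right_inv hq⟩
  -- Once `q` is literally a lift, its base point is `ϖ y` by definition and the covector needs no
  -- transport.
  subst hyq
  have hq' : contactLift α ϖ y ∈ Ψ.target := hq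
  have hy' : Ψ.symm (contactLift α ϖ y) = y := by rw [← hΨ]; exact Ψ.left_inv hy
  refine ⟨(quotientCovector α ϖ y).1, (quotientCovector α ϖ y).2, rfl,
    ContinuousLinearMap.ext fun v => ?_⟩
  have h1 := ((hs'.contMDiffAt (Ψ.open_target.mem_nhds hq')).mdifferentiableAt
    (by simp)).hasMFDerivAt
  have hyV : Ψ.symm (contactLift α ϖ y) ∈ V := by rw [hy']; exact hΨV hy
  have h2 := ((hϖ.contMDiffAt (hV.mem_nhds hyV)).mdifferentiableAt (by simp)).hasMFDerivAt
  -- The lift covers `ϖ`, so near the point the projection is `ϖ ∘ φ` with `φ = Ψ.symm`; therefore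
  -- `α ∘ dφ = p ∘ dϖ ∘ dφ = p ∘ dπ`.
  have h3 : (SphereCotangent.base : SphereCotangent m L → L) =ᶠ[𝓝 (contactLift α ϖ y)]
      ϖ ∘ Ψ.symm := by
    filter_upwards [Ψ.open_target.mem_nhds hq'] with q hq
    have h := (hΨ (Ψ.symm q)).symm.trans (Ψ.right_inv hq)
    exact (congrArg SphereCotangent.base h).symm
  have h4 := ((h2.comp _ h1).congr_of_eventuallyEq h3).mfderiv
  have h5 : ∀ z (_ : z = y) (w : EuclideanSpace ℝ (Fin d)), α z w =
      ((quotientCovector α ϖ y).1 : EuclideanSpace ℝ (Fin (m + 1)) →L[ℝ] ℝ)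
        (mfderiv (𝓡 d) (𝓡 (m + 1)) ϖ z w) := by
    rintro z rfl w
    exact hα z hy w
  refine (h5 _ hy' _).trans ?_
  exact congrArg (fun f : TangentSpace ((𝓡 (m + 1)).prod (𝓡 m)) (contactLift α ϖ y) →L[ℝ]
    EuclideanSpace ℝ (Fin (m + 1)) =>
    ((quotientCovector α ϖ y).1 : EuclideanSpace ℝ (Fin (m + 1)) →L[ℝ] ℝ) (f v)) h4.symm

end Contact

end ContactNbhd
end
theorem mainTheorem10 (m : ℕ)
    {L : Type*} [TopologicalSpace L] [ChartedSpace (EuclideanSpace ℝ (Fin (m + 1))) L]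
    [IsManifold (𝓡 (m + 1)) ∞ L] [T2Space L] [CompactSpace L] [ConnectedSpace L]
    {M : Type*} [TopologicalSpace M] [ChartedSpace (EuclideanSpace ℝ (Fin (2 * m + 1))) M]
    [IsManifold (𝓡 (2 * m + 1)) ∞ M] [T2Space M] [SecondCountableTopology M]
    (α : ContactNbhd.CovectorField (2 * m + 1) M) (hα : ContactNbhd.IsContactForm α)
    (ι : L → M) (hι : ContactNbhd.IsCoisotropicEmbedding (k := m + 1) α ι)
    (hclosed : ContactNbhd.IsClosedForm (ContactNbhd.pullbackForm (k := m + 1) ι α)) :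
    let β : L → ContactNbhd.SphereCotangent m L :=
      ContactNbhd.SphereCotangent.ofForm (ContactNbhd.pullbackForm (k := m + 1) ι α)
        (hι.pullbackForm_ne_zero hα)
    ∃ φ : OpenPartialHomeomorph (ContactNbhd.SphereCotangent m L) M,
      Set.range β ⊆ φ.source ∧ Set.range ι ⊆ φ.target ∧
        ContactNbhd.SphereCotangent.IsContactDiffeo α φ ∧ φ ∘ β = ι := by
  intro β
  -- Local compactness together with second countability gives the σ-compactness needed for
  -- partitions of unity.
  have : LocallyCompactSpace M :=
    ChartedSpace.locallyCompactSpace (EuclideanSpace ℝ (Fin (2 * m + 1))) M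
  have hsm : ContMDiff (𝓡 (m + 1)) (𝓡 (2 * m + 1)) ∞ ι := hι.isSmoothEmbedding.contMDiff
  obtain ⟨V, ϖ, hV, hιV, hϖ, hret, hker⟩ :=
    ContactNbhd.exists_legendrian_retraction (m := m) rfl (by ring) hα hι hclosed
  obtain ⟨Ψ, hιΨ, hΨV, hΨ, hΨα, hs, hs'⟩ :=
    ContactNbhd.exists_contactLift_openPartialHomeomorph hα rfl hV hϖ hker hsm hret hιV
  have hβ : ∀ x, Ψ (ι x) = β x := fun x => (hΨ (ι x)).trans
    (ContactNbhd.contactLift_eq_ofForm hV hϖ hsm hret (hιV x) (hΨα _ (hιΨ x))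
      (hι.pullbackForm_ne_zero hα))
  refine ⟨Ψ.symm, ?_, ?_, ContactNbhd.isContactDiffeo_symm_of_contactLift hV hϖ hΨV hΨ hΨα hs hs',
    funext fun x => ?_⟩
  · rintro _ ⟨x, rfl⟩
    rw [← hβ x]
    exact Ψ.map_source (hιΨ x)
  · rintro _ ⟨x, rfl⟩
    exact hιΨ x
  · rw [Function.comp_apply, ← hβ x]
    exact Ψ.left_inv (hιΨ x)
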